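/- Let $\mathbb T=(\mathbb C^*)^n$, with Lie algebra $\mathbb C^n=\mathfrak t\oplus i\mathfrak t$, where $\mathfrak t=i\mathbb R^n$ is the Lie algebra of the maximal compact torus $T=(S^1)^n$ and $i\mathfrak t=\mathbb R^n$. Let $(X,\mathbb T)$ be a smooth toric variety of complex dimension $n$, regarded as a complex manifold, and fix a point $x_0$ of the open dense $\mathbb T$-orbit; this gives logarithmic coordinates $z=x+iy\mapsto \exp(z)\cdot x_0$, $z\in\mathbb C^n$, on the open orbit. Let $\Pi$ be a totally real toric Poisson structure on $X$, that is, a real Poisson bivector field which is $\mathbb T$-invariant, of type $(1,1)$ and positive (semidefinite), whose symplectic leaves are exactly the $\mathbb T$-orbits, and for which the $T$-orbits are coisotropic. In logarithmic coordinates $\Pi$ is the inverse of a constant symplectic form $\Xi$ on $\mathbb C^n$; a basis $e_1,\dots,e_n$ of $i\mathfrak t=\mathbb R^n$ is called an adapted Darboux basis if $\Xi(e_j,e_k)=\Xi(ie_j,ie_k)=0$ and $\Xi(e_j,ie_k)=\delta_{jk}$ for all $j,k$. Let $\sigma$ be a Kähler form on $X$ for which the action of $T$ is Hamiltonian, and let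 $P$ be the inverse Poisson bivector field of $\sigma$. A Kähler potential of $\sigma$ is a function $\phi\in C^\infty(\mathbb R^n)$, $\mathbb R^n=i\mathfrak t$, such that in logarithmic coordinates $$\sigma=\tfrac i2\sum_{j,k}\frac{\partial^2\phi}{\partial x_j\partial x_k}(x)\,dz_j\wedge d\bar z_k .$$ The corresponding symplectic potential is the Legendre transform $\phi^*(p)=\sup_x(\langle p,x\rangle-\phi(x))$ on the domain $d\phi(\mathbb R^n)\subset(\mathbb R^n)^*$. A smooth function $f$ with positive definite Hessian $Hf$ on a connected open set $\Omega\subset\mathbb R^n$ has property $\mathcal I$ if $$\frac{\partial}{\partial x_k}(Hf^{-1})_{ij}=\frac{\partial}{\partial x_j}(Hf^{-1})_{ik}\quad\text{on }\Omega,\qquad 1\le i,j,k\le n .$$ Then $\sigma$ has a Kähler potential and $\Pi$ has an adapted Darboux basis, and for every Kähler potential $\phi$ of $\sigma$ and every adapted Darboux basis $e_1,\dots,e_n$ of $\Pi$ the following are equivalent: 1. $\Pi$ and $P$ Poisson commute, i.e. the Schouten bracket $[\Pi,P]$ vanishes on $X$. 2. The Kähler potential $\phi$, written in the linear coordinates of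 the basis $e_1,\dots,e_n$, has property $\mathcal I$ on $\mathbb R^n$. 3. The symplectic potential $\phi^*$, written in the linear coordinates of the dual basis of $e_1,\dots,e_n$, has property $\mathcal I$ on the domain corresponding to $d\phi(\mathbb R^n)$. -/

import Mathlib

open Set
open scoped ContDiff Manifold

noncomputable section

namespace ToricPoisson

/-! ### Strictly convex functions with property `I` -/

/-- The Hessian matrix of a function on `ℝⁿ`. -/
def hessian {n : ℕ} (f : (Fin n → ℝ) → ℝ) (x : Fin n → ℝ) : Matrix (Fin n) (Fin n) ℝ :=
  Matrix.of fun i j =>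
    fderiv ℝ (fun y => fderiv ℝ f y (Pi.single j 1)) x (Pi.single i 1)

/-- A smooth function `f` on a connected open set `Ω ⊆ ℝⁿ` which is strictly convex (its Hessian is
positive definite at every point) has property `I` if
`∂ₖ (Hf⁻¹)ᵢⱼ = ∂ⱼ (Hf⁻¹)ᵢₖ` on `Ω` for all `i, j, k`. -/
structure HasPropertyI {n : ℕ} (Ω : Set (Fin n → ℝ)) (f : (Fin n → ℝ) → ℝ) : Prop where
  isOpen : IsOpen Ω
  isConnected : IsConnected Ω
  smooth : ContDiffOn ℝ ∞ f Ω
  strictlyConvex : ∀ x ∈ Ω, (hessian f x).PosDef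
  symm_deriv : ∀ x ∈ Ω, ∀ i j k : Fin n,
    fderiv ℝ (fun y => (hessian f y)⁻¹ i j) x (Pi.single k 1) =
      fderiv ℝ (fun y => (hessian f y)⁻¹ i k) x (Pi.single j 1)

/-- The Legendre transform of `φ`, a function on the dual space:
`φ*(p) = sup_x (p x - φ x)`. -/
def legendre {n : ℕ} (φ : (Fin n → ℝ) → ℝ) (p : (Fin n → ℝ) →L[ℝ] ℝ) : ℝ :=
  ⨆ x : Fin n → ℝ, (p x - φ x)

/-- The point of `ℝⁿ` with coordinates `x` in the basis `e`. -/
def ofCoords {n : ℕ} (e : Module.Basis (Fin n) ℝ (Fin n → ℝ)) (x : Fin n → ℝ) : Fin n → ℝ :=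
  ∑ i, x i • e i

/-- The covector with coordinates `y` in the basis dual to `e`. -/
def ofDualCoords {n : ℕ} (e : Module.Basis (Fin n) ℝ (Fin n → ℝ)) (y : Fin n → ℝ) :
    (Fin n → ℝ) →L[ℝ] ℝ :=
  ∑ i, y i • LinearMap.toContinuousLinearMap (e.coord i)

/-! ### The complex torus and its Lie algebra -/

/-- The complex torus `𝕋 = (ℂ*)ⁿ`. Its Lie algebra is `ℂⁿ`. The maximal compact torus `T` has Lie
algebra `𝔱 = i ℝⁿ`, so that `i𝔱 = ℝⁿ`. -/
abbrev Torus (n : ℕ) : Type := Fin n → ℂˣ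

/-- The exponential map `ℂⁿ → (ℂ*)ⁿ`. -/
def torusExp {n : ℕ} (z : Fin n → ℂ) : Torus n :=
  fun j => Units.mk0 (Complex.exp (z j)) (Complex.exp_ne_zero _)

/-- The maximal compact torus `T = (S¹)ⁿ`, as a subset of `𝕋`. -/
def compactTorus (n : ℕ) : Set (Torus n) := {t | ∀ j, ‖(t j : ℂ)‖ = 1}

/-- The inclusion `i𝔱 = ℝⁿ → ℂⁿ`. -/
def realVec {n : ℕ} (v : Fin n → ℝ) : Fin n → ℂ := fun j => (v j : ℂ)

/-- The identification `ℝⁿ = i𝔱 → 𝔱 = i ℝⁿ` given by multiplication by `i`. -/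
def imagVec {n : ℕ} (v : Fin n → ℝ) : Fin n → ℂ := fun j => Complex.I * (v j : ℂ)

/-! ### Smooth toric varieties -/

section Toric

variable {n : ℕ} {X : Type*} [TopologicalSpace X] [ChartedSpace (Fin n → ℂ) X]

section Action

variable [MulAction (Torus n) X]

/-- A toric chart: its domain is `𝕋`-invariant, its image is `ℂˢ × (ℂ*)^(n-s)`, and it turns the
action into the diagonal one through an automorphism of the algebraic torus `𝕋` (given by a matrix
`A ∈ GL(n, ℤ)` of characters). -/
def IsToricChart (c : OpenPartialHomeomorph X (Fin n → ℂ)) : Prop :=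
  ∃ (s : Set (Fin n)) (A : Matrix (Fin n) (Fin n) ℤ), IsUnit A.det ∧
    c.target = {z | ∀ i, i ∉ s → z i ≠ 0} ∧
    ∀ (t : Torus n), ∀ x ∈ c.source, t • x ∈ c.source ∧
      ∀ i, c (t • x) i = (∏ j, (t j : ℂ) ^ A i j) * c x i

variable (n X) in
/-- Smooth toric varieties of complex dimension `n`, as complex manifolds with an action of
`𝕋 = (ℂ*)ⁿ`: Hausdorff, with a dense orbit, and covered by finitely many holomorphic toric charts
(the affine toric charts given by the cones of the fan). -/
structure IsSmoothToricVariety : Prop where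
  t2 : T2Space X
  isManifold : IsManifold 𝓘(ℂ, Fin n → ℂ) ω X
  charts : ∃ S : Set (OpenPartialHomeomorph X (Fin n → ℂ)), S.Finite ∧
    S ⊆ IsManifold.maximalAtlas 𝓘(ℂ, Fin n → ℂ) ω X ∧
    (∀ c ∈ S, IsToricChart c) ∧ ∀ x : X, ∃ c ∈ S, x ∈ c.source
  dense_orbit : ∃ x : X, Dense (MulAction.orbit (Torus n) x)

end Action

/-! ### Tensor calculus on the underlying real manifold -/

variable (n) in
/-- The real tangent space at `x`. -/
abbrev T (x : X) : Type := TangentSpace 𝓘(ℝ, Fin n → ℂ) x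

variable (n) in
/-- The real cotangent space at `x`. -/
abbrev Cotangent (x : X) : Type := T n x →L[ℝ] ℝ

variable (n) in
/-- The complex structure `J`, that is, multiplication by `i`. -/
def J (x : X) : T n x →L[ℝ] T n x :=
  (Complex.I • ContinuousLinearMap.id ℝ (Fin n → ℂ) : (Fin n → ℂ) →L[ℝ] (Fin n → ℂ))

variable (n) in
/-- Smooth germs of real functions at `x`. -/
def SmoothAt (f : X → ℝ) (x : X) : Prop := ContMDiffAt 𝓘(ℝ, Fin n → ℂ) 𝓘(ℝ, ℝ) ∞ f x

variable (n) in
/-- The differential of a real function. -/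
def d (f : X → ℝ) (x : X) : Cotangent n x := mfderiv 𝓘(ℝ, Fin n → ℂ) 𝓘(ℝ, ℝ) f x

variable (n X) in
/-- A field of bivectors `Π`, given by the bundle map `Π♯ : T*X → TX`, with
`Π(α, β) = β (Π♯ α)`; so `u ∧ v` is `α ↦ α(u) v - α(v) u`. Antisymmetry and smoothness are
required in `IsBivectorField`. -/
abbrev BivectorField := (x : X) → Cotangent n x →L[ℝ] T n x

variable (n X) in
/-- A field of real alternating `2`-forms. -/
abbrev TwoForm := (x : X) → T n x [⋀^Fin 2]→L[ℝ] ℝ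

/-- The bracket `{f, g} = Π(df, dg)`. -/
def bracket (B : BivectorField n X) (f g : X → ℝ) (x : X) : ℝ := d n g x (B x (d n f x))

/-- A smooth field of bivectors. -/
structure IsBivectorField (B : BivectorField n X) : Prop where
  antisymm : ∀ x (α β : Cotangent n x), β (B x α) = -α (B x β)
  smooth : ∀ x (f g : X → ℝ), SmoothAt n f x → SmoothAt n g x → SmoothAt n (bracket B f g) x

/-- The Schouten bracket of two fields of bivectors evaluated on `df, dg, dh`:
`∑_cyclic ({f, {g, h}_B}_C + {f, {g, h}_C}_B)`. -/
def schouten (B C : BivectorField n X) (f g h : X → ℝ) (x : X) : ℝ :=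
  (bracket C f (bracket B g h) x + bracket C g (bracket B h f) x + bracket C h (bracket B f g) x) +
  (bracket B f (bracket C g h) x + bracket B g (bracket C h f) x + bracket B h (bracket C f g) x)

/-- `[B, C] = 0`: the trivector field `[B, C]` vanishes on the differentials of all germs of smooth
functions at all points. -/
def PoissonCommute (B C : BivectorField n X) : Prop :=
  ∀ (x : X) (f g h : X → ℝ), SmoothAt n f x → SmoothAt n g x → SmoothAt n h x → schouten B C f g h x = 0

/-- A Poisson structure: a smooth field of bivectors `B` with `[B, B] = 0`. -/
structure IsPoisson (B : BivectorField n X) : Prop extends IsBivectorField B where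
  commute_self : PoissonCommute B B

/-- The symplectic leaf of `B` through `x`: the points which can be joined to `x` by a finite
concatenation of integral curves of Hamiltonian vector fields `B♯(df)` of smooth functions. -/
def symplecticLeaf (B : BivectorField n X) (x : X) : Set X :=
  {y | Relation.ReflTransGen (fun p q : X => ∃ (f : X → ℝ) (γ : ℝ → X),
    ContMDiff 𝓘(ℝ, Fin n → ℂ) 𝓘(ℝ, ℝ) ∞ f ∧
    IsMIntegralCurveOn (I := 𝓘(ℝ, Fin n → ℂ)) γ (fun z => B z (d n f z)) (Icc 0 1) ∧
    γ 0 = p ∧ γ 1 = q) x y}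

/-- The contraction `u ↦ ω(u, ·)` of an alternating `2`-form on `ℂⁿ` (as a real vector space). -/
def flat (w : (Fin n → ℂ) [⋀^Fin 2]→L[ℝ] ℝ) :
    (Fin n → ℂ) →L[ℝ] ((Fin n → ℂ) →L[ℝ] ℝ) :=
  LinearMap.toContinuousLinearMap
    { toFun := fun u =>
        (ContinuousAlternatingMap.ofSubsingleton ℝ (Fin n → ℂ) ℝ (0 : Fin 1)).symm (w.curryLeft u)
      map_add' := fun u v => by ext; simp
      map_smul' := fun r u => by ext; simp }

theorem flat_apply (w : (Fin n → ℂ) [⋀^Fin 2]→L[ℝ] ℝ) (u v : Fin n → ℂ) :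
    flat w u v = w ![u, v] := by
  simp only [flat, LinearMap.coe_toContinuousLinearMap', LinearMap.coe_mk, AddHom.coe_mk,
    ContinuousAlternatingMap.ofSubsingleton_symm_apply_apply, ContinuousAlternatingMap.curryLeft_apply_apply]
  congr 1
  ext i : 1
  fin_cases i <;> rfl

/-- The bivector `P` inverse to a nondegenerate `2`-form `w`: `P♯(w(u, ·)) = -u`, equivalently
`P(w(u, ·), w(v, ·)) = w(u, v)`. The inverse of `dx ∧ dy` is `∂x ∧ ∂y`. -/
def IsInverse (Q : ((Fin n → ℂ) →L[ℝ] ℝ) →L[ℝ] (Fin n → ℂ))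
    (w : (Fin n → ℂ) [⋀^Fin 2]→L[ℝ] ℝ) : Prop :=
  ∀ u, Q (flat w u) = -u

/-- The field of bivectors inverse to a nondegenerate `2`-form. -/
def inverseBivector (σ : TwoForm n X) : BivectorField n X :=
  fun x => -(flat (n := n) (σ x)).inverse

/-- The expression of a `2`-form in a chart. -/
def chartForm (σ : TwoForm n X) (c : OpenPartialHomeomorph X (Fin n → ℂ)) (y : Fin n → ℂ) :
    (Fin n → ℂ) [⋀^Fin 2]→L[ℝ] ℝ :=
  (σ (c.symm y)).compContinuousLinearMap
    (mfderiv 𝓘(ℝ, Fin n → ℂ) 𝓘(ℝ, Fin n → ℂ) c.symm y)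

/-- Kähler forms: smooth closed real `2`-forms of type `(1,1)` which are positive. -/
structure IsKahlerForm (σ : TwoForm n X) : Prop where
  smooth : ∀ c ∈ atlas (Fin n → ℂ) X, ContDiffOn ℝ ∞ (chartForm σ c) c.target
  closed : ∀ c ∈ atlas (Fin n → ℂ) X, ∀ y ∈ c.target, extDeriv (chartForm σ c) y = 0
  type_one_one : ∀ x (u v : T n x), σ x ![J n x u, J n x v] = σ x ![u, v]
  pos : ∀ x (v : T n x), v ≠ 0 → 0 < σ x ![v, J n x v]

/-! ### Toric Poisson structures and Hamiltonian Kähler forms -/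

variable [MulAction (Torus n) X]

/-- The fundamental vector field on `X` of an element `ξ` of the Lie algebra `ℂⁿ` of `𝕋`. -/
def fundamentalField (ξ : Fin n → ℂ) (x : X) : T n x :=
  let v : TangentSpace 𝓘(ℝ, Fin n → ℂ) (torusExp ((0 : ℝ) • ξ) • x) :=
    mfderiv 𝓘(ℝ, ℝ) 𝓘(ℝ, Fin n → ℂ) (fun s : ℝ => torusExp (s • ξ) • x) 0 (1 : ℝ)
  v

/-- A toric Poisson structure: `𝕋`-invariant, of type `(1,1)` and positive, with symplectic leaves
equal to the `𝕋`-orbits. -/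
structure IsToricPoisson (B : BivectorField n X) : Prop extends IsPoisson B where
  invariant : ∀ (t : Torus n) (x : X) (α : Cotangent n (t • x)),
    B (t • x) α =
      mfderiv 𝓘(ℝ, Fin n → ℂ) 𝓘(ℝ, Fin n → ℂ) (fun y : X => t • y) x
        (B x (α.comp (mfderiv 𝓘(ℝ, Fin n → ℂ) 𝓘(ℝ, Fin n → ℂ) (fun y : X => t • y) x)))
  type_one_one : ∀ x (α β : Cotangent n x), β (J n x (B x (α.comp (J n x)))) = β (B x α)
  nonneg : ∀ x (α : Cotangent n x), 0 ≤ α (B x (α.comp (J n x)))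
  leaf_eq_orbit : ∀ x, symplecticLeaf B x = MulAction.orbit (Torus n) x

/-- `B` is totally real: the orbits of `T` are coisotropic, that is, `B(α, β) = 0` for any two
covectors vanishing on the tangent space of a `T`-orbit. -/
def IsTotallyReal (B : BivectorField n X) : Prop :=
  ∀ x (α β : Cotangent n x), (∀ v : Fin n → ℝ, α (fundamentalField (imagVec v) x) = 0) →
    (∀ v : Fin n → ℝ, β (fundamentalField (imagVec v) x) = 0) → β (B x α) = 0

/-- The action of `T` is Hamiltonian for `σ`: there is a smooth `T`-invariant momentum map
`μ : X → 𝔱* = ℝⁿ` (`T` is abelian, so equivariance is invariance). -/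
def IsHamiltonianAction (σ : TwoForm n X) : Prop :=
  ∃ μ : X → Fin n → ℝ, (∀ k x, SmoothAt n (fun y => μ y k) x) ∧
    (∀ t ∈ compactTorus n, ∀ x, μ (t • x) = μ x) ∧
    ∀ (v : Fin n → ℝ) (x : X) (w : T n x),
      d n (fun y => ∑ k, v k * μ y k) x w = σ x ![w, fundamentalField (imagVec v) x]

/-! ### Logarithmic coordinates -/

/-- Logarithmic coordinates on the open orbit with base point `x₀`, `z ↦ exp z • x₀`. -/
def logMap (x₀ : X) (z : Fin n → ℂ) : X := torusExp z • x₀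

/-- The differential of `z ↦ exp z • x₀`. -/
def logMapDeriv (x₀ : X) (z : Fin n → ℂ) : (Fin n → ℂ) →L[ℝ] T n (logMap x₀ z) :=
  mfderiv 𝓘(ℝ, Fin n → ℂ) 𝓘(ℝ, Fin n → ℂ) (logMap x₀) z

/-- `φ : i𝔱 = ℝⁿ → ℝ` is a Kähler potential of `σ`: in logarithmic coordinates
`z = x + i y`, one has `σ = 2 i ∂∂̄ φ(x) = (i/2) ∑ (∂²φ/∂xⱼ∂xₖ)(x) dzⱼ ∧ dz̄ₖ`. -/
def IsKahlerPotential (σ : TwoForm n X) (x₀ : X) (φ : (Fin n → ℝ) → ℝ) : Prop :=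
  ContDiff ℝ ∞ φ ∧ ∀ z u v : Fin n → ℂ,
    ((σ (logMap x₀ z) ![logMapDeriv x₀ z u, logMapDeriv x₀ z v] : ℝ) : ℂ) =
      (Complex.I / 2) * ∑ j, ∑ k, (hessian φ (fun l => (z l).re) j k : ℂ) *
        (u j * (starRingEnd ℂ) (v k) - v j * (starRingEnd ℂ) (u k))

/-- The expression of `B` in logarithmic coordinates; for `𝕋`-invariant `B` it does not depend on
the point, and is taken at `0`. -/
def logBivector (B : BivectorField n X) (x₀ : X) :
    ((Fin n → ℂ) →L[ℝ] ℝ) →L[ℝ] (Fin n → ℂ) :=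
  let D : T n (logMap x₀ (0 : Fin n → ℂ)) →L[ℝ] (Fin n → ℂ) := (logMapDeriv x₀ 0).inverse
  LinearMap.toContinuousLinearMap
    { toFun := fun α => D (B (logMap x₀ 0) (α.comp D))
      map_add' := fun α β => by simp [ContinuousLinearMap.add_comp]
      map_smul' := fun r α => by simp [ContinuousLinearMap.smul_comp] }

/-- `e₁, …, eₙ ∈ i𝔱` is an adapted Darboux basis for `B`: `e₁, …, eₙ, i e₁, …, i eₙ` is a Darboux
basis for the constant symplectic form on `𝔱 ⊕ i𝔱 = ℂⁿ` inverse to `B`. -/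
def IsAdaptedDarbouxBasis (B : BivectorField n X) (x₀ : X)
    (e : Module.Basis (Fin n) ℝ (Fin n → ℝ)) : Prop :=
  ∃ w : (Fin n → ℂ) [⋀^Fin 2]→L[ℝ] ℝ, IsInverse (logBivector B x₀) w ∧
    (∀ j k, w ![realVec (e j), realVec (e k)] = 0) ∧
    (∀ j k, w ![imagVec (e j), imagVec (e k)] = 0) ∧
    ∀ j k, w ![realVec (e j), imagVec (e k)] = if j = k then 1 else 0

end Toric

end ToricPoisson

end

/-! On the open orbit everything is read in logarithmic coordinates z = x + iy. By invariance `B` is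
a constant bivector there, and in adapted Darboux coordinates it is ∑ ∂/∂xⱼ ∧ ∂/∂yⱼ. Let ψ be the
Kähler potential written in the adapted basis and H its Hessian. Then σ = ∑ Hⱼₖ dxⱼ ∧ dyₖ, with
inverse ∑ Nⱼₖ ∂/∂xⱼ ∧ ∂/∂yₖ, where N = H⁻¹ depends on x only. The Schouten bracket with a constant
bivector differentiates N alone, and it vanishes exactly when ∂ₖNᵢⱼ = ∂ⱼNᵢₖ
(`schoutenTensor_stdBivector`), which is property I. The open orbit is dense, so vanishing there
extends to X by continuity (`poissonCommute_of_dense`); together this is `poissonCommute_iff`.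

For the Legendre transform, ∇ψ is a diffeomorphism onto its image and the Hessian of ψ* at ∇ψ(x) is
H(x)⁻¹. Expanding derivatives, property I for ψ and for ψ* both say that ∑ₗ ψₐₖₗ (H⁻¹)ₗⱼ is
symmetric in j and k (`symm_deriv_iff`, `hasPropertyI_iff_legendre`).

A Kähler potential exists because the invariant momentum map is a function m of x; type (1,1) makes
its Jacobian symmetric, so m is a gradient (`exists_isKahlerPotential`). For the Darboux basis, `B`
must first be nondegenerate on the open orbit: otherwise the leaf of x₀ would lie in the image of a
real hyperplane, which is smaller than the orbit because the periods of the exponential map are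
countable (`IsToricPoisson.logBivector_surjective`). Coisotropy then makes 𝔱 isotropic for the
inverse form Ξ, type (1,1) does the same for i𝔱, and positivity turns Ξ(a, ib) into an inner product
on i𝔱; any orthonormal basis for it is adapted (`IsTotallyRealBivector.exists_darboux`). -/

noncomputable section

namespace ToricPoisson

/-! ### Inverses of matrix valued functions -/

theorem contDiffAt_det {n : ℕ} {E : Type*} [NormedAddCommGroup E] [NormedSpace ℝ E] {k : ℕ∞ω}
    {A : E → Matrix (Fin n) (Fin n) ℝ} {x : E} (hA : ∀ i j, ContDiffAt ℝ k (fun y => A y i j) x) :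
    ContDiffAt ℝ k (fun y => (A y).det) x := by
  simp only [Matrix.det_apply]
  exact ContDiffAt.sum fun s _ => (contDiffAt_prod fun i _ => hA _ _).const_smul _

/-- Cramer's rule: the entries of the inverse are determinants, of `A` with one row made constant,
divided by det `A`. -/
theorem contDiffAt_matrix_inv {n : ℕ} {E : Type*} [NormedAddCommGroup E] [NormedSpace ℝ E]
    {k : ℕ∞ω} {A : E → Matrix (Fin n) (Fin n) ℝ} {x : E}
    (hA : ∀ i j, ContDiffAt ℝ k (fun y => A y i j) x) (hx : (A x).det ≠ 0) (i j : Fin n) :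
    ContDiffAt ℝ k (fun y => (A y)⁻¹ i j) x := by
  simp only [Matrix.inv_def, Matrix.smul_apply, Ring.inverse_eq_inv', smul_eq_mul,
    Matrix.adjugate_apply]
  refine ((contDiffAt_det hA).inv hx).mul (contDiffAt_det fun a b => ?_)
  by_cases h : a = j
  · subst h; simpa using contDiffAt_const
  · simpa [Matrix.updateRow_ne h] using hA a b

/-- The derivative of `A⁻¹` is `-A⁻¹ A' A⁻¹`. -/
theorem fderiv_matrix_inv {n : ℕ} {E : Type*} [NormedAddCommGroup E] [NormedSpace ℝ E]
    {A : E → Matrix (Fin n) (Fin n) ℝ} {x : E}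
    (hA : ∀ i j, ContDiffAt ℝ 1 (fun y => A y i j) x) (hx : (A x).det ≠ 0) (v : E) (i j : Fin n) :
    fderiv ℝ (fun y => (A y)⁻¹ i j) x v =
      -((A x)⁻¹ * (Matrix.of fun a b => fderiv ℝ (fun y => A y a b) x v) * (A x)⁻¹) i j := by
  set N' : Matrix (Fin n) (Fin n) ℝ := Matrix.of fun a b => fderiv ℝ (fun y => (A y)⁻¹ a b) x v
  set T : Matrix (Fin n) (Fin n) ℝ := Matrix.of fun a b => fderiv ℝ (fun y => A y a b) x v
  have hu : IsUnit (A x).det := isUnit_iff_ne_zero.2 hx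
  have hdA : ∀ i j, DifferentiableAt ℝ (fun y => A y i j) x := fun i j =>
    (hA i j).differentiableAt one_ne_zero
  have hdN : ∀ i j, DifferentiableAt ℝ (fun y => (A y)⁻¹ i j) x := fun i j =>
    (contDiffAt_matrix_inv hA hx i j).differentiableAt one_ne_zero
  -- Differentiate A⁻¹A = 1, an identity valid near `x` because the determinant stays nonzero there.
  have key : N' * A x + (A x)⁻¹ * T = 0 := by
    ext a b
    have h1 : HasFDerivAt (fun y => ((A y)⁻¹ * A y) a b)
        (∑ c, ((A x)⁻¹ a c • fderiv ℝ (fun y => A y c b) x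
          + A x c b • fderiv ℝ (fun y => (A y)⁻¹ a c) x)) x := by
      simp only [Matrix.mul_apply]
      exact HasFDerivAt.fun_sum fun c _ => (hdN a c).hasFDerivAt.mul (hdA c b).hasFDerivAt
    have h2 : (fun y => ((A y)⁻¹ * A y) a b) =ᶠ[nhds x]
        fun _ => (1 : Matrix (Fin n) (Fin n) ℝ) a b := by
      filter_upwards [(contDiffAt_det hA).continuousAt.eventually_ne hx] with y hy
      rw [Matrix.nonsing_inv_mul _ (isUnit_iff_ne_zero.2 hy)]
    have h3 := h1.unique ((hasFDerivAt_const _ x).congr_of_eventuallyEq h2)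
    have h4 := congrArg (fun L : E →L[ℝ] ℝ => L v) h3
    simp only [sum_apply, add_apply, smul_apply, smul_eq_mul, zero_apply] at h4
    simp only [Matrix.add_apply, Matrix.mul_apply, Matrix.zero_apply, N', T, Matrix.of_apply]
    rw [← h4, ← Finset.sum_add_distrib]
    exact Finset.sum_congr rfl fun c _ => by ring
  have h5 : N' = -((A x)⁻¹ * T * (A x)⁻¹) := by
    have := congrArg (· * (A x)⁻¹) (eq_neg_of_add_eq_zero_left key)
    simpa [Matrix.mul_nonsing_inv_cancel_right _ _ hu] using this
  exact congrFun (congrFun h5 i) j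

/-! ### Strictly convex functions and the Legendre transform -/

section Legendre

open Matrix

variable {n : ℕ} {ψ : (Fin n → ℝ) → ℝ}

/-- The gradient of a function on `ℝⁿ`. -/
def grad (ψ : (Fin n → ℝ) → ℝ) (x : Fin n → ℝ) : Fin n → ℝ := fun j => fderiv ℝ ψ x (Pi.single j 1)

theorem fderiv_eq_grad_dotProduct (x v : Fin n → ℝ) : fderiv ℝ ψ x v = grad ψ x ⬝ᵥ v := by
  conv_lhs => rw [pi_eq_sum_univ' v]
  simp [grad, dotProduct, mul_comm]

theorem contDiff_grad (hψ : ContDiff ℝ ∞ ψ) : ContDiff ℝ ∞ (grad ψ) :=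
  contDiff_pi.2 fun _ => (hψ.fderiv_right (m := ∞) le_rfl).clm_apply contDiff_const

theorem contDiff_hessian (hψ : ContDiff ℝ ∞ ψ) (i j : Fin n) :
    ContDiff ℝ ∞ (fun x => hessian ψ x i j) := by
  have h := contDiff_pi.1 (contDiff_grad hψ) j
  exact (h.fderiv_right (m := ∞) le_rfl).clm_apply contDiff_const

theorem fderiv_apply_single_comm {f : (Fin n → ℝ) → ℝ} {x : Fin n → ℝ} (hf : ContDiffAt ℝ 2 f x)
    (i j : Fin n) :
    fderiv ℝ (fun y => fderiv ℝ f y (Pi.single j 1)) x (Pi.single i 1) =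
      fderiv ℝ (fun y => fderiv ℝ f y (Pi.single i 1)) x (Pi.single j 1) := by
  have hd : DifferentiableAt ℝ (fderiv ℝ f) x :=
    (hf.fderiv_right (m := 1) le_rfl).differentiableAt one_ne_zero
  have hs := hf.isSymmSndFDerivAt (by simp)
  rw [fderiv_clm_apply hd (by fun_prop), fderiv_clm_apply hd (by fun_prop)]
  simpa using hs.eq _ _

theorem hessian_isSymm (hψ : ContDiff ℝ ∞ ψ) (x : Fin n → ℝ) : (hessian ψ x).IsSymm := by
  ext i j
  exact fderiv_apply_single_comm (hψ.contDiffAt.of_le (WithTop.coe_le_coe.2 le_top)) j i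

theorem hasFDerivAt_grad (hψ : ContDiff ℝ ∞ ψ) (x : Fin n → ℝ) :
    HasFDerivAt (grad ψ) (Matrix.mulVecLin (hessian ψ x)).toContinuousLinearMap x := by
  refine hasFDerivAt_pi'.2 fun j => ?_
  have h := ((contDiff_pi.1 (contDiff_grad hψ) j).differentiable (by simp) x).hasFDerivAt
  convert h using 1
  ext v
  rw [fderiv_eq_grad_dotProduct]
  simp only [ContinuousLinearMap.comp_apply, LinearMap.coe_toContinuousLinearMap',
    Matrix.mulVecLin_apply, ContinuousLinearMap.proj_apply, Matrix.mulVec, dotProduct]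
  refine Finset.sum_congr rfl fun i _ => ?_
  rw [← (hessian_isSymm hψ x).apply]
  rfl

theorem hasDerivAt_grad_line (hψ : ContDiff ℝ ∞ ψ) (x v : Fin n → ℝ) (t : ℝ) :
    HasDerivAt (fun t : ℝ => grad ψ (x + t • v) ⬝ᵥ v) (v ⬝ᵥ (hessian ψ (x + t • v) *ᵥ v)) t := by
  have hl : HasDerivAt (fun t : ℝ => x + t • v) v t := by
    simpa using ((hasDerivAt_id t).smul_const v).const_add x
  have h1 := hasDerivAt_pi.1 ((hasFDerivAt_grad hψ (x + t • v)).comp_hasDerivAt t hl)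
  rw [dotProduct_comm]
  exact HasDerivAt.fun_sum fun i _ => (h1 i).mul_const (v i)

/-- The derivative along the line is the Hessian quadratic form evaluated at `v`. -/
theorem strictMono_grad_line (hψ : ContDiff ℝ ∞ ψ) (hpos : ∀ x, (hessian ψ x).PosDef)
    (x : Fin n → ℝ) {v : Fin n → ℝ} (hv : v ≠ 0) :
    StrictMono fun t : ℝ => grad ψ (x + t • v) ⬝ᵥ v :=
  strictMono_of_deriv_pos fun t => by
    rw [(hasDerivAt_grad_line hψ x v t).deriv]
    simpa using (hpos (x + t • v)).dotProduct_mulVec_pos hv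

/-- On the segment joining two points with the same gradient, the directional derivative would take
equal values at both ends, against strict monotonicity. -/
theorem grad_injective (hψ : ContDiff ℝ ∞ ψ) (hpos : ∀ x, (hessian ψ x).PosDef) :
    Function.Injective (grad ψ) := fun x y h => by
  by_contra hxy
  have := strictMono_grad_line hψ hpos x (sub_ne_zero.2 (Ne.symm hxy)) (zero_lt_one (α := ℝ))
  simp [h] at this

/-- A convex function lies above its tangents. -/
theorem grad_dotProduct_sub_le (hψ : ContDiff ℝ ∞ ψ) (hpos : ∀ x, (hessian ψ x).PosDef)
    (x y : Fin n → ℝ) : grad ψ x ⬝ᵥ (y - x) ≤ ψ y - ψ x := by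
  rcases eq_or_ne y x with rfl | hxy
  · simp
  set v := y - x
  have hd : ∀ t : ℝ, HasDerivAt (fun t : ℝ => ψ (x + t • v)) (grad ψ (x + t • v) ⬝ᵥ v) t := by
    intro t
    have hl : HasDerivAt (fun t : ℝ => x + t • v) v t := by
      simpa using ((hasDerivAt_id t).smul_const v).const_add x
    rw [← fderiv_eq_grad_dotProduct]
    exact ((hψ.differentiable (by simp)) (x + t • v)).hasFDerivAt.comp_hasDerivAt t hl
  -- Mean value theorem: the increment of ψ is the directional derivative at some `c` > 0, which is
  -- at least the one at 0.
  obtain ⟨c, hc, h⟩ := exists_deriv_eq_slope (fun t : ℝ => ψ (x + t • v)) zero_lt_one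
    (fun t _ => (hd t).continuousAt.continuousWithinAt)
    (fun t _ => (hd t).differentiableAt.differentiableWithinAt)
  rw [(hd c).deriv] at h
  have h2 := (strictMono_grad_line hψ hpos x (sub_ne_zero.2 hxy)).monotone hc.1.le
  simp only [zero_smul, add_zero, one_smul, sub_zero, div_one] at h h2
  have h3 : x + v = y := add_sub_cancel x y
  rw [h3] at h
  rw [← h]
  exact h2

/-- By the tangent inequality the supremum is attained at `x` itself. The upper bound is needed
explicitly, since a real supremum of an unbounded family has a default value. -/
theorem legendre_grad (hψ : ContDiff ℝ ∞ ψ) (hpos : ∀ x, (hessian ψ x).PosDef) (x : Fin n → ℝ) :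
    ⨆ y, (grad ψ x ⬝ᵥ y - ψ y) = grad ψ x ⬝ᵥ x - ψ x := by
  have h : ∀ y, grad ψ x ⬝ᵥ y - ψ y ≤ grad ψ x ⬝ᵥ x - ψ x := fun y => by
    have := grad_dotProduct_sub_le hψ hpos x y
    rw [dotProduct_sub] at this
    linarith
  exact le_antisymm (ciSup_le h) (le_ciSup (f := fun y => grad ψ x ⬝ᵥ y - ψ y)
    ⟨_, forall_mem_range.2 h⟩ x)

/-- The Hessian of a strictly convex function as a continuous linear equivalence. -/
def hessianEquiv {x : Fin n → ℝ} (hx : (hessian ψ x).PosDef) : (Fin n → ℝ) ≃L[ℝ] (Fin n → ℝ) :=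
  (LinearEquiv.ofInjectiveEndo (mulVecLin (hessian ψ x))
    (mulVec_injective_of_isUnit hx.isUnit)).toContinuousLinearEquiv

theorem hasFDerivAt_grad_equiv (hψ : ContDiff ℝ ∞ ψ) {x : Fin n → ℝ} (hx : (hessian ψ x).PosDef) :
    HasFDerivAt (grad ψ) (hessianEquiv hx : (Fin n → ℝ) →L[ℝ] (Fin n → ℝ)) x :=
  hasFDerivAt_grad hψ x

theorem hessianEquiv_symm_apply {x : Fin n → ℝ} (hx : (hessian ψ x).PosDef) (v : Fin n → ℝ) :
    (hessianEquiv hx).symm v = (hessian ψ x)⁻¹ *ᵥ v := by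
  rw [ContinuousLinearEquiv.symm_apply_eq]
  change v = hessian ψ x *ᵥ ((hessian ψ x)⁻¹ *ᵥ v)
  rw [mulVec_mulVec, mul_nonsing_inv _ (isUnit_iff_ne_zero.2 hx.det_pos.ne'), one_mulVec]

/-- The inverse function theorem makes the gradient an open map, since its derivative is the
invertible Hessian; injectivity is global by convexity. -/
theorem isOpenEmbedding_grad (hψ : ContDiff ℝ ∞ ψ) (hpos : ∀ x, (hessian ψ x).PosDef) :
    Topology.IsOpenEmbedding (grad ψ) :=
  .of_continuous_injective_isOpenMap (contDiff_grad hψ).continuous (grad_injective hψ hpos)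
    (isOpenMap_of_hasStrictFDerivAt_equiv (f' := fun x => hessianEquiv (hpos x)) fun x =>
      (contDiff_grad hψ).contDiffAt.hasStrictFDerivAt' (hasFDerivAt_grad_equiv hψ (hpos x))
        (by simp))

/-- The gradient of a strictly convex function as a diffeomorphism onto its image. -/
def gradHomeo (hψ : ContDiff ℝ ∞ ψ) (hpos : ∀ x, (hessian ψ x).PosDef) :
    OpenPartialHomeomorph (Fin n → ℝ) (Fin n → ℝ) :=
  (isOpenEmbedding_grad hψ hpos).toOpenPartialHomeomorph (grad ψ)

theorem gradHomeo_target (hψ : ContDiff ℝ ∞ ψ) (hpos : ∀ x, (hessian ψ x).PosDef) :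
    (gradHomeo hψ hpos).target = range (grad ψ) :=
  Topology.IsOpenEmbedding.toOpenPartialHomeomorph_target ..

theorem gradHomeo_symm_grad (hψ : ContDiff ℝ ∞ ψ) (hpos : ∀ x, (hessian ψ x).PosDef)
    (x : Fin n → ℝ) : (gradHomeo hψ hpos).symm (grad ψ x) = x :=
  (gradHomeo hψ hpos).left_inv (x := x) (mem_univ _)

theorem hasFDerivAt_gradHomeo_symm (hψ : ContDiff ℝ ∞ ψ) (hpos : ∀ x, (hessian ψ x).PosDef)
    (x : Fin n → ℝ) :
    HasFDerivAt (gradHomeo hψ hpos).symm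
      ((hessianEquiv (hpos x)).symm : (Fin n → ℝ) →L[ℝ] (Fin n → ℝ)) (grad ψ x) := by
  refine OpenPartialHomeomorph.hasFDerivAt_symm _ ?_ ?_
  · rw [gradHomeo_target]; exact mem_range_self x
  · rw [gradHomeo_symm_grad]; exact hasFDerivAt_grad_equiv hψ (hpos x)

theorem contDiffAt_gradHomeo_symm (hψ : ContDiff ℝ ∞ ψ) (hpos : ∀ x, (hessian ψ x).PosDef)
    (x : Fin n → ℝ) :
    ContDiffAt ℝ ∞ (gradHomeo hψ hpos).symm (grad ψ x) := by
  refine OpenPartialHomeomorph.contDiffAt_symm _ (f₀' := hessianEquiv (hpos x)) ?_ ?_ ?_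
  · rw [gradHomeo_target]; exact mem_range_self x
  · rw [gradHomeo_symm_grad]; exact hasFDerivAt_grad_equiv hψ (hpos x)
  · exact (contDiff_grad hψ).contDiffAt

theorem range_grad_mem_nhds (hψ : ContDiff ℝ ∞ ψ) (hpos : ∀ x, (hessian ψ x).PosDef)
    (x : Fin n → ℝ) : range (grad ψ) ∈ nhds (grad ψ x) :=
  (isOpenEmbedding_grad hψ hpos).isOpen_range.mem_nhds (mem_range_self x)

theorem legendre_eq (hψ : ContDiff ℝ ∞ ψ) (hpos : ∀ x, (hessian ψ x).PosDef)
    {y : Fin n → ℝ} (hy : y ∈ range (grad ψ)) :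
    ⨆ x, (y ⬝ᵥ x - ψ x) = y ⬝ᵥ (gradHomeo hψ hpos).symm y - ψ ((gradHomeo hψ hpos).symm y) := by
  obtain ⟨x, rfl⟩ := hy
  rw [gradHomeo_symm_grad, legendre_grad hψ hpos]

theorem contDiffAt_legendre (hψ : ContDiff ℝ ∞ ψ) (hpos : ∀ x, (hessian ψ x).PosDef)
    (x : Fin n → ℝ) :
    ContDiffAt ℝ ∞ (fun y => ⨆ x, (y ⬝ᵥ x - ψ x)) (grad ψ x) := by
  have hG := contDiffAt_gradHomeo_symm hψ hpos x
  have h1 : ContDiffAt ℝ ∞ (fun y => y ⬝ᵥ (gradHomeo hψ hpos).symm y) (grad ψ x) :=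
    ContDiffAt.sum fun i _ => (contDiffAt_pi.1 contDiffAt_id i).mul (contDiffAt_pi.1 hG i)
  refine (h1.sub (hψ.contDiffAt.comp _ hG)).congr_of_eventuallyEq ?_
  filter_upwards [range_grad_mem_nhds hψ hpos x] with y hy using legendre_eq hψ hpos hy

/-- Write G for the inverse of ∇ψ. In the derivative of y·G(y) − ψ(G(y)) the two terms containing DG
cancel because ∇ψ(G(y)) = y, and G(y) remains. -/
theorem grad_legendre (hψ : ContDiff ℝ ∞ ψ) (hpos : ∀ x, (hessian ψ x).PosDef) (x : Fin n → ℝ) :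
    grad (fun y => ⨆ x, (y ⬝ᵥ x - ψ x)) (grad ψ x) = x := by
  -- The derivative of the inverse is kept abstract, since it drops out.
  obtain ⟨L, hG⟩ : ∃ L : (Fin n → ℝ) →L[ℝ] (Fin n → ℝ),
      HasFDerivAt (gradHomeo hψ hpos).symm L (grad ψ x) := ⟨_, hasFDerivAt_gradHomeo_symm hψ hpos x⟩
  have h1 : HasFDerivAt (fun y => y ⬝ᵥ (gradHomeo hψ hpos).symm y)
      (∑ i, (grad ψ x i • (ContinuousLinearMap.proj i ∘L L) +
        (gradHomeo hψ hpos).symm (grad ψ x) i • ContinuousLinearMap.proj i)) (grad ψ x) :=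
    HasFDerivAt.fun_sum fun i _ =>
      (hasFDerivAt_apply (𝕜 := ℝ) i (grad ψ x)).mul (hasFDerivAt_pi'.1 hG i)
  have h2 := ((hψ.differentiable (by simp)) ((gradHomeo hψ hpos).symm (grad ψ x))).hasFDerivAt.comp
    (grad ψ x) hG
  have h3 := (h1.sub h2).congr_of_eventuallyEq (f₁ := fun y => ⨆ x, (y ⬝ᵥ x - ψ x)) (by
    filter_upwards [range_grad_mem_nhds hψ hpos x] with y hy using legendre_eq hψ hpos hy)
  ext j
  rw [grad, h3.fderiv, gradHomeo_symm_grad]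
  simp [fderiv_eq_grad_dotProduct, Finset.sum_add_distrib, dotProduct, Pi.single_apply]

/-- Near ∇ψ(x) the gradient of the transform is the inverse map of ∇ψ, so its Jacobian is the
inverse of the Hessian. -/
theorem hessian_legendre (hψ : ContDiff ℝ ∞ ψ) (hpos : ∀ x, (hessian ψ x).PosDef) (x : Fin n → ℝ) :
    hessian (fun y => ⨆ x, (y ⬝ᵥ x - ψ x)) (grad ψ x) = (hessian ψ x)⁻¹ := by
  ext i j
  have h : (fun y => grad (fun y => ⨆ x, (y ⬝ᵥ x - ψ x)) y j) =ᶠ[nhds (grad ψ x)]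
      fun y => (gradHomeo hψ hpos).symm y j := by
    filter_upwards [range_grad_mem_nhds hψ hpos x] with y ⟨z, hz⟩
    rw [← hz, grad_legendre hψ hpos, gradHomeo_symm_grad]
  have h2 := (hasFDerivAt_pi'.1 (hasFDerivAt_gradHomeo_symm hψ hpos x) j).congr_of_eventuallyEq h
  change fderiv ℝ (fun y => grad (fun y => ⨆ x, (y ⬝ᵥ x - ψ x)) y j) (grad ψ x) _ = _
  rw [h2.fderiv]
  simp only [ContinuousLinearMap.comp_apply, ContinuousLinearEquiv.coe_coe,
    hessianEquiv_symm_apply, ContinuousLinearMap.proj_apply, mulVec_single_one, col_apply]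
  rw [← (hpos x).inv.isHermitian.apply i j]
  rfl

/-! ### Third derivatives and the invariance of property I -/

/-- The matrix of derivatives of the entries of the Hessian in the direction of a basis vector. -/
def thirdDeriv (ψ : (Fin n → ℝ) → ℝ) (x : Fin n → ℝ) (k : Fin n) : Matrix (Fin n) (Fin n) ℝ :=
  of fun a b => fderiv ℝ (fun y => hessian ψ y a b) x (Pi.single k 1)

theorem thirdDeriv_symm (hψ : ContDiff ℝ ∞ ψ) (x : Fin n → ℝ) (k a b : Fin n) :
    thirdDeriv ψ x k a b = thirdDeriv ψ x k b a := by
  simp only [thirdDeriv, of_apply]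
  congr 2
  ext y
  exact ((hessian_isSymm hψ y).apply a b).symm

/-- Together with `thirdDeriv_symm` this makes the third derivatives totally symmetric. -/
theorem thirdDeriv_swap (hψ : ContDiff ℝ ∞ ψ) (x : Fin n → ℝ) (k a b : Fin n) :
    thirdDeriv ψ x k a b = thirdDeriv ψ x a k b :=
  fderiv_apply_single_comm
    (((contDiff_pi.1 (contDiff_grad hψ) b).contDiffAt).of_le (WithTop.coe_le_coe.2 le_top)) k a

/-- The derivative of H⁻¹ in direction k is −H⁻¹TₖH⁻¹. The left factor H⁻¹ does not involve j or k
and is invertible, so it can be cancelled. -/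
theorem symm_deriv_iff (hψ : ContDiff ℝ ∞ ψ) (hpos : ∀ x, (hessian ψ x).PosDef) (x : Fin n → ℝ) :
    (∀ i j k : Fin n, fderiv ℝ (fun y => (hessian ψ y)⁻¹ i j) x (Pi.single k 1) =
      fderiv ℝ (fun y => (hessian ψ y)⁻¹ i k) x (Pi.single j 1)) ↔
    ∀ a j k, (thirdDeriv ψ x k * (hessian ψ x)⁻¹) a j =
      (thirdDeriv ψ x j * (hessian ψ x)⁻¹) a k := by
  have hu : IsUnit (hessian ψ x).det := isUnit_iff_ne_zero.2 (hpos x).det_pos.ne'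
  have hf : ∀ i j k, fderiv ℝ (fun y => (hessian ψ y)⁻¹ i j) x (Pi.single k 1) =
      -((hessian ψ x)⁻¹ * (thirdDeriv ψ x k * (hessian ψ x)⁻¹)) i j := fun i j k => by
    rw [fderiv_matrix_inv (fun a b => (contDiff_hessian hψ a b).contDiffAt.of_le
      (WithTop.coe_le_coe.2 le_top)) (hpos x).det_pos.ne', ← Matrix.mul_assoc]
    rfl
  simp only [hf, neg_inj]
  constructor
  · intro h a j k
    have e : ∀ j k, (thirdDeriv ψ x k * (hessian ψ x)⁻¹) a j =
        ∑ i, hessian ψ x a i * ((hessian ψ x)⁻¹ * (thirdDeriv ψ x k * (hessian ψ x)⁻¹)) i j :=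
      fun j k => by rw [← mul_apply, mul_nonsing_inv_cancel_left _ _ hu]
    rw [e, e]
    exact Finset.sum_congr rfl fun i _ => by rw [h]
  · intro h i j k
    rw [mul_apply, mul_apply]
    exact Finset.sum_congr rfl fun a _ => by rw [h]

/-- Property `I` is invariant under the Legendre transform. -/
theorem hasPropertyI_iff_legendre (hψ : ContDiff ℝ ∞ ψ) (hpos : ∀ x, (hessian ψ x).PosDef) :
    HasPropertyI univ ψ ↔ HasPropertyI (range (grad ψ)) (fun y => ⨆ x, (y ⬝ᵥ x - ψ x)) := by
  -- The inverse Hessian of ψ* is H composed with the inverse of ∇ψ. The chain rule gives ∑ₗ ∂ₗHᵢⱼ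
  -- (H⁻¹)ₗₖ, and total symmetry lets j become the direction of differentiation.
  have hstar : ∀ x i j k, fderiv ℝ (fun y => (hessian (fun y => ⨆ x, (y ⬝ᵥ x - ψ x)) y)⁻¹ i j)
      (grad ψ x) (Pi.single k 1) = (thirdDeriv ψ x j * (hessian ψ x)⁻¹) i k := fun x i j k => by
    have h : (fun y => (hessian (fun y => ⨆ x, (y ⬝ᵥ x - ψ x)) y)⁻¹ i j) =ᶠ[nhds (grad ψ x)]
        fun y => hessian ψ ((gradHomeo hψ hpos).symm y) i j := by
      filter_upwards [range_grad_mem_nhds hψ hpos x] with y ⟨z, hz⟩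
      rw [← hz, hessian_legendre hψ hpos, gradHomeo_symm_grad,
        nonsing_inv_nonsing_inv _ (isUnit_iff_ne_zero.2 (hpos z).det_pos.ne')]
    have hd := ((contDiff_hessian hψ i j).differentiable (by simp)
      ((gradHomeo hψ hpos).symm (grad ψ x))).hasFDerivAt.comp (grad ψ x)
      (hasFDerivAt_gradHomeo_symm hψ hpos x)
    rw [(hd.congr_of_eventuallyEq h).fderiv, gradHomeo_symm_grad]
    simp only [ContinuousLinearMap.comp_apply, ContinuousLinearEquiv.coe_coe,
      hessianEquiv_symm_apply, mulVec_single_one]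
    rw [fderiv_eq_grad_dotProduct, mul_apply]
    refine Finset.sum_congr rfl fun l _ => ?_
    rw [col_apply]
    congr 1
    rw [← thirdDeriv_symm hψ x j l i, ← thirdDeriv_swap hψ x l j i, ← thirdDeriv_symm hψ x l i j]
    rfl
  constructor
  · intro h
    refine ⟨(isOpenEmbedding_grad hψ hpos).isOpen_range,
      isConnected_range (contDiff_grad hψ).continuous, ?_, ?_, ?_⟩
    · rintro _ ⟨x, rfl⟩
      exact (contDiffAt_legendre hψ hpos x).contDiffWithinAt
    · rintro _ ⟨x, rfl⟩
      rw [hessian_legendre hψ hpos]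
      exact (hpos x).inv
    · rintro _ ⟨x, rfl⟩ i j k
      rw [hstar, hstar]
      exact (symm_deriv_iff hψ hpos x).1 (h.symm_deriv x (mem_univ x)) i k j
  · intro h
    refine ⟨isOpen_univ, isConnected_univ, hψ.contDiffOn, fun x _ => hpos x, fun x _ => ?_⟩
    refine (symm_deriv_iff hψ hpos x).2 fun a j k => ?_
    have := h.symm_deriv (grad ψ x) (mem_range_self x) a k j
    rwa [hstar, hstar] at this

end Legendre

/-! ### The real manifold underlying a complex manifold -/

section RestrictScalars

variable {E F : Type*} [NormedAddCommGroup E] [NormedSpace ℂ E] [NormedAddCommGroup F]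
  [NormedSpace ℂ F] {M N : Type*} [TopologicalSpace M] [ChartedSpace E M] [TopologicalSpace N]
  [ChartedSpace F N]

theorem isManifold_restrictScalars [h : IsManifold 𝓘(ℂ, E) ω M] : IsManifold 𝓘(ℝ, E) ω M :=
  isManifold_of_contDiffOn _ _ _ fun e e' he he' => by
    have h1 := (contDiffGroupoid ω 𝓘(ℂ, E)).compatible he he'
    exact ContDiffOn.restrict_scalars ℝ h1.1

theorem ContMDiffAt.restrictScalars {k : ℕ∞ω} {f : M → N} {x : M}
    (h : ContMDiffAt 𝓘(ℂ, E) 𝓘(ℂ, F) k f x) : ContMDiffAt 𝓘(ℝ, E) 𝓘(ℝ, F) k f x := by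
  rw [contMDiffAt_iff] at h ⊢
  exact ⟨h.1, h.2.restrict_scalars ℝ⟩

/-- This supplies the complex linearity of real differentials of holomorphic maps, hence their
compatibility with multiplication by i. -/
theorem exists_hasMFDerivAt_restrictScalars {f : M → N} {x : M}
    (h : MDifferentiableAt 𝓘(ℂ, E) 𝓘(ℂ, F) f x) :
    ∃ L : E →L[ℂ] F, HasMFDerivAt 𝓘(ℝ, E) 𝓘(ℝ, F) f x (L.restrictScalars ℝ) :=
  ⟨mfderiv 𝓘(ℂ, E) 𝓘(ℂ, F) f x, h.hasMFDerivAt.1, h.hasMFDerivAt.2.restrictScalars ℝ⟩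

end RestrictScalars

section Bivectors

variable {n : ℕ} {X : Type*} [TopologicalSpace X] [ChartedSpace (Fin n → ℂ) X]

/-! ### Brackets in local parametrizations -/

variable (n) in
/-- Bivectors on `ℂⁿ`, as maps from covectors to vectors. -/
abbrev Bivector : Type := ((Fin n → ℂ) →L[ℝ] ℝ) →L[ℝ] (Fin n → ℂ)

/-- The linear map `L` sends the bivector `Q` to the bivector `R`. -/
def Related (L : (Fin n → ℂ) →L[ℝ] (Fin n → ℂ)) (Q R : Bivector n) : Prop :=
  ∀ α : (Fin n → ℂ) →L[ℝ] ℝ, L (Q (α.comp L)) = R α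

theorem Related.comp {L L' : (Fin n → ℂ) →L[ℝ] (Fin n → ℂ)} {Q R S : Bivector n}
    (h : Related L Q R) (h' : Related L' R S) : Related (L'.comp L) Q S := fun α => by
  rw [← h' α, ← h (α.comp L')]
  rfl

variable (n) in
/-- The differential of a function in the coordinates of the preferred chart. -/
def covector (f : X → ℝ) (x : X) : (Fin n → ℂ) →L[ℝ] ℝ := d n f x

theorem hasFDerivAt_comp {ψ : (Fin n → ℂ) → X} {z : Fin n → ℂ}
    {L : (Fin n → ℂ) →L[ℝ] (Fin n → ℂ)} (hψ : HasMFDerivAt 𝓘(ℝ, Fin n → ℂ) 𝓘(ℝ, Fin n → ℂ) ψ z L)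
    {f : X → ℝ} (hf : MDifferentiableAt 𝓘(ℝ, Fin n → ℂ) 𝓘(ℝ, ℝ) f (ψ z)) :
    HasFDerivAt (f ∘ ψ) ((covector n f (ψ z)).comp L) z :=
  (hf.hasMFDerivAt.comp z hψ).hasFDerivAt

/-- The parametrization need not be injective, so this serves both inverse charts and the
exponential covering of the open orbit. -/
theorem bracket_apply {B : BivectorField n X} {ψ : (Fin n → ℂ) → X} {z : Fin n → ℂ}
    {L : (Fin n → ℂ) →L[ℝ] (Fin n → ℂ)} (hψ : HasMFDerivAt 𝓘(ℝ, Fin n → ℂ) 𝓘(ℝ, Fin n → ℂ) ψ z L)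
    {Q : Bivector n} (hQ : Related L Q (B (ψ z))) {f g : X → ℝ}
    (hf : MDifferentiableAt 𝓘(ℝ, Fin n → ℂ) 𝓘(ℝ, ℝ) f (ψ z))
    (hg : MDifferentiableAt 𝓘(ℝ, Fin n → ℂ) 𝓘(ℝ, ℝ) g (ψ z)) :
    bracket B f g (ψ z) = fderiv ℝ (g ∘ ψ) z (Q (fderiv ℝ (f ∘ ψ) z)) := by
  rw [(hasFDerivAt_comp hψ hf).fderiv, (hasFDerivAt_comp hψ hg).fderiv,
    ContinuousLinearMap.comp_apply, hQ]
  rfl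

/-- The Schouten bracket of two fields of bivectors on `ℂⁿ` as a trilinear form. -/
def schoutenTensor (Q R : (Fin n → ℂ) → Bivector n) (z : Fin n → ℂ)
    (α β γ : (Fin n → ℂ) →L[ℝ] ℝ) : ℝ :=
  (γ (fderiv ℝ Q z (R z α) β) + α (fderiv ℝ Q z (R z β) γ) + β (fderiv ℝ Q z (R z γ) α)) +
  (γ (fderiv ℝ R z (Q z α) β) + α (fderiv ℝ R z (Q z β) γ) + β (fderiv ℝ R z (Q z γ) α))

/-- Leibniz rule for dh(Q dg). Antisymmetry of `Q` moves the second derivative of `g` onto Q dh,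
whence the minus sign. -/
theorem fderiv_bracket_apply {Q : (Fin n → ℂ) → Bivector n} {z : Fin n → ℂ}
    (hQ : DifferentiableAt ℝ Q z)
    (hanti : ∀ α β : (Fin n → ℂ) →L[ℝ] ℝ, β (Q z α) = -α (Q z β)) {g h : (Fin n → ℂ) → ℝ}
    (hg : ContDiffAt ℝ 2 g z) (hh : ContDiffAt ℝ 2 h z) (v : Fin n → ℂ) :
    fderiv ℝ (fun w => fderiv ℝ h w (Q w (fderiv ℝ g w))) z v =
      fderiv ℝ (fderiv ℝ h) z v (Q z (fderiv ℝ g z)) -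
        fderiv ℝ (fderiv ℝ g) z v (Q z (fderiv ℝ h z))
        + fderiv ℝ h z (fderiv ℝ Q z v (fderiv ℝ g z)) := by
  have hdg : DifferentiableAt ℝ (fderiv ℝ g) z :=
    (hg.fderiv_right (m := 1) le_rfl).differentiableAt one_ne_zero
  have hdh : DifferentiableAt ℝ (fderiv ℝ h) z :=
    (hh.fderiv_right (m := 1) le_rfl).differentiableAt one_ne_zero
  rw [fderiv_clm_apply hdh (hQ.clm_apply hdg), fderiv_clm_apply hQ hdg]
  simp only [add_apply, ContinuousLinearMap.comp_apply, ContinuousLinearMap.flip_apply, map_add]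
  rw [hanti (fderiv ℝ (fderiv ℝ g) z v) (fderiv ℝ h z)]
  ring

variable [IsManifold 𝓘(ℝ, Fin n → ℂ) ω X]

theorem SmoothAt.eventually_mdifferentiableAt {f : X → ℝ} {x : X} (hf : SmoothAt n f x) :
    ∀ᶠ y in nhds x, MDifferentiableAt 𝓘(ℝ, Fin n → ℂ) 𝓘(ℝ, ℝ) f y := by
  have : IsManifold 𝓘(ℝ, Fin n → ℂ) 1 X := .of_le (n := ω) le_top
  have h1 : ContMDiffAt 𝓘(ℝ, Fin n → ℂ) 𝓘(ℝ, ℝ) 1 f x := ContMDiffAt.of_le hf (by simp)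
  filter_upwards [(contMDiffAt_iff_contMDiffAt_nhds (by simp)).1 h1] with y hy
    using hy.mdifferentiableAt one_ne_zero

theorem eventually_bracket_apply {B : BivectorField n X} {ψ : (Fin n → ℂ) → X} {z : Fin n → ℂ}
    (hψ : ContinuousAt ψ z) {L : (Fin n → ℂ) → (Fin n → ℂ) →L[ℝ] (Fin n → ℂ)}
    (hL : ∀ᶠ w in nhds z, HasMFDerivAt 𝓘(ℝ, Fin n → ℂ) 𝓘(ℝ, Fin n → ℂ) ψ w (L w))
    {Q : (Fin n → ℂ) → Bivector n} (hQ : ∀ᶠ w in nhds z, Related (L w) (Q w) (B (ψ w)))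
    {f g : X → ℝ} (hf : SmoothAt n f (ψ z)) (hg : SmoothAt n g (ψ z)) :
    (bracket B f g ∘ ψ) =ᶠ[nhds z] fun w => fderiv ℝ (g ∘ ψ) w (Q w (fderiv ℝ (f ∘ ψ) w)) := by
  filter_upwards [hL, hQ, hψ.eventually hf.eventually_mdifferentiableAt,
    hψ.eventually hg.eventually_mdifferentiableAt] with w h1 h2 h3 h4
  exact bracket_apply h1 h2 h3 h4

/-- In the cyclic sums the second derivatives of the three functions cancel, and only the terms with
a derivative of a bivector remain. This is the tensoriality of the Schouten bracket. -/
theorem schouten_eq_schoutenTensor {B C : BivectorField n X} (hB : IsBivectorField B)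
    (hC : IsBivectorField C) {ψ : (Fin n → ℂ) → X} {z : Fin n → ℂ}
    (hψ : ContMDiffAt 𝓘(ℝ, Fin n → ℂ) 𝓘(ℝ, Fin n → ℂ) ∞ ψ z)
    {L : (Fin n → ℂ) → (Fin n → ℂ) →L[ℝ] (Fin n → ℂ)}
    (hL : ∀ᶠ w in nhds z, HasMFDerivAt 𝓘(ℝ, Fin n → ℂ) 𝓘(ℝ, Fin n → ℂ) ψ w (L w))
    {Q R : (Fin n → ℂ) → Bivector n} (hQ : ∀ᶠ w in nhds z, Related (L w) (Q w) (B (ψ w)))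
    (hR : ∀ᶠ w in nhds z, Related (L w) (R w) (C (ψ w)))
    (hdQ : DifferentiableAt ℝ Q z) (hdR : DifferentiableAt ℝ R z)
    (hQa : ∀ α β : (Fin n → ℂ) →L[ℝ] ℝ, β (Q z α) = -α (Q z β))
    (hRa : ∀ α β : (Fin n → ℂ) →L[ℝ] ℝ, β (R z α) = -α (R z β))
    {f g h : X → ℝ} (hf : SmoothAt n f (ψ z)) (hg : SmoothAt n g (ψ z)) (hh : SmoothAt n h (ψ z)) :
    schouten B C f g h (ψ z) =
      schoutenTensor Q R z (fderiv ℝ (f ∘ ψ) z) (fderiv ℝ (g ∘ ψ) z) (fderiv ℝ (h ∘ ψ) z) := by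
  have hsm : ∀ {f : X → ℝ}, SmoothAt n f (ψ z) → ContDiffAt ℝ 2 (f ∘ ψ) z := fun hf =>
    ((ContMDiffAt.comp z hf hψ).contDiffAt).of_le (WithTop.coe_le_coe.2 le_top)
  have hmd : ∀ {f : X → ℝ}, SmoothAt n f (ψ z) →
      MDifferentiableAt 𝓘(ℝ, Fin n → ℂ) 𝓘(ℝ, ℝ) f (ψ z) :=
    fun hf => hf.eventually_mdifferentiableAt.self_of_nhds
  have key : ∀ {B C : BivectorField n X} (_ : IsBivectorField B) {Q R : (Fin n → ℂ) → Bivector n},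
      (∀ᶠ w in nhds z, Related (L w) (Q w) (B (ψ w))) →
      (∀ᶠ w in nhds z, Related (L w) (R w) (C (ψ w))) → DifferentiableAt ℝ Q z →
      (∀ α β : (Fin n → ℂ) →L[ℝ] ℝ, β (Q z α) = -α (Q z β)) →
      ∀ {f g h : X → ℝ}, SmoothAt n f (ψ z) → SmoothAt n g (ψ z) → SmoothAt n h (ψ z) →
      bracket C f (bracket B g h) (ψ z) =
        fderiv ℝ (fderiv ℝ (h ∘ ψ)) z (R z (fderiv ℝ (f ∘ ψ) z)) (Q z (fderiv ℝ (g ∘ ψ) z))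
        - fderiv ℝ (fderiv ℝ (g ∘ ψ)) z (R z (fderiv ℝ (f ∘ ψ) z)) (Q z (fderiv ℝ (h ∘ ψ) z))
        + fderiv ℝ (h ∘ ψ) z (fderiv ℝ Q z (R z (fderiv ℝ (f ∘ ψ) z)) (fderiv ℝ (g ∘ ψ) z)) := by
    intro B C hB Q R hQ hR hdQ hQa f g h hf hg hh
    rw [bracket_apply hL.self_of_nhds hR.self_of_nhds (hmd hf) (hmd (hB.smooth _ _ _ hg hh)),
      (eventually_bracket_apply hψ.continuousAt hL hQ hg hh).fderiv_eq,
      fderiv_bracket_apply hdQ hQa (hsm hg) (hsm hh)]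
  have hs : ∀ {f : X → ℝ}, SmoothAt n f (ψ z) → ∀ u v, fderiv ℝ (fderiv ℝ (f ∘ ψ)) z u v =
      fderiv ℝ (fderiv ℝ (f ∘ ψ)) z v u := fun hf => ((hsm hf).isSymmSndFDerivAt (by simp)).eq
  rw [schouten, schoutenTensor, key hB hQ hR hdQ hQa hf hg hh, key hB hQ hR hdQ hQa hg hh hf,
    key hB hQ hR hdQ hQa hh hf hg, key hC hR hQ hdR hRa hf hg hh, key hC hR hQ hdR hRa hg hh hf,
    key hC hR hQ hdR hRa hh hf hg]
  -- Symmetry of second derivatives aligns the arguments, so that the Hessian terms of the first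
  -- cyclic sum are the negatives of those of the second.
  rw [hs hf (R z _), hs hf (R z _), hs hg (R z _), hs hg (R z _), hs hh (R z _), hs hh (R z _)]
  ring

end Bivectors

section Charts

variable {n : ℕ} {X : Type*} [TopologicalSpace X] [ChartedSpace (Fin n → ℂ) X]

/-! ### Bivector fields in charts -/

theorem contDiffAt_of_forall_covector {E F : Type*} [NormedAddCommGroup E] [NormedSpace ℝ E]
    [NormedAddCommGroup F] [NormedSpace ℝ F] [FiniteDimensional ℝ F] {k : ℕ∞ω} {f : E → F} {x : E}
    (h : ∀ β : F →L[ℝ] ℝ, ContDiffAt ℝ k (fun y => β (f y)) x) : ContDiffAt ℝ k f x := by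
  have e : f = fun y => ∑ i, (Module.finBasis ℝ F).coord i (f y) • Module.finBasis ℝ F i := by
    ext1 y
    exact ((Module.finBasis ℝ F).sum_repr (f y)).symm
  rw [e]
  exact ContDiffAt.sum fun i _ =>
    (h ((Module.finBasis ℝ F).coord i).toContinuousLinearMap).smul contDiffAt_const

theorem contDiffAt_of_forall_apply {E F G : Type*} [NormedAddCommGroup E] [NormedSpace ℝ E]
    [NormedAddCommGroup F] [NormedSpace ℝ F] [FiniteDimensional ℝ F] [NormedAddCommGroup G]
    [NormedSpace ℝ G] {k : ℕ∞ω} {f : E → F →L[ℝ] G} {x : E}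
    (h : ∀ v, ContDiffAt ℝ k (fun y => f y v) x) : ContDiffAt ℝ k f x := by
  have e : f = fun y => ∑ i, ((Module.finBasis ℝ F).coord i).toContinuousLinearMap.smulRight
      (f y (Module.finBasis ℝ F i)) := by
    ext y v
    refine (congrArg (f y) ((Module.finBasis ℝ F).sum_repr v).symm).trans ?_
    simp only [map_sum, map_smul, sum_apply, ContinuousLinearMap.smulRight_apply,
      LinearMap.coe_toContinuousLinearMap', Module.Basis.coord_apply]
  rw [e]
  exact ContDiffAt.sum fun i _ => contDiffAt_const.smulRight (h _)

/-- Smoothness of a bivector field is given through brackets of functions, that is, through its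
values on pairs of covectors. -/
theorem contDiffAt_bivector {E : Type*} [NormedAddCommGroup E] [NormedSpace ℝ E] {k : ℕ∞ω}
    {Q : E → Bivector n} {x : E}
    (h : ∀ α β : (Fin n → ℂ) →L[ℝ] ℝ, ContDiffAt ℝ k (fun y => β (Q y α)) x) :
    ContDiffAt ℝ k Q x :=
  contDiffAt_of_forall_apply fun α => contDiffAt_of_forall_covector fun β => h α β

/-- The differential of a chart, in the coordinates of the preferred chart. -/
def chartDeriv (c : OpenPartialHomeomorph X (Fin n → ℂ)) (x : X) :
    (Fin n → ℂ) →L[ℝ] (Fin n → ℂ) :=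
  mfderiv 𝓘(ℝ, Fin n → ℂ) 𝓘(ℝ, Fin n → ℂ) c x

/-- The differential of the inverse of a chart, in the coordinates of the preferred chart. -/
def chartSymmDeriv (c : OpenPartialHomeomorph X (Fin n → ℂ)) (w : Fin n → ℂ) :
    (Fin n → ℂ) →L[ℝ] (Fin n → ℂ) :=
  mfderiv 𝓘(ℝ, Fin n → ℂ) 𝓘(ℝ, Fin n → ℂ) c.symm w

section

variable [IsManifold 𝓘(ℝ, Fin n → ℂ) ω X] {c : OpenPartialHomeomorph X (Fin n → ℂ)}
  (hc : c ∈ atlas (Fin n → ℂ) X)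

include hc

theorem mdifferentiable_chart : c.MDifferentiable 𝓘(ℝ, Fin n → ℂ) 𝓘(ℝ, Fin n → ℂ) :=
  have : IsManifold 𝓘(ℝ, Fin n → ℂ) 1 X := .of_le (n := ω) le_top
  mdifferentiable_of_mem_atlas hc

theorem hasMFDerivAt_chart {x : X} (hx : x ∈ c.source) :
    HasMFDerivAt 𝓘(ℝ, Fin n → ℂ) 𝓘(ℝ, Fin n → ℂ) c x (chartDeriv c x) :=
  ((mdifferentiable_chart hc).mdifferentiableAt hx).hasMFDerivAt

theorem hasMFDerivAt_chart_symm {w : Fin n → ℂ} (hw : w ∈ c.target) :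
    HasMFDerivAt 𝓘(ℝ, Fin n → ℂ) 𝓘(ℝ, Fin n → ℂ) c.symm w (chartSymmDeriv c w) :=
  ((mdifferentiable_chart hc).mdifferentiableAt_symm hw).hasMFDerivAt

theorem chartDeriv_comp_symm {w : Fin n → ℂ} (hw : w ∈ c.target) :
    (chartDeriv c (c.symm w)).comp (chartSymmDeriv c w) = ContinuousLinearMap.id ℝ (Fin n → ℂ) :=
  (mdifferentiable_chart hc).comp_symm_deriv hw

theorem chartSymmDeriv_comp {w : Fin n → ℂ} (hw : w ∈ c.target) :
    (chartSymmDeriv c w).comp (chartDeriv c (c.symm w)) = ContinuousLinearMap.id ℝ (Fin n → ℂ) := by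
  have h := (mdifferentiable_chart hc).symm_comp_deriv (c.map_target hw)
  rw [c.right_inv hw] at h
  exact h

theorem contMDiffAt_chart {x : X} (hx : x ∈ c.source) :
    ContMDiffAt 𝓘(ℝ, Fin n → ℂ) 𝓘(ℝ, Fin n → ℂ) ∞ c x :=
  ((contMDiffOn_of_mem_maximalAtlas (n := ω) (IsManifold.subset_maximalAtlas hc)).contMDiffAt
    (c.open_source.mem_nhds hx)).of_le le_top

theorem contMDiffAt_chart_symm {w : Fin n → ℂ} (hw : w ∈ c.target) :
    ContMDiffAt 𝓘(ℝ, Fin n → ℂ) 𝓘(ℝ, Fin n → ℂ) ∞ c.symm w :=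
  ((contMDiffOn_symm_of_mem_maximalAtlas (n := ω) (IsManifold.subset_maximalAtlas hc)).contMDiffAt
    (c.open_target.mem_nhds hw)).of_le le_top

end

/-- A bivector, in the coordinates of the preferred chart. -/
def bivectorAt (B : BivectorField n X) (x : X) : Bivector n := B x

/-- The expression of a field of bivectors in a chart. -/
def chartBivector (c : OpenPartialHomeomorph X (Fin n → ℂ)) (B : BivectorField n X)
    (w : Fin n → ℂ) : Bivector n :=
  (chartDeriv c (c.symm w)).comp ((bivectorAt B (c.symm w)).comp
    ((ContinuousLinearMap.compL ℝ (Fin n → ℂ) (Fin n → ℂ) ℝ).flip (chartDeriv c (c.symm w))))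

theorem related_chartBivector [IsManifold 𝓘(ℝ, Fin n → ℂ) ω X]
    {c : OpenPartialHomeomorph X (Fin n → ℂ)}
    (hc : c ∈ atlas (Fin n → ℂ) X) (B : BivectorField n X) {w : Fin n → ℂ} (hw : w ∈ c.target) :
    Related (chartSymmDeriv c w) (chartBivector c B w) (B (c.symm w)) := fun α => by
  have h := chartSymmDeriv_comp hc hw
  have h1 : (α.comp (chartSymmDeriv c w)).comp (chartDeriv c (c.symm w)) = α := by
    rw [ContinuousLinearMap.comp_assoc, h, ContinuousLinearMap.comp_id]
  change (chartSymmDeriv c w).comp (chartDeriv c (c.symm w)) (bivectorAt B (c.symm w)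
    ((α.comp (chartSymmDeriv c w)).comp (chartDeriv c (c.symm w)))) = _
  rw [h1, h]
  rfl

omit [ChartedSpace (Fin n → ℂ) X] in
theorem fderiv_covector_comp_chart {c : OpenPartialHomeomorph X (Fin n → ℂ)} {w : Fin n → ℂ}
    (hw : w ∈ c.target) (α : (Fin n → ℂ) →L[ℝ] ℝ) : fderiv ℝ ((α ∘ c) ∘ c.symm) w = α := by
  have h : (α ∘ c) ∘ c.symm =ᶠ[nhds w] α := by
    filter_upwards [c.open_target.mem_nhds hw] with y hy
    simp [c.right_inv hy]
  rw [h.fderiv_eq, ContinuousLinearMap.fderiv]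

theorem smoothAt_covector_comp_chart [IsManifold 𝓘(ℝ, Fin n → ℂ) ω X]
    {c : OpenPartialHomeomorph X (Fin n → ℂ)}
    (hc : c ∈ atlas (Fin n → ℂ) X) {x : X} (hx : x ∈ c.source) (α : (Fin n → ℂ) →L[ℝ] ℝ) :
    SmoothAt n (α ∘ c) x :=
  ContMDiffAt.comp x α.contDiff.contMDiff.contMDiffAt (contMDiffAt_chart hc hx)

/-- Linear functions of the chart have constant differentials, so the components of the bivector are
their brackets. Smoothness of brackets thereby becomes smoothness of the chart expression. -/
theorem covector_chartBivector [IsManifold 𝓘(ℝ, Fin n → ℂ) ω X]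
    {c : OpenPartialHomeomorph X (Fin n → ℂ)}
    (hc : c ∈ atlas (Fin n → ℂ) X) (B : BivectorField n X) {w : Fin n → ℂ} (hw : w ∈ c.target)
    (α β : (Fin n → ℂ) →L[ℝ] ℝ) :
    β (chartBivector c B w α) = bracket B (α ∘ c) (β ∘ c) (c.symm w) := by
  have hs := c.map_target hw
  rw [bracket_apply (hasMFDerivAt_chart_symm hc hw) (related_chartBivector hc B hw)
    (smoothAt_covector_comp_chart hc hs α).eventually_mdifferentiableAt.self_of_nhds
    (smoothAt_covector_comp_chart hc hs β).eventually_mdifferentiableAt.self_of_nhds,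
    fderiv_covector_comp_chart hw, fderiv_covector_comp_chart hw]

theorem IsBivectorField.contDiffAt_chartBivector [IsManifold 𝓘(ℝ, Fin n → ℂ) ω X]
    {B : BivectorField n X} (hB : IsBivectorField B)
    {c : OpenPartialHomeomorph X (Fin n → ℂ)} (hc : c ∈ atlas (Fin n → ℂ) X) {w : Fin n → ℂ}
    (hw : w ∈ c.target) : ContDiffAt ℝ ∞ (chartBivector c B) w := by
  refine contDiffAt_bivector fun α β => ?_
  have hs := c.map_target hw
  have h : ContMDiffAt 𝓘(ℝ, Fin n → ℂ) 𝓘(ℝ, ℝ) ∞ (bracket B (α ∘ c) (β ∘ c) ∘ c.symm) w :=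
    ContMDiffAt.comp w (hB.smooth _ _ _ (smoothAt_covector_comp_chart hc hs α)
      (smoothAt_covector_comp_chart hc hs β)) (contMDiffAt_chart_symm hc hw)
  refine h.contDiffAt.congr_of_eventuallyEq ?_
  filter_upwards [c.open_target.mem_nhds hw] with y hy using covector_chartBivector hc B hy α β

theorem IsBivectorField.chartBivector_antisymm {B : BivectorField n X} (hB : IsBivectorField B)
    (c : OpenPartialHomeomorph X (Fin n → ℂ)) (w : Fin n → ℂ) (α β : (Fin n → ℂ) →L[ℝ] ℝ) :
    β (chartBivector c B w α) = -α (chartBivector c B w β) :=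
  hB.antisymm (c.symm w) (α.comp (chartDeriv c (c.symm w))) (β.comp (chartDeriv c (c.symm w)))

theorem schouten_eq_chart [IsManifold 𝓘(ℝ, Fin n → ℂ) ω X]
    {B C : BivectorField n X} (hB : IsBivectorField B)
    (hC : IsBivectorField C) {c : OpenPartialHomeomorph X (Fin n → ℂ)}
    (hc : c ∈ atlas (Fin n → ℂ) X) {w : Fin n → ℂ} (hw : w ∈ c.target) {f g h : X → ℝ}
    (hf : SmoothAt n f (c.symm w)) (hg : SmoothAt n g (c.symm w)) (hh : SmoothAt n h (c.symm w)) :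
    schouten B C f g h (c.symm w) = schoutenTensor (chartBivector c B) (chartBivector c C) w
      (fderiv ℝ (f ∘ c.symm) w) (fderiv ℝ (g ∘ c.symm) w) (fderiv ℝ (h ∘ c.symm) w) := by
  have ht := c.open_target.mem_nhds hw
  refine schouten_eq_schoutenTensor (L := chartSymmDeriv c) hB hC (contMDiffAt_chart_symm hc hw)
    ?_ ?_ ?_
    ((hB.contDiffAt_chartBivector hc hw).differentiableAt (by simp))
    ((hC.contDiffAt_chartBivector hc hw).differentiableAt (by simp))
    (hB.chartBivector_antisymm c w) (hC.chartBivector_antisymm c w) hf hg hh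
  · filter_upwards [ht] with y hy using hasMFDerivAt_chart_symm hc hy
  · filter_upwards [ht] with y hy using related_chartBivector hc B hy
  · filter_upwards [ht] with y hy using related_chartBivector hc C hy

/-- If the Schouten bracket vanishes on a dense set, it vanishes. -/
theorem poissonCommute_of_dense [IsManifold 𝓘(ℝ, Fin n → ℂ) ω X]
    {B C : BivectorField n X} (hB : IsBivectorField B)
    (hC : IsBivectorField C) {s : Set X} (hs : Dense s)
    (h : ∀ x ∈ s, ∀ f g h : X → ℝ, SmoothAt n f x → SmoothAt n g x → SmoothAt n h x →
      schouten B C f g h x = 0) : PoissonCommute B C := by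
  intro x f g k hf hg hk
  set c := chartAt (Fin n → ℂ) x
  have hc : c ∈ atlas (Fin n → ℂ) X := chart_mem_atlas _ x
  have hx : x ∈ c.source := mem_chart_source _ x
  -- In a chart the coefficients of the trivector are continuous, and they are the brackets of
  -- linear functions of the chart. If one were nonzero somewhere, it would be nonzero on an open
  -- set, which meets `s`.
  have key : ∀ α β γ : (Fin n → ℂ) →L[ℝ] ℝ, ∀ w ∈ c.target,
      schoutenTensor (chartBivector c B) (chartBivector c C) w α β γ = 0 := by
    intro α β γ
    have hcont : ContinuousOn
        (fun w => schoutenTensor (chartBivector c B) (chartBivector c C) w α β γ) c.target := by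
      intro w hw
      have h1 := hB.contDiffAt_chartBivector hc hw
      have h2 := hC.contDiffAt_chartBivector hc hw
      have h3 := h1.continuousAt
      have h4 := h2.continuousAt
      have h5 := (h1.fderiv_right (m := 0) (by simp)).continuousAt
      have h6 := (h2.fderiv_right (m := 0) (by simp)).continuousAt
      refine ContinuousAt.continuousWithinAt ?_
      unfold schoutenTensor
      fun_prop
    by_contra! hne
    obtain ⟨w, hw, hwne⟩ := hne
    have hopen : IsOpen (c.source ∩ c ⁻¹' (c.target ∩
        (fun w => schoutenTensor (chartBivector c B) (chartBivector c C) w α β γ) ⁻¹' {0}ᶜ)) :=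
      c.isOpen_inter_preimage (hcont.isOpen_inter_preimage c.open_target isOpen_compl_singleton)
    obtain ⟨y, ⟨hy1, hy2⟩, hy3⟩ := hs.inter_open_nonempty _ hopen
      ⟨c.symm w, c.map_target hw, by simpa [c.right_inv hw] using ⟨hw, hwne⟩⟩
    have hy4 : c.symm (c y) = y := c.left_inv hy1
    refine hy2.2 ?_
    have := schouten_eq_chart hB hC hc hy2.1
      (smoothAt_covector_comp_chart hc (hy4.symm ▸ hy1) α)
      (smoothAt_covector_comp_chart hc (hy4.symm ▸ hy1) β)
      (smoothAt_covector_comp_chart hc (hy4.symm ▸ hy1) γ)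
    rw [fderiv_covector_comp_chart hy2.1, fderiv_covector_comp_chart hy2.1,
      fderiv_covector_comp_chart hy2.1, hy4] at this
    change schoutenTensor (chartBivector c B) (chartBivector c C) (c y) α β γ = 0
    rw [← this]
    exact h y hy3 _ _ _ (smoothAt_covector_comp_chart hc hy1 α)
      (smoothAt_covector_comp_chart hc hy1 β) (smoothAt_covector_comp_chart hc hy1 γ)
  have hx' : c.symm (c x) = x := c.left_inv hx
  have := schouten_eq_chart hB hC hc (c.map_source hx) (f := f) (g := g) (h := k)
    (hx'.symm ▸ hf) (hx'.symm ▸ hg) (hx'.symm ▸ hk)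
  rw [hx', key _ _ _ _ (c.map_source hx)] at this
  exact this

end Charts

section Forms

variable {n : ℕ}

/-! ### Nondegenerate two-forms and their inverses -/

theorem twoForm_swap (w : (Fin n → ℂ) [⋀^Fin 2]→L[ℝ] ℝ) (u v : Fin n → ℂ) :
    w ![u, v] = -w ![v, u] := by
  have h := w.toAlternatingMap.map_swap ![v, u] (i := 0) (j := 1) (by simp)
  have e : ![v, u] ∘ Equiv.swap (0 : Fin 2) 1 = ![u, v] := by
    ext i : 1
    fin_cases i <;> simp
  rw [e] at h
  exact h

/-- Nondegenerate two-forms. -/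
def IsNondegenerate (w : (Fin n → ℂ) [⋀^Fin 2]→L[ℝ] ℝ) : Prop :=
  Function.Injective (flat w)

theorem isNondegenerate_iff {w : (Fin n → ℂ) [⋀^Fin 2]→L[ℝ] ℝ} :
    IsNondegenerate w ↔ ∀ u, (∀ v, w ![u, v] = 0) → u = 0 := by
  rw [IsNondegenerate, injective_iff_map_eq_zero]
  refine forall_congr' fun u => imp_congr_left ?_
  simp [ContinuousLinearMap.ext_iff, flat_apply]

theorem finrank_dual_eq (E : Type*) [NormedAddCommGroup E] [NormedSpace ℝ E]
    [FiniteDimensional ℝ E] : Module.finrank ℝ (E →L[ℝ] ℝ) = Module.finrank ℝ E := by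
  rw [← (LinearMap.toContinuousLinearMap (𝕜 := ℝ) (E := E) (F' := ℝ)).finrank_eq]
  exact Subspace.dual_finrank_eq

theorem exists_equiv_of_injective {E F : Type*} [NormedAddCommGroup E] [NormedSpace ℝ E]
    [FiniteDimensional ℝ E] [NormedAddCommGroup F] [NormedSpace ℝ F] [FiniteDimensional ℝ F]
    (h : Module.finrank ℝ E = Module.finrank ℝ F) {L : E →L[ℝ] F} (hL : Function.Injective L) :
    ∃ e : E ≃L[ℝ] F, (e : E →L[ℝ] F) = L :=
  ⟨(LinearEquiv.ofInjectiveOfFinrankEq (L : E →ₗ[ℝ] F) hL h).toContinuousLinearEquiv, by ext; rfl⟩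

theorem IsNondegenerate.exists_equiv {w : (Fin n → ℂ) [⋀^Fin 2]→L[ℝ] ℝ} (hw : IsNondegenerate w) :
    ∃ e : (Fin n → ℂ) ≃L[ℝ] ((Fin n → ℂ) →L[ℝ] ℝ), (e : (Fin n → ℂ) →L[ℝ] _) = flat w :=
  exists_equiv_of_injective (finrank_dual_eq _).symm hw

/-- The bivector inverse to a nondegenerate two-form. -/
def inverseOf (w : (Fin n → ℂ) [⋀^Fin 2]→L[ℝ] ℝ) : Bivector n := -(flat w).inverse

theorem IsNondegenerate.isInverse {w : (Fin n → ℂ) [⋀^Fin 2]→L[ℝ] ℝ} (hw : IsNondegenerate w) :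
    IsInverse (inverseOf w) w := fun u => by
  obtain ⟨e, he⟩ := hw.exists_equiv
  rw [inverseOf, ← he, ContinuousLinearMap.inverse_equiv]
  simp

theorem IsNondegenerate.flat_inverseOf {w : (Fin n → ℂ) [⋀^Fin 2]→L[ℝ] ℝ} (hw : IsNondegenerate w)
    (α : (Fin n → ℂ) →L[ℝ] ℝ) : flat w (inverseOf w α) = -α := by
  obtain ⟨e, he⟩ := hw.exists_equiv
  rw [inverseOf, ← he, ContinuousLinearMap.inverse_equiv]
  simp

theorem IsNondegenerate.eq_inverseOf {w : (Fin n → ℂ) [⋀^Fin 2]→L[ℝ] ℝ} (hw : IsNondegenerate w)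
    {Q : Bivector n} (hQ : IsInverse Q w) : Q = inverseOf w := by
  ext1 α
  rw [← neg_neg α, ← hw.flat_inverseOf α, map_neg, map_neg, hQ, hw.isInverse]

theorem IsInverse.isNondegenerate {Q : Bivector n} {w : (Fin n → ℂ) [⋀^Fin 2]→L[ℝ] ℝ}
    (h : IsInverse Q w) : IsNondegenerate w := fun u v huv => by
  have := congrArg Q huv
  rwa [h, h, neg_inj] at this

theorem IsNondegenerate.antisymm {w : (Fin n → ℂ) [⋀^Fin 2]→L[ℝ] ℝ} (hw : IsNondegenerate w)
    (α β : (Fin n → ℂ) →L[ℝ] ℝ) : β (inverseOf w α) = -α (inverseOf w β) := by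
  have h1 := congrArg (fun L => L (inverseOf w α)) (hw.flat_inverseOf β)
  have h2 := congrArg (fun L => L (inverseOf w β)) (hw.flat_inverseOf α)
  simp only [flat_apply, neg_apply] at h1 h2
  rw [twoForm_swap] at h1
  linarith

/-- The inverse of the pull-back of a two-form is related to the inverse of the form. -/
theorem related_inverse {L : (Fin n → ℂ) →L[ℝ] (Fin n → ℂ)} (hL : Function.Surjective L)
    {w w' : (Fin n → ℂ) [⋀^Fin 2]→L[ℝ] ℝ} (hw : IsNondegenerate w)
    (hww : ∀ u v, w' ![u, v] = w ![L u, L v]) {Q : Bivector n} (hQ : IsInverse Q w') :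
    Related L Q (inverseOf w) := fun α => by
  -- The sign comes from the convention P♯(w(u, ·)) = −u: this choice makes w'(u, ·) the pull-back
  -- of α.
  obtain ⟨u, hu⟩ := hL (-inverseOf w α)
  have h : α.comp L = flat w' u := by
    ext1 v
    rw [flat_apply, hww, hu, ← flat_apply, map_neg, hw.flat_inverseOf, neg_neg,
      ContinuousLinearMap.comp_apply]
  rw [h, hQ, map_neg, hu, neg_neg]

/-- Inversion of linear maps is smooth at invertible ones. -/
theorem contDiffAt_inverseOf {E : Type*} [NormedAddCommGroup E] [NormedSpace ℝ E] {k : ℕ∞ω}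
    {w : E → (Fin n → ℂ) [⋀^Fin 2]→L[ℝ] ℝ} {x : E} (hw : ContDiffAt ℝ k w x)
    (hx : IsNondegenerate (w x)) : ContDiffAt ℝ k (fun y => inverseOf (w y)) x := by
  have h1 : ContDiffAt ℝ k (fun y => flat (w y)) x := by
    refine contDiffAt_of_forall_apply fun u => contDiffAt_of_forall_apply fun v => ?_
    simp only [flat_apply]
    exact (ContinuousAlternatingMap.apply ℝ (Fin n → ℂ) ℝ ![u, v]).contDiff.contDiffAt.comp x hw
  obtain ⟨e, he⟩ := hx.exists_equiv
  have h2 := contDiffAt_map_inverse (𝕜 := ℝ) (n := k) e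
  rw [he] at h2
  exact (h2.comp x h1).neg

variable {X : Type*} [TopologicalSpace X] [ChartedSpace (Fin n → ℂ) X]

/-- A two-form at a point, in the coordinates of the preferred chart. -/
def formAt (σ : TwoForm n X) (x : X) : (Fin n → ℂ) [⋀^Fin 2]→L[ℝ] ℝ := σ x

theorem IsKahlerForm.formAt_pos {σ : TwoForm n X} (hσ : IsKahlerForm σ) (x : X) {v : Fin n → ℂ}
    (hv : v ≠ 0) : 0 < formAt σ x ![v, Complex.I • v] :=
  hσ.pos x v hv

theorem IsKahlerForm.formAt_I_smul {σ : TwoForm n X} (hσ : IsKahlerForm σ) (x : X)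
    (u v : Fin n → ℂ) : formAt σ x ![Complex.I • u, Complex.I • v] = formAt σ x ![u, v] :=
  hσ.type_one_one x u v

/-- A vector u ≠ 0 in the kernel would contradict σ(u, iu) > 0. -/
theorem IsKahlerForm.isNondegenerate {σ : TwoForm n X} (hσ : IsKahlerForm σ) (x : X) :
    IsNondegenerate (formAt σ x) :=
  isNondegenerate_iff.2 fun _ hu => by_contra fun h => (hσ.formAt_pos x h).ne' (hu _)

theorem chartForm_apply (σ : TwoForm n X) (c : OpenPartialHomeomorph X (Fin n → ℂ))
    (w u v : Fin n → ℂ) : chartForm σ c w ![u, v] =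
      formAt σ (c.symm w) ![chartSymmDeriv c w u, chartSymmDeriv c w v] := by
  rw [chartForm]
  refine (ContinuousAlternatingMap.compContinuousLinearMap_apply ..).trans ?_
  refine congrArg (formAt σ (c.symm w)) ?_
  ext i : 1
  fin_cases i <;> rfl

/-- The inverse of a Kähler form is a smooth field of bivectors. -/
theorem IsKahlerForm.isBivectorField [IsManifold 𝓘(ℝ, Fin n → ℂ) ω X] {σ : TwoForm n X}
    (hσ : IsKahlerForm σ) : IsBivectorField (inverseBivector σ) where
  antisymm x α β := (hσ.isNondegenerate x).antisymm α β
  smooth x f g hf hg := by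
    set c := chartAt (Fin n → ℂ) x
    have hc : c ∈ atlas (Fin n → ℂ) X := chart_mem_atlas _ x
    have hx : x ∈ c.source := mem_chart_source _ x
    have ht : ∀ᶠ w in nhds (c x), w ∈ c.target := c.open_target.mem_nhds (c.map_source hx)
    have hx' : c.symm (c x) = x := c.left_inv hx
    have hinj : ∀ w ∈ c.target, Function.Injective (chartSymmDeriv c w) := fun w hw u v huv => by
      have := congrArg (chartDeriv c (c.symm w)) huv
      rwa [← ContinuousLinearMap.comp_apply, ← ContinuousLinearMap.comp_apply,
        chartDeriv_comp_symm hc hw] at this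
    have hsurj : ∀ w ∈ c.target, Function.Surjective (chartSymmDeriv c w) := fun w hw =>
      LinearMap.injective_iff_surjective (f := (chartSymmDeriv c w : (Fin n → ℂ) →ₗ[ℝ] _)).1 (hinj w hw)
    have hnd : ∀ w ∈ c.target, IsNondegenerate (chartForm σ c w) := fun w hw =>
      isNondegenerate_iff.2 fun u hu => hinj w hw <| by
        rw [map_zero]
        refine isNondegenerate_iff.1 (hσ.isNondegenerate (c.symm w)) _ fun v => ?_
        obtain ⟨v, rfl⟩ := hsurj w hw v
        rw [← chartForm_apply, hu]
    have hrel : ∀ w ∈ c.target, Related (chartSymmDeriv c w) (inverseOf (chartForm σ c w))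
        (inverseBivector σ (c.symm w)) := fun w hw =>
      related_inverse (hsurj w hw) (hσ.isNondegenerate _) (chartForm_apply σ c w)
        (hnd w hw).isInverse
    have hQ : ContDiffAt ℝ ∞ (fun w => inverseOf (chartForm σ c w)) (c x) :=
      contDiffAt_inverseOf ((hσ.smooth c hc).contDiffAt ht) (hnd _ (c.map_source hx))
    have hcs := contMDiffAt_chart_symm hc (c.map_source hx)
    have hsm : ∀ f : X → ℝ, SmoothAt n f x → ContDiffAt ℝ ∞ (f ∘ c.symm) (c x) := fun f hf =>
      (ContMDiffAt.comp (c x) (hx'.symm ▸ hf) hcs).contDiffAt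
    -- The bracket in the chart is assembled from smooth differentials and the inverse of the smooth
    -- chart expression of σ.
    have key : ContDiffAt ℝ ∞ (fun w => fderiv ℝ (g ∘ c.symm) w (inverseOf (chartForm σ c w)
        (fderiv ℝ (f ∘ c.symm) w))) (c x) :=
      ((hsm g hg).fderiv_right (m := ∞) le_rfl).clm_apply
        (hQ.clm_apply ((hsm f hf).fderiv_right (m := ∞) le_rfl))
    have heq := eventually_bracket_apply (B := inverseBivector σ) hcs.continuousAt
      (L := chartSymmDeriv c) (Q := fun w => inverseOf (chartForm σ c w))
      (by filter_upwards [ht] with w hw using hasMFDerivAt_chart_symm hc hw)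
      (by filter_upwards [ht] with w hw using hrel w hw) (f := f) (g := g) (hx'.symm ▸ hf)
      (hx'.symm ▸ hg)
    have h2 : ContMDiffAt 𝓘(ℝ, Fin n → ℂ) 𝓘(ℝ, ℝ) ∞
        ((bracket (inverseBivector σ) f g ∘ c.symm) ∘ c) x :=
      ContMDiffAt.comp x (key.congr_of_eventuallyEq heq).contMDiffAt (contMDiffAt_chart hc hx)
    refine h2.congr_of_eventuallyEq ?_
    filter_upwards [c.open_source.mem_nhds hx] with y hy
    simp [c.left_inv hy]

end Forms

/-! ### Logarithmic coordinates -/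

section ToricExp

variable {n : ℕ}

/-- The complex linear map given by an integer matrix. -/
def intLin (A : Matrix (Fin n) (Fin n) ℤ) : (Fin n → ℂ) →L[ℂ] (Fin n → ℂ) :=
  (A.map (Int.cast : ℤ → ℂ)).mulVecLin.toContinuousLinearMap

theorem intLin_apply (A : Matrix (Fin n) (Fin n) ℤ) (z : Fin n → ℂ) (i : Fin n) :
    intLin A z i = ∑ j, (A i j : ℂ) * z j := rfl

theorem intLin_injective {A : Matrix (Fin n) (Fin n) ℤ} (hA : IsUnit A.det) :
    Function.Injective (intLin A) := by
  refine Matrix.mulVec_injective_of_isUnit ((Matrix.isUnit_iff_isUnit_det _).2 ?_)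
  have h := hA.map (Int.castRingHom ℂ)
  rw [RingHom.map_det] at h
  exact h

/-- The exponential map of the torus in a toric chart. -/
def toricExp (A : Matrix (Fin n) (Fin n) ℤ) (a z : Fin n → ℂ) : Fin n → ℂ :=
  fun i => Complex.exp (intLin A z i) * a i

theorem contDiff_toricExp (A : Matrix (Fin n) (Fin n) ℤ) (a : Fin n → ℂ) {k : ℕ∞ω} :
    ContDiff ℂ k (toricExp A a) :=
  contDiff_pi.2 fun i => ((contDiff_pi.1 (intLin A).contDiff i).cexp).mul contDiff_const

theorem hasFDerivAt_toricExp (A : Matrix (Fin n) (Fin n) ℤ) (a z : Fin n → ℂ) :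
    HasFDerivAt (toricExp A a) (ContinuousLinearMap.pi fun i =>
      (toricExp A a z i) • (ContinuousLinearMap.proj (R := ℂ) (φ := fun _ : Fin n => ℂ) i).comp
        (intLin A)) z := by
  refine hasFDerivAt_pi.2 fun i => ?_
  have h := ((hasFDerivAt_pi'.1 (intLin A).hasFDerivAt i : HasFDerivAt _ _ z).cexp).mul_const (a i)
  rw [smul_smul, mul_comm] at h
  exact h

/-- The i-th component of the derivative at v is a nonzero multiple of the i-th component of A v,
and `A` is invertible. -/
theorem fderiv_toricExp_injective {A : Matrix (Fin n) (Fin n) ℤ} (hA : IsUnit A.det)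
    {a : Fin n → ℂ} (ha : ∀ i, a i ≠ 0) (z : Fin n → ℂ) :
    Function.Injective (fderiv ℝ (toricExp A a) z) := by
  rw [((hasFDerivAt_toricExp A a z).restrictScalars ℝ).fderiv, injective_iff_map_eq_zero]
  intro v hv
  refine intLin_injective hA ?_
  rw [map_zero]
  ext i
  have h := congrFun hv i
  have h' : toricExp A a z i * intLin A v i = 0 := h
  exact (mul_eq_zero.1 h').resolve_left (mul_ne_zero (Complex.exp_ne_zero _) (ha i))

theorem toricExp_eq_iff {A : Matrix (Fin n) (Fin n) ℤ} {a : Fin n → ℂ}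
    (ha : ∀ i, a i ≠ 0) (z : Fin n → ℂ) : toricExp A a z = a ↔
      ∀ i, ∃ k : ℤ, intLin A z i = k * (2 * Real.pi * Complex.I) := by
  simp only [funext_iff, toricExp, ← Complex.exp_eq_one_iff]
  exact forall_congr' fun i => by rw [mul_eq_right₀ (ha i)]

/-- The invertible matrix `A` maps the periods injectively into (2πiℤ)ⁿ. -/
theorem countable_toricExp_eq {A : Matrix (Fin n) (Fin n) ℤ} (hA : IsUnit A.det) {a : Fin n → ℂ}
    (ha : ∀ i, a i ≠ 0) : {z | toricExp A a z = a}.Countable := by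
  have h : {z | toricExp A a z = a} ⊆ intLin A ⁻¹'
      range fun (k : Fin n → ℤ) i => ((k i : ℂ) * (2 * Real.pi * Complex.I)) := fun z hz => by
    choose k hk using (toricExp_eq_iff ha z).1 hz
    exact ⟨k, (funext hk).symm⟩
  exact ((countable_range _).preimage_of_injOn (intLin_injective hA).injOn).mono h

end ToricExp

section Log

variable {n : ℕ} {X : Type*} [MulAction (Torus n) X]

theorem torusExp_add (z w : Fin n → ℂ) : torusExp (z + w) = torusExp z * torusExp w := by
  ext j
  simp [torusExp, Complex.exp_add]

theorem torusExp_zero : torusExp (0 : Fin n → ℂ) = 1 := by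
  ext j
  simp [torusExp]

theorem torusExp_surjective : Function.Surjective (torusExp (n := n)) := fun t =>
  ⟨fun j => Complex.log (t j), by ext j; simp [torusExp, Complex.exp_log]⟩

theorem logMap_zero (x₀ : X) : logMap x₀ (0 : Fin n → ℂ) = x₀ := by
  rw [logMap, torusExp_zero, one_smul]

theorem torusExp_smul_logMap (x₀ : X) (z w : Fin n → ℂ) :
    torusExp z • logMap x₀ w = logMap x₀ (z + w) := by
  rw [logMap, logMap, torusExp_add, mul_smul]

theorem range_logMap (x₀ : X) : range (logMap (n := n) x₀) = MulAction.orbit (Torus n) x₀ := by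
  ext x
  constructor
  · rintro ⟨z, rfl⟩
    exact ⟨torusExp z, rfl⟩
  · rintro ⟨t, rfl⟩
    obtain ⟨z, rfl⟩ := torusExp_surjective t
    exact ⟨z, rfl⟩

theorem logMap_sub_eq {x₀ : X} {z w : Fin n → ℂ} (h : logMap x₀ z = logMap x₀ w) :
    logMap x₀ (z - w) = x₀ := by
  rw [sub_eq_neg_add, ← torusExp_smul_logMap, h, torusExp_smul_logMap, neg_add_cancel, logMap_zero]

theorem logMap_add_congr {x₀ : X} {z w : Fin n → ℂ} (h : logMap x₀ z = logMap x₀ w)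
    (a : Fin n → ℂ) : logMap x₀ (a + z) = logMap x₀ (a + w) := by
  rw [← torusExp_smul_logMap, h, torusExp_smul_logMap]

variable [TopologicalSpace X] [ChartedSpace (Fin n → ℂ) X]

/-- A toric chart in which the base point `x₀` has non-zero coordinates. -/
structure IsLogChart (x₀ : X) (c : OpenPartialHomeomorph X (Fin n → ℂ))
    (A : Matrix (Fin n) (Fin n) ℤ) : Prop where
  mem_atlas : c ∈ IsManifold.maximalAtlas 𝓘(ℂ, Fin n → ℂ) ω X
  isUnit_det : IsUnit A.det
  smul_mem : ∀ (t : Torus n), ∀ x ∈ c.source, t • x ∈ c.source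
  smul_apply : ∀ (t : Torus n), ∀ x ∈ c.source, ∀ i, c (t • x) i = (∏ j, (t j : ℂ) ^ A i j) * c x i
  mem_source : x₀ ∈ c.source
  ne_zero : ∀ i, c x₀ i ≠ 0

/-- Take a toric chart around x₀. A vanishing coordinate of x₀ would vanish on the whole orbit,
because the action is diagonal, while the nonempty open set where that coordinate is nonzero meets
the dense orbit. The point (1, …, 1), which lies in every toric chart image, shows that this set is
nonempty. -/
theorem IsSmoothToricVariety.exists_isLogChart (hX : IsSmoothToricVariety n X) {x₀ : X}
    (hx₀ : Dense (MulAction.orbit (Torus n) x₀)) :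
    ∃ (c : OpenPartialHomeomorph X (Fin n → ℂ)) (A : Matrix (Fin n) (Fin n) ℤ),
      IsLogChart x₀ c A := by
  obtain ⟨S, -, hS, hS', hcov⟩ := hX.charts
  obtain ⟨c, hc, hx⟩ := hcov x₀
  obtain ⟨s, A, hA, ht, hsm⟩ := hS' c hc
  refine ⟨c, A, hS hc, hA, fun t x hx => (hsm t x hx).1, fun t x hx => (hsm t x hx).2, hx,
    fun i hi => ?_⟩
  have hopen : IsOpen (c.source ∩ c ⁻¹' {z | z i ≠ 0}) :=
    c.isOpen_inter_preimage (isOpen_ne_fun (continuous_apply i) continuous_const)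
  have h1 : (fun _ => 1 : Fin n → ℂ) ∈ c.target := by
    rw [ht]
    simp
  obtain ⟨y, ⟨-, hy⟩, ⟨t, rfl⟩⟩ := hx₀.inter_open_nonempty _ hopen
    ⟨c.symm fun _ => 1, c.map_target h1, by simp [c.right_inv h1]⟩
  exact hy (by change c (t • x₀) i = 0; rw [(hsm t x₀ hx).2, hi, mul_zero])

namespace IsLogChart

variable {x₀ : X} {c : OpenPartialHomeomorph X (Fin n → ℂ)} {A : Matrix (Fin n) (Fin n) ℤ}

theorem logMap_mem (h : IsLogChart x₀ c A) (z : Fin n → ℂ) : logMap x₀ z ∈ c.source :=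
  h.smul_mem _ _ h.mem_source

theorem apply_logMap (h : IsLogChart x₀ c A) (z : Fin n → ℂ) :
    c (logMap x₀ z) = toricExp A (c x₀) z := by
  ext i
  rw [logMap, h.smul_apply _ _ h.mem_source, toricExp, intLin_apply, Complex.exp_sum]
  congr 1
  exact Finset.prod_congr rfl fun j _ => by rw [Complex.exp_int_mul]; rfl

theorem symm_toricExp (h : IsLogChart x₀ c A) (z : Fin n → ℂ) :
    c.symm (toricExp A (c x₀) z) = logMap x₀ z := by
  rw [← h.apply_logMap, c.left_inv (h.logMap_mem z)]

theorem toricExp_mem (h : IsLogChart x₀ c A) (z : Fin n → ℂ) : toricExp A (c x₀) z ∈ c.target := by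
  rw [← h.apply_logMap]
  exact c.map_source (h.logMap_mem z)

theorem contMDiffAt_complex (h : IsLogChart x₀ c A) {x : X} (hx : x ∈ c.source) :
    ContMDiffAt 𝓘(ℂ, Fin n → ℂ) 𝓘(ℂ, Fin n → ℂ) ω c x :=
  (contMDiffOn_of_mem_maximalAtlas h.mem_atlas).contMDiffAt (c.open_source.mem_nhds hx)

theorem contMDiffAt_symm_complex (h : IsLogChart x₀ c A) {z : Fin n → ℂ} (hz : z ∈ c.target) :
    ContMDiffAt 𝓘(ℂ, Fin n → ℂ) 𝓘(ℂ, Fin n → ℂ) ω c.symm z :=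
  (contMDiffOn_symm_of_mem_maximalAtlas h.mem_atlas).contMDiffAt (c.open_target.mem_nhds hz)

theorem contMDiffAt_logMap_complex (h : IsLogChart x₀ c A) (z : Fin n → ℂ) :
    ContMDiffAt 𝓘(ℂ, Fin n → ℂ) 𝓘(ℂ, Fin n → ℂ) ω (logMap x₀) z := by
  have e : logMap x₀ = c.symm ∘ toricExp A (c x₀) := funext fun z => (h.symm_toricExp z).symm
  rw [e]
  exact ContMDiffAt.comp z (h.contMDiffAt_symm_complex (h.toricExp_mem z))
    (contDiff_toricExp A (c x₀)).contMDiff.contMDiffAt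

theorem contMDiffAt_logMap (h : IsLogChart x₀ c A) (z : Fin n → ℂ) :
    ContMDiffAt 𝓘(ℝ, Fin n → ℂ) 𝓘(ℝ, Fin n → ℂ) ω (logMap x₀) z :=
  ContMDiffAt.restrictScalars (h.contMDiffAt_logMap_complex z)

/-- In a toric chart the action is a diagonal linear map. -/
theorem smul_mdifferentiableAt (h : IsLogChart x₀ c A) (t : Torus n) {x : X} (hx : x ∈ c.source) :
    MDifferentiableAt 𝓘(ℝ, Fin n → ℂ) 𝓘(ℝ, Fin n → ℂ) (fun y : X => t • y) x := by
  set D : (Fin n → ℂ) → (Fin n → ℂ) := fun z i => (∏ j, (t j : ℂ) ^ A i j) * z i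
  have hD : ContDiff ℂ ω D := contDiff_pi.2 fun i => contDiff_const.mul (contDiff_apply ℂ ℂ i)
  have hDc : ∀ y ∈ c.source, D (c y) = c (t • y) := fun y hy =>
    funext fun i => (h.smul_apply t y hy i).symm
  have h1 : ContMDiffAt 𝓘(ℂ, Fin n → ℂ) 𝓘(ℂ, Fin n → ℂ) ω (c.symm ∘ (D ∘ c)) x :=
    ContMDiffAt.comp x (h.contMDiffAt_symm_complex (by
      rw [Function.comp_apply, hDc x hx]
      exact c.map_source (h.smul_mem t x hx)))
      (ContMDiffAt.comp x hD.contMDiff.contMDiffAt (h.contMDiffAt_complex hx))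
  refine ((ContMDiffAt.restrictScalars h1).congr_of_eventuallyEq ?_).mdifferentiableAt (by simp)
  filter_upwards [c.open_source.mem_nhds hx] with y hy
  simp [hDc y hy, c.left_inv (h.smul_mem t y hy)]

end IsLogChart

/-- The differential of `logMap`, in the coordinates of the preferred chart. -/
def logDeriv (x₀ : X) (z : Fin n → ℂ) : (Fin n → ℂ) →L[ℝ] (Fin n → ℂ) := logMapDeriv x₀ z

namespace IsLogChart

variable {x₀ : X} {c : OpenPartialHomeomorph X (Fin n → ℂ)} {A : Matrix (Fin n) (Fin n) ℤ}

theorem hasMFDerivAt_logMap (h : IsLogChart x₀ c A) (z : Fin n → ℂ) :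
    HasMFDerivAt 𝓘(ℝ, Fin n → ℂ) 𝓘(ℝ, Fin n → ℂ) (logMap x₀) z (logDeriv x₀ z) :=
  ((h.contMDiffAt_logMap z).mdifferentiableAt (by simp)).hasMFDerivAt

theorem logDeriv_I_smul (h : IsLogChart x₀ c A) (z v : Fin n → ℂ) :
    logDeriv x₀ z (Complex.I • v) = Complex.I • logDeriv x₀ z v := by
  obtain ⟨L, hL⟩ := exists_hasMFDerivAt_restrictScalars
    ((h.contMDiffAt_logMap_complex z).mdifferentiableAt (by simp))
  have e : logDeriv x₀ z = L.restrictScalars ℝ :=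
    hasMFDerivAt_unique (h.hasMFDerivAt_logMap z) hL
  rw [e]
  exact L.map_smul _ _

/-- Followed by the chart, `logMap` becomes `toricExp`, whose derivative is injective. -/
theorem logDeriv_injective (h : IsLogChart x₀ c A) (z : Fin n → ℂ) :
    Function.Injective (logDeriv x₀ z) := by
  have hc := ((h.contMDiffAt_complex (h.logMap_mem z)).mdifferentiableAt (by simp))
  obtain ⟨K, hK⟩ := exists_hasMFDerivAt_restrictScalars hc
  have h1 : HasFDerivAt (c ∘ logMap x₀) ((K.restrictScalars ℝ).comp (logDeriv x₀ z)) z :=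
    (hK.comp z (h.hasMFDerivAt_logMap z)).hasFDerivAt
  have e : c ∘ logMap x₀ = toricExp A (c x₀) := funext h.apply_logMap
  rw [e] at h1
  have h2 := fderiv_toricExp_injective h.isUnit_det h.ne_zero z
  rw [h1.fderiv] at h2
  exact Function.Injective.of_comp h2

theorem logDeriv_surjective (h : IsLogChart x₀ c A) (z : Fin n → ℂ) :
    Function.Surjective (logDeriv x₀ z) :=
  LinearMap.injective_iff_surjective (f := (logDeriv x₀ z : (Fin n → ℂ) →ₗ[ℝ] _)).1
    (h.logDeriv_injective z)

theorem countable_periods (h : IsLogChart x₀ c A) :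
    {z : Fin n → ℂ | logMap x₀ z = x₀}.Countable := by
  refine (countable_toricExp_eq h.isUnit_det h.ne_zero).mono fun z hz => ?_
  rw [mem_ofPred_eq, ← h.apply_logMap, hz]

/-- The exponential map has smooth local inverses. -/
theorem exists_localInverse (h : IsLogChart x₀ c A) (z : Fin n → ℂ) :
    ∃ lg : X → Fin n → ℂ, lg (logMap x₀ z) = z ∧ ∀ᶠ x in nhds (logMap x₀ z),
      logMap x₀ (lg x) = x ∧ MDifferentiableAt 𝓘(ℝ, Fin n → ℂ) 𝓘(ℝ, Fin n → ℂ) lg x := by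
  have hF : ContDiffAt ℝ 1 (toricExp A (c x₀)) z :=
    ((contDiff_toricExp A (c x₀)).restrict_scalars ℝ).contDiffAt
  obtain ⟨e, he⟩ := exists_equiv_of_injective rfl
    (fderiv_toricExp_injective h.isUnit_det h.ne_zero z)
  have hF' : HasFDerivAt (toricExp A (c x₀)) (e : (Fin n → ℂ) →L[ℝ] (Fin n → ℂ)) z := by
    rw [he]
    exact (hF.differentiableAt one_ne_zero).hasFDerivAt
  have h1 : ∀ᶠ y in nhds (c (logMap x₀ z)),
      toricExp A (c x₀) (hF.localInverse hF' one_ne_zero y) = y := by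
    rw [h.apply_logMap]
    exact (hF.hasStrictFDerivAt' hF' one_ne_zero).eventually_right_inverse
  have h2 : ∀ᶠ y in nhds (c (logMap x₀ z)),
      DifferentiableAt ℝ (hF.localInverse hF' one_ne_zero) y := by
    rw [h.apply_logMap]
    filter_upwards [(hF.to_localInverse hF' one_ne_zero).eventually (by simp)] with y hy
    exact hy.differentiableAt one_ne_zero
  have hcont := c.continuousAt (h.logMap_mem z)
  refine ⟨hF.localInverse hF' one_ne_zero ∘ c, ?_, ?_⟩
  · rw [Function.comp_apply, h.apply_logMap]
    exact hF.localInverse_apply_image hF' one_ne_zero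
  · filter_upwards [hcont.eventually h1, hcont.eventually h2,
      c.open_source.mem_nhds (h.logMap_mem z)] with x hx1 hx2 hx3
    refine ⟨?_, MDifferentiableAt.comp x hx2.mdifferentiableAt
      ((ContMDiffAt.restrictScalars (h.contMDiffAt_complex hx3)).mdifferentiableAt (by simp))⟩
    rw [← h.symm_toricExp, Function.comp_apply, hx1, c.left_inv hx3]

/-- The exponential map turns translation by sξ into the action of exp(sξ), so fundamental fields
are constant in logarithmic coordinates. -/
theorem fundamentalField_logMap (h : IsLogChart x₀ c A) (ξ z : Fin n → ℂ) :
    (show Fin n → ℂ from fundamentalField ξ (logMap x₀ z)) = logDeriv x₀ z ξ := by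
  have h1 : HasFDerivAt (fun s : ℝ => s • ξ + z) ((ContinuousLinearMap.id ℝ ℝ).smulRight ξ) 0 :=
    ((hasFDerivAt_id (0 : ℝ)).smul_const ξ).add_const z
  have h2 := (h.hasMFDerivAt_logMap ((0 : ℝ) • ξ + z)).comp (0 : ℝ) h1.hasMFDerivAt
  have e : (fun s : ℝ => torusExp (s • ξ) • logMap x₀ z) = logMap x₀ ∘ fun s : ℝ => s • ξ + z :=
    funext fun s => torusExp_smul_logMap x₀ _ _
  have h3 : (show Fin n → ℂ from fundamentalField ξ (logMap x₀ z)) =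
      logDeriv x₀ ((0 : ℝ) • ξ + z) ((1 : ℝ) • ξ) := by
    have := congrArg (fun L : ℝ →L[ℝ] (Fin n → ℂ) => L 1) h2.mfderiv
    rw [← e] at this
    exact this
  rw [h3, one_smul, zero_smul, zero_add]

end IsLogChart

end Log

section Invariant

variable {n : ℕ} {X : Type*} [TopologicalSpace X] [ChartedSpace (Fin n → ℂ) X]
  [MulAction (Torus n) X] {x₀ : X} {c : OpenPartialHomeomorph X (Fin n → ℂ)}
  {A : Matrix (Fin n) (Fin n) ℤ} {B : BivectorField n X}

/-! ### Toric Poisson structures in logarithmic coordinates -/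

theorem IsLogChart.exists_logDeriv_equiv (h : IsLogChart x₀ c A) (z : Fin n → ℂ) :
    ∃ e : (Fin n → ℂ) ≃L[ℝ] (Fin n → ℂ), (e : (Fin n → ℂ) →L[ℝ] (Fin n → ℂ)) = logDeriv x₀ z :=
  exists_equiv_of_injective rfl (h.logDeriv_injective z)

theorem logBivector_apply (B : BivectorField n X) (x₀ : X) (α : (Fin n → ℂ) →L[ℝ] ℝ) :
    logBivector B x₀ α = (logDeriv x₀ 0).inverse
      (bivectorAt B (logMap x₀ (0 : Fin n → ℂ)) (α.comp (logDeriv x₀ 0).inverse)) := rfl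

theorem IsLogChart.related_logBivector_zero (h : IsLogChart x₀ c A) (B : BivectorField n X) :
    Related (logDeriv x₀ 0) (logBivector B x₀) (bivectorAt B (logMap x₀ (0 : Fin n → ℂ))) := by
  intro α
  obtain ⟨e, he⟩ := h.exists_logDeriv_equiv 0
  rw [logBivector_apply, ← he, ContinuousLinearMap.inverse_equiv]
  have h1 : (α.comp (e : (Fin n → ℂ) →L[ℝ] (Fin n → ℂ))).comp
      (e.symm : (Fin n → ℂ) →L[ℝ] (Fin n → ℂ)) = α := by ext; simp
  rw [h1]
  simp

/-- The differential of the action of an element of the torus. -/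
def smulDeriv (t : Torus n) (x : X) : (Fin n → ℂ) →L[ℝ] (Fin n → ℂ) :=
  mfderiv 𝓘(ℝ, Fin n → ℂ) 𝓘(ℝ, Fin n → ℂ) (fun y : X => t • y) x

/-- Differentiate exp(z)·`logMap` w = `logMap` (z + w) at w = 0. -/
theorem IsLogChart.smulDeriv_comp_logDeriv (h : IsLogChart x₀ c A) (z : Fin n → ℂ) :
    (smulDeriv (torusExp z) (logMap x₀ (0 : Fin n → ℂ))).comp (logDeriv x₀ 0) = logDeriv x₀ z := by
  have h1 := ((h.smul_mdifferentiableAt (torusExp z) (h.logMap_mem 0)).hasMFDerivAt).comp 0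
    (h.hasMFDerivAt_logMap 0)
  have e : (fun y : X => torusExp z • y) ∘ logMap x₀ = logMap x₀ ∘ fun w => z + w :=
    funext fun w => torusExp_smul_logMap x₀ z w
  have h2 : HasFDerivAt (fun w : Fin n → ℂ => z + w) (ContinuousLinearMap.id ℝ (Fin n → ℂ)) 0 :=
    (hasFDerivAt_id _).const_add z
  have h3 := (h.hasMFDerivAt_logMap (z + 0)).comp 0 h2.hasMFDerivAt
  rw [← e] at h3
  have h4 : (smulDeriv (torusExp z) (logMap x₀ (0 : Fin n → ℂ))).comp (logDeriv x₀ 0) =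
    logDeriv x₀ (z + 0) := hasMFDerivAt_unique h1 h3
  rw [h4, add_zero]

/-- In logarithmic coordinates an invariant bivector field is constant. -/
theorem IsToricPoisson.related_logBivector (hB : IsToricPoisson B) (h : IsLogChart x₀ c A)
    (z : Fin n → ℂ) : Related (logDeriv x₀ z) (logBivector B x₀) (bivectorAt B (logMap x₀ z)) := by
  have h1 : Related (smulDeriv (torusExp z) (logMap x₀ (0 : Fin n → ℂ)))
      (bivectorAt B (logMap x₀ (0 : Fin n → ℂ)))
      (bivectorAt B (torusExp z • logMap x₀ (0 : Fin n → ℂ))) :=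
    fun α => (hB.invariant (torusExp z) (logMap x₀ 0) α).symm
  rw [torusExp_smul_logMap, add_zero] at h1
  rw [← h.smulDeriv_comp_logDeriv z]
  exact (h.related_logBivector_zero B).comp h1

/-- A linear form which vanishes on the image of the bivector gives local Casimir functions. -/
theorem IsToricPoisson.exists_casimir (hB : IsToricPoisson B) (h : IsLogChart x₀ c A)
    {ℓ : (Fin n → ℂ) →L[ℝ] ℝ} (hℓ : ∀ α, ℓ (logBivector B x₀ α) = 0) (z : Fin n → ℂ) :
    ∃ k : X → ℝ, ∀ᶠ x in nhds (logMap x₀ z), (∃ ζ, logMap x₀ ζ = x ∧ ℓ ζ = k x) ∧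
      ∃ L : (Fin n → ℂ) →L[ℝ] ℝ, HasMFDerivAt 𝓘(ℝ, Fin n → ℂ) 𝓘(ℝ, ℝ) k x L ∧
        ∀ α, L (bivectorAt B x α) = 0 := by
  obtain ⟨lg, -, hlg⟩ := h.exists_localInverse z
  refine ⟨ℓ ∘ lg, ?_⟩
  filter_upwards [hlg, hlg.eventually_nhds] with x ⟨hx, hd⟩ hev
  obtain ⟨M, hM⟩ : ∃ M : (Fin n → ℂ) →L[ℝ] (Fin n → ℂ),
      HasMFDerivAt 𝓘(ℝ, Fin n → ℂ) 𝓘(ℝ, Fin n → ℂ) lg x M := ⟨_, hd.hasMFDerivAt⟩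
  refine ⟨⟨lg x, hx, rfl⟩, ℓ.comp M, ?_, fun α => ?_⟩
  · exact (ℓ.hasFDerivAt (x := lg x)).hasMFDerivAt.comp x hM
  · have h1 := (h.hasMFDerivAt_logMap (lg x)).comp x hM
    have h2 : HasMFDerivAt 𝓘(ℝ, Fin n → ℂ) 𝓘(ℝ, Fin n → ℂ) (logMap x₀ ∘ lg) x
        (ContinuousLinearMap.id ℝ (TangentSpace 𝓘(ℝ, Fin n → ℂ) x)) :=
      (hasMFDerivAt_id x).congr_of_eventuallyEq (hev.mono fun y hy => hy.1)
    have h3 : (logDeriv x₀ (lg x)).comp M = ContinuousLinearMap.id ℝ (Fin n → ℂ) :=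
      hasMFDerivAt_unique h1 h2
    have h4 := hB.related_logBivector h (lg x)
    rw [hx] at h4
    rw [← h4 α, ContinuousLinearMap.comp_apply]
    -- The right inverse `M` is also a left inverse because `logDeriv` is injective. Hence dk sends
    -- the image of the bivector to ℓ of the image of `logBivector`, which is zero.
    have h5 : ∀ u, M (logDeriv x₀ (lg x) u) = u := fun u =>
      h.logDeriv_injective (lg x) (congrArg (fun L => L (logDeriv x₀ (lg x) u)) h3)
    rw [h5, hℓ]

/-- The image of an affine hyperplane under the exponential map. -/
def logHyperplane (x₀ : X) (ℓ : (Fin n → ℂ) →L[ℝ] ℝ) (r : ℝ) : Set X :=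
  {x | ∃ ζ, logMap x₀ ζ = x ∧ ℓ ζ = r}

omit [TopologicalSpace X] [ChartedSpace (Fin n → ℂ) X] in
-- A point has many logarithms. Translating the one that lies on the hyperplane by ξ − ζ, on which ℓ
-- vanishes, gives a suitable logarithm of the other point.
theorem logHyperplane_mem_of_mem {ℓ : (Fin n → ℂ) →L[ℝ] ℝ} {r : ℝ} {ζ ξ : Fin n → ℂ}
    (h : ℓ ζ = ℓ ξ) (hζ : logMap x₀ ζ ∈ logHyperplane x₀ ℓ r) :
    logMap x₀ ξ ∈ logHyperplane x₀ ℓ r := by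
  obtain ⟨η, hη, hr⟩ := hζ
  refine ⟨(ξ - ζ) + η, ?_, by rw [map_add, map_sub, h, sub_self, zero_add, hr]⟩
  rw [logMap_add_congr hη, sub_add_cancel]

/-- Local branches of ℓ∘log are Casimir functions, hence constant along Hamiltonian curves.
Membership in the image of the hyperplane is therefore locally constant in t, and [0, 1] is
connected. The curve must stay in the orbit for branches of the logarithm to exist along it. -/
theorem IsToricPoisson.curve_mem_logHyperplane (hB : IsToricPoisson B) (h : IsLogChart x₀ c A)
    {ℓ : (Fin n → ℂ) →L[ℝ] ℝ} (hℓ : ∀ α, ℓ (logBivector B x₀ α) = 0) {r : ℝ} {f : X → ℝ}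
    {γ : ℝ → X} (hγ : IsMIntegralCurveOn (I := 𝓘(ℝ, Fin n → ℂ)) γ
      (fun z => B z (d n f z)) (Icc 0 1))
    (horb : ∀ t ∈ Icc (0 : ℝ) 1, γ t ∈ MulAction.orbit (Torus n) x₀)
    (h0 : γ 0 ∈ logHyperplane x₀ ℓ r) : γ 1 ∈ logHyperplane x₀ ℓ r := by
  refine ((isPreconnected_Icc (a := (0 : ℝ)) (b := 1)).induction₂
    (fun s t => γ s ∈ logHyperplane x₀ ℓ r ↔ γ t ∈ logHyperplane x₀ ℓ r) ?_
    (fun _ _ _ _ _ _ h1 h2 => h1.trans h2) (fun _ _ _ _ h1 => h1.symm) (x := 0) (y := 1)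
    (by simp) (by simp)).1 h0
  intro t₀ ht₀
  obtain ⟨z, hz⟩ : γ t₀ ∈ range (logMap (n := n) x₀) := by
    rw [range_logMap]
    exact horb t₀ ht₀
  obtain ⟨k, hk⟩ := hB.exists_casimir h hℓ z
  rw [hz] at hk
  have hc : ContinuousWithinAt γ (Icc 0 1) t₀ := (hγ t₀ ht₀).continuousWithinAt
  obtain ⟨ε, hε, hball⟩ := Metric.mem_nhdsWithin_iff.1 (hc.eventually hk)
  have hconv : Convex ℝ (Metric.ball t₀ ε ∩ Icc 0 1) := (convex_ball t₀ ε).inter (convex_Icc 0 1)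
  have hd : ∀ t ∈ Metric.ball t₀ ε ∩ Icc 0 1,
      HasFDerivWithinAt (k ∘ γ) (0 : ℝ →L[ℝ] ℝ) (Metric.ball t₀ ε ∩ Icc 0 1) t := fun t ht => by
    obtain ⟨-, L, hL, hL0⟩ := hball ht
    have h1 := ((hL.comp_hasMFDerivWithinAt t (hγ t ht.2)).hasFDerivWithinAt).mono
      (inter_subset_right (s := Metric.ball t₀ ε))
    refine h1.congr_fderiv (ContinuousLinearMap.ext_ring ?_)
    symm
    change (0 : ℝ) = L ((1 : ℝ) • bivectorAt B (γ t) (covector n f (γ t)))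
    rw [one_smul, hL0]
  have hmem : t₀ ∈ Metric.ball t₀ ε ∩ Icc 0 1 := ⟨Metric.mem_ball_self hε, ht₀⟩
  have hconst : ∀ t ∈ Metric.ball t₀ ε ∩ Icc 0 1, k (γ t₀) = k (γ t) := fun t ht => by
    have := hconv.norm_image_sub_le_of_norm_hasFDerivWithin_le hd (C := 0) (by simp) hmem ht
    simp only [zero_mul, norm_le_zero_iff, sub_eq_zero, Function.comp_apply] at this
    exact this.symm
  obtain ⟨⟨ζ₀, hζ₀, hk₀⟩, -⟩ := hball hmem
  filter_upwards [inter_mem_nhdsWithin (Icc 0 1) (Metric.ball_mem_nhds t₀ hε)] with t ht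
  obtain ⟨⟨ζ, hζ, hkζ⟩, -⟩ := hball ⟨ht.2, ht.1⟩
  have e : ℓ ζ₀ = ℓ ζ := by rw [hk₀, hkζ, hconst t ⟨ht.2, ht.1⟩]
  rw [← hζ₀, ← hζ]
  exact ⟨logHyperplane_mem_of_mem e, logHyperplane_mem_of_mem e.symm⟩

omit [MulAction (Torus n) X] in
-- The leaf is defined by endpoints of unit-time curves. Scaling the Hamiltonian and the time by `t`
-- makes γ(t) such an endpoint.
theorem symplecticLeaf_curve {x : X} {f : X → ℝ} {γ : ℝ → X}
    (hf : ContMDiff 𝓘(ℝ, Fin n → ℂ) 𝓘(ℝ, ℝ) ∞ f)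
    (hγ : IsMIntegralCurveOn (I := 𝓘(ℝ, Fin n → ℂ)) γ
      (fun z => B z (d n f z)) (Icc 0 1))
    (h0 : γ 0 ∈ symplecticLeaf B x) {t : ℝ} (ht : t ∈ Icc (0 : ℝ) 1) :
    γ t ∈ symplecticLeaf B x := by
  refine Relation.ReflTransGen.tail h0 ⟨t • f, γ ∘ (· * t), ?_, ?_, by simp, by simp⟩
  · exact (contMDiff_const (I' := 𝓘(ℝ, ℝ)) (c := t)).smul hf
  · have h1 := (hγ.comp_mul t).mono (s' := Icc 0 1)
      fun s hs => ⟨mul_nonneg hs.1 ht.1, mul_le_one₀ hs.2 ht.1 ht.2⟩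
    convert h1 using 1
    ext1 z
    have h2 : d n (t • f) z = t • d n f z :=
      const_smul_mfderiv ((hf z).mdifferentiableAt (by simp)) t
    rw [h2]
    exact (B z).map_smul t _

/-- The bivector of a toric Poisson structure is nondegenerate on the open orbit. -/
theorem IsToricPoisson.logBivector_surjective (hB : IsToricPoisson B) (h : IsLogChart x₀ c A) :
    Function.Surjective (logBivector B x₀) := by
  by_contra hsurj
  -- A nonzero functional killing the image of the bivector; the leaf of x₀ then stays in the image
  -- of its kernel.
  obtain ⟨ℓ', hℓ'0, hℓ'⟩ := Submodule.exists_le_ker_of_lt_top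
    (LinearMap.range (logBivector B x₀ : ((Fin n → ℂ) →L[ℝ] ℝ) →ₗ[ℝ] (Fin n → ℂ)))
    (lt_top_iff_ne_top.2 fun h' => hsurj (LinearMap.range_eq_top.1 h'))
  set ℓ : (Fin n → ℂ) →L[ℝ] ℝ := ℓ'.toContinuousLinearMap
  have hℓ : ∀ α, ℓ (logBivector B x₀ α) = 0 := fun α => hℓ' ⟨α, rfl⟩
  have hleaf : ∀ y ∈ symplecticLeaf B x₀, y ∈ logHyperplane x₀ ℓ 0 := fun y hy => by
    induction hy with
    | refl => exact ⟨0, logMap_zero x₀, map_zero ℓ⟩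
    | @tail p q hp hpq ih =>
      obtain ⟨f, γ, hf, hγ, rfl, rfl⟩ := hpq
      refine hB.curve_mem_logHyperplane h hℓ hγ (fun t ht => ?_) ih
      rw [← hB.leaf_eq_orbit]
      exact symplecticLeaf_curve hf hγ hp ht
  -- The leaf is the whole orbit, so every `z` differs by a period from a point of the kernel. Every
  -- real number is then the value of ℓ at a period, although the periods are countable.
  have huniv : (univ : Set ℝ) ⊆ ℓ '' {z | logMap x₀ z = x₀} := fun r _ => by
    obtain ⟨z, rfl⟩ := LinearMap.surjective hℓ'0 r
    obtain ⟨ζ, hζ, h0⟩ := hleaf (logMap x₀ z) (by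
      rw [hB.leaf_eq_orbit, ← range_logMap]
      exact mem_range_self z)
    refine ⟨z - ζ, logMap_sub_eq hζ.symm, ?_⟩
    rw [map_sub, h0, sub_zero]
    rfl
  exact Set.not_countable_univ ((h.countable_periods.image ℓ).mono huniv)

end Invariant

/-! ### Kähler potentials -/

section Split

variable {n : ℕ}

open Matrix

variable (n) in
/-- The inclusion `ℝⁿ → ℂⁿ` as a linear map. -/
def realL : (Fin n → ℝ) →L[ℝ] (Fin n → ℂ) :=
  ContinuousLinearMap.pi fun i => Complex.ofRealCLM.comp (ContinuousLinearMap.proj i)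

variable (n) in
/-- The real part as a linear map. -/
def reL : (Fin n → ℂ) →L[ℝ] (Fin n → ℝ) :=
  ContinuousLinearMap.pi fun i => Complex.reCLM.comp (ContinuousLinearMap.proj i)

variable (n) in
/-- The imaginary part as a linear map. -/
def imL : (Fin n → ℂ) →L[ℝ] (Fin n → ℝ) :=
  ContinuousLinearMap.pi fun i => Complex.imCLM.comp (ContinuousLinearMap.proj i)

theorem realL_apply (v : Fin n → ℝ) : realL n v = realVec v := rfl

theorem imagVec_eq (v : Fin n → ℝ) : imagVec v = Complex.I • realL n v := rfl

theorem reL_realL (v : Fin n → ℝ) : reL n (realL n v) = v := by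
  ext i
  exact Complex.ofReal_re _

theorem imL_realL (v : Fin n → ℝ) : imL n (realL n v) = 0 := by
  ext i
  exact Complex.ofReal_im (v i)

theorem reL_I_smul (v : Fin n → ℂ) : reL n (Complex.I • v) = -imL n v := by
  ext i
  exact Complex.I_mul_re _

theorem imL_I_smul (v : Fin n → ℂ) : imL n (Complex.I • v) = reL n v := by
  ext i
  exact Complex.I_mul_im _

theorem reL_imagVec (v : Fin n → ℝ) : reL n (imagVec v) = 0 := by
  rw [imagVec_eq, reL_I_smul, imL_realL, neg_zero]

theorem realL_add_imagVec (z : Fin n → ℂ) : realL n (reL n z) + imagVec (imL n z) = z := by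
  ext i
  change ((z i).re : ℂ) + Complex.I * ((z i).im : ℂ) = z i
  rw [mul_comm, Complex.re_add_im]

theorem I_smul_imagVec (v : Fin n → ℝ) : Complex.I • imagVec v = -realL n v := by
  rw [imagVec_eq, smul_smul, Complex.I_mul_I, neg_one_smul]

/-- The `(1,1)`-form given by a symmetric matrix. -/
theorem half_I_mul_sum {H : Matrix (Fin n) (Fin n) ℝ} (hH : H.IsSymm) (u v : Fin n → ℂ) :
    (Complex.I / 2) * ∑ j, ∑ k, (H j k : ℂ) *
        (u j * (starRingEnd ℂ) (v k) - v j * (starRingEnd ℂ) (u k)) =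
      ((reL n u ⬝ᵥ H *ᵥ imL n v - reL n v ⬝ᵥ H *ᵥ imL n u : ℝ) : ℂ) := by
  set S : ℂ := ∑ j, ∑ k, (H j k : ℂ) * (u j * (starRingEnd ℂ) (v k))
  -- Symmetry of `H` makes the double sum S − S̄ = 2i Im S, so the whole expression is −Im S.
  have h1 : ∑ j, ∑ k, (H j k : ℂ) * (u j * (starRingEnd ℂ) (v k) - v j * (starRingEnd ℂ) (u k)) =
      S - (starRingEnd ℂ) S := by
    simp only [mul_sub, Finset.sum_sub_distrib, S, map_sum, map_mul, Complex.conj_ofReal,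
      Complex.conj_conj]
    congr 1
    rw [Finset.sum_comm]
    refine Finset.sum_congr rfl fun j _ => Finset.sum_congr rfl fun k _ => ?_
    rw [hH.apply]
    ring
  have h2 : S.im = reL n v ⬝ᵥ H *ᵥ imL n u - reL n u ⬝ᵥ H *ᵥ imL n v := by
    have h3 : reL n v ⬝ᵥ H *ᵥ imL n u = ∑ j, ∑ k, H j k * ((u j).im * (v k).re) := by
      simp only [dotProduct, mulVec, Finset.mul_sum]
      rw [Finset.sum_comm]
      refine Finset.sum_congr rfl fun j _ => Finset.sum_congr rfl fun k _ => ?_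
      rw [hH.apply]
      change (v k).re * (H j k * (u j).im) = _
      ring
    have h4 : reL n u ⬝ᵥ H *ᵥ imL n v = ∑ j, ∑ k, H j k * ((u j).re * (v k).im) := by
      simp only [dotProduct, mulVec, Finset.mul_sum]
      refine Finset.sum_congr rfl fun j _ => Finset.sum_congr rfl fun k _ => ?_
      change (u j).re * (H j k * (v k).im) = _
      ring
    rw [h3, h4, ← Finset.sum_sub_distrib]
    simp only [S, Complex.im_sum]
    refine Finset.sum_congr rfl fun j _ => ?_
    rw [← Finset.sum_sub_distrib]
    refine Finset.sum_congr rfl fun k _ => ?_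
    simp [Complex.mul_im]
    ring
  rw [h1, Complex.sub_conj, h2]
  push_cast
  linear_combination (-(((reL n u ⬝ᵥ H *ᵥ imL n v : ℝ) : ℂ) - ((reL n v ⬝ᵥ H *ᵥ imL n u : ℝ) : ℂ))) *
    Complex.I_sq

end Split

/-! ### Kähler potentials from momentum maps -/

section Potential

variable {n : ℕ} {X : Type*} [TopologicalSpace X] [ChartedSpace (Fin n → ℂ) X]
  [MulAction (Torus n) X] {x₀ : X} {c : OpenPartialHomeomorph X (Fin n → ℂ)}
  {A : Matrix (Fin n) (Fin n) ℤ} {σ : TwoForm n X}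

open Matrix

theorem isKahlerPotential_iff {φ : (Fin n → ℝ) → ℝ} :
    IsKahlerPotential σ x₀ φ ↔ ContDiff ℝ ∞ φ ∧ ∀ z u v : Fin n → ℂ,
      formAt σ (logMap x₀ z) ![logDeriv x₀ z u, logDeriv x₀ z v] =
        reL n u ⬝ᵥ hessian φ (reL n z) *ᵥ imL n v - reL n v ⬝ᵥ hessian φ (reL n z) *ᵥ imL n u := by
  refine and_congr_right fun hφ => forall_congr' fun z => forall_congr' fun u =>
    forall_congr' fun v => ?_
  rw [half_I_mul_sum (hessian_isSymm hφ _), Complex.ofReal_inj]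
  rfl

/-- At a real vector v the value σ(v, iv) > 0 is the Hessian quadratic form. -/
theorem IsKahlerPotential.posDef (hσ : IsKahlerForm σ) (h : IsLogChart x₀ c A)
    {φ : (Fin n → ℝ) → ℝ} (hφ : IsKahlerPotential σ x₀ φ) (x : Fin n → ℝ) :
    (hessian φ x).PosDef := by
  refine Matrix.PosDef.of_dotProduct_mulVec_pos ?_ fun v hv => ?_
  · rw [Matrix.IsHermitian, conjTranspose_eq_transpose_of_trivial]
    exact hessian_isSymm hφ.1 x
  have hv' : logDeriv x₀ (realL n x) (realL n v) ≠ 0 := fun h0 => hv <| by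
    have := h.logDeriv_injective _ (h0.trans (map_zero _).symm)
    rw [← reL_realL v, this, map_zero]
  have h1 := hσ.formAt_pos (logMap x₀ (realL n x)) hv'
  rw [← h.logDeriv_I_smul, (isKahlerPotential_iff.1 hφ).2] at h1
  simpa [reL_realL, imL_realL, reL_I_smul, imL_I_smul] using h1

theorem torusExp_imagVec_mem (v : Fin n → ℝ) : torusExp (imagVec v) ∈ compactTorus n := fun j => by
  change ‖Complex.exp (Complex.I * (v j : ℂ))‖ = 1
  rw [mul_comm, Complex.norm_exp_ofReal_mul_I]

theorem hasFDerivAt_of_contDiff {f : (Fin n → ℝ) → ℝ} (hf : ContDiff ℝ ∞ f) (x : Fin n → ℝ) :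
    HasFDerivAt f (fderiv ℝ f x) x := (hf.differentiable (by simp) x).hasFDerivAt

/-- A Kähler form with a Hamiltonian action of the compact torus has a Kähler potential. -/
theorem exists_isKahlerPotential [IsManifold 𝓘(ℝ, Fin n → ℂ) ω X] (hσ : IsKahlerForm σ)
    (hham : IsHamiltonianAction σ) (h : IsLogChart x₀ c A) : ∃ φ, IsKahlerPotential σ x₀ φ := by
  obtain ⟨μ, hμs, hμi, hμ⟩ := hham
  set m : (Fin n → ℝ) → Fin n → ℝ := fun x k => μ (logMap x₀ (realL n x)) k
  have hlog : ∀ z, ContMDiffAt 𝓘(ℝ, Fin n → ℂ) 𝓘(ℝ, Fin n → ℂ) ∞ (logMap x₀) z := fun z =>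
    (h.contMDiffAt_logMap z).of_le le_top
  have hm : ∀ k, ContDiff ℝ ∞ fun x => m x k := fun k => contDiff_iff_contDiffAt.2 fun x =>
    (ContMDiffAt.comp x (ContMDiffAt.comp (realL n x) (hμs k _) (hlog _))
      (realL n).contDiff.contMDiff.contMDiffAt).contDiffAt
  -- Invariance under the compact torus removes the imaginary part of `z`.
  have hμm : ∀ z, μ (logMap x₀ z) = m (reL n z) := fun z => by
    conv_lhs => rw [← realL_add_imagVec z, add_comm, ← torusExp_smul_logMap]
    exact hμi _ (torusExp_imagVec_mem _) _
  set form : (Fin n → ℂ) → (Fin n → ℂ) → (Fin n → ℂ) → ℝ := fun z u v =>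
    formAt σ (logMap x₀ z) ![logDeriv x₀ z u, logDeriv x₀ z v]
  have hform : ∀ z w v, form z w (imagVec v) =
      ∑ k, v k * fderiv ℝ (fun x => m x k) (reL n z) (reL n w) := by
    intro z w v
    have h1 : MDifferentiableAt 𝓘(ℝ, Fin n → ℂ) 𝓘(ℝ, ℝ) (fun y => ∑ k, v k * μ y k)
        (logMap x₀ z) := by
      have : ContMDiffAt 𝓘(ℝ, Fin n → ℂ) 𝓘(ℝ, ℝ) ∞ (fun y => ∑ k, v k * μ y k) (logMap x₀ z) :=
        contMDiffAt_finsetSum fun k _ => contMDiffAt_const.mul (hμs k _)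
      exact this.mdifferentiableAt (by simp)
    have h2 := hasFDerivAt_comp (h.hasMFDerivAt_logMap z) h1
    have h3 : HasFDerivAt ((fun y => ∑ k, v k * μ y k) ∘ logMap x₀)
        (∑ k, v k • (fderiv ℝ (fun x => m x k) (reL n z)).comp (reL n)) z := by
      have e : (fun y => ∑ k, v k * μ y k) ∘ logMap x₀ = fun z => ∑ k, v k * m (reL n z) k :=
        funext fun z => by simp only [Function.comp_apply, hμm]
      rw [e]
      exact HasFDerivAt.fun_sum fun k _ =>
        ((hasFDerivAt_of_contDiff (hm k) (reL n z)).comp z (reL n).hasFDerivAt).const_mul (v k)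
    have h4 := congrArg (fun L : (Fin n → ℂ) →L[ℝ] ℝ => L w) (h2.unique h3)
    have h5 := hμ v (logMap x₀ z) (logDeriv x₀ z w)
    have h6 : (show Fin n → ℂ from fundamentalField (imagVec v) (logMap x₀ z)) =
        logDeriv x₀ z (imagVec v) := h.fundamentalField_logMap _ _
    have h7 : form z w (imagVec v) = covector n (fun y => ∑ k, v k * μ y k) (logMap x₀ z)
        (logDeriv x₀ z w) := by
      refine Eq.trans ?_ h5.symm
      change formAt σ (logMap x₀ z) ![_, logDeriv x₀ z (imagVec v)] = _
      rw [← h6]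
      rfl
    rw [h7]
    refine h4.trans ?_
    simp [_root_.sum_apply]
  have hI : ∀ z u v, form z (Complex.I • u) (Complex.I • v) = form z u v := fun z u v => by
    simp only [form, h.logDeriv_I_smul, hσ.formAt_I_smul]
  have hswap : ∀ z u v, form z u v = -form z v u := fun z u v => twoForm_swap _ _ _
  have hneg : ∀ z u v, form z u (-v) = -form z u v := fun z u v => by
    simp only [form, map_neg, ← flat_apply]
  have hadd : ∀ z u v v', form z u (v + v') = form z u v + form z u v' := fun z u v v' => by
    simp only [form, map_add, ← flat_apply]
  have hadd' : ∀ z u u' v, form z (u + u') v = form z u v + form z u' v := fun z u u' v => by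
    simp only [form, map_add, ← flat_apply, _root_.add_apply]
  -- The momentum map does not change in imaginary directions, so the orbits of the compact torus
  -- are isotropic; type (1,1) carries this over to real directions.
  have hii : ∀ z u v, form z (imagVec u) (imagVec v) = 0 := fun z u v => by
    simp [hform, reL_imagVec]
  have hrr : ∀ z u v, form z (realL n u) (realL n v) = 0 := fun z u v => by
    rw [← hI, ← imagVec_eq, ← imagVec_eq, hii]
  -- By type (1,1) the Jacobian of the momentum map is symmetric: the 1-form ∑ mₖ dxₖ is closed.
  have hsymm : ∀ z u v, form z (realL n u) (imagVec v) = form z (realL n v) (imagVec u) := by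
    intro z u v
    rw [← hI, I_smul_imagVec, ← imagVec_eq, hneg, ← hswap]
  set pr : Fin n → (Fin n → ℝ) →L[ℝ] ℝ := fun k => ContinuousLinearMap.proj k
  set W : (Fin n → ℝ) → (Fin n → ℝ) →L[ℝ] ℝ := fun x => ∑ k, m x k • pr k
  have hW : ContDiff ℝ ∞ W := ContDiff.sum fun k _ => (hm k).smul contDiff_const
  have hWd : ∀ x u v, fderiv ℝ W x u v = ∑ k, v k * fderiv ℝ (fun x => m x k) x u := fun x u v => by
    have h1 : HasFDerivAt W (∑ k, (fderiv ℝ (fun x => m x k) x).smulRight (pr k)) x :=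
      HasFDerivAt.fun_sum fun k _ => (hasFDerivAt_of_contDiff (hm k) x).smul_const (pr k)
    rw [h1.fderiv]
    simp [_root_.sum_apply, mul_comm, pr]
  -- Poincaré lemma on ℝⁿ: the closed 1-form `W` is the differential of some φ.
  obtain ⟨φ, hφ⟩ := convex_univ.exists_forall_hasFDerivAt_of_fderiv_symmetric isOpen_univ
    (hW.differentiable (by simp)).differentiableOn (fun x _ u v => by
      have := hsymm (realL n x) u v
      simp only [hform, reL_realL] at this
      rw [hWd, hWd, this])
  have hφW : fderiv ℝ φ = W := funext fun x => (hφ x (mem_univ x)).fderiv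
  have hφs : ContDiff ℝ ∞ φ := contDiff_infty_iff_fderiv.2
    ⟨fun x => (hφ x (mem_univ x)).differentiableAt, hφW ▸ hW⟩
  refine ⟨φ, isKahlerPotential_iff.2 ⟨hφs, fun z u v => ?_⟩⟩
  have hH : ∀ x a b, a ⬝ᵥ hessian φ x *ᵥ b = ∑ k, b k * fderiv ℝ (fun x => m x k) x a := by
    intro x a b
    have h1 : ∀ i j, hessian φ x i j = grad (fun x => m x j) x i := fun i j => by
      have h2 : (fun y => fderiv ℝ φ y (Pi.single j 1)) = fun y => m y j := by
        ext y
        simp [hφW, W, pr, _root_.sum_apply, Pi.single_apply]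
      rw [hessian, of_apply, h2]
      rfl
    simp only [fderiv_eq_grad_dotProduct, dotProduct, mulVec, h1, Finset.mul_sum]
    rw [Finset.sum_comm]
    exact Finset.sum_congr rfl fun j _ => Finset.sum_congr rfl fun i _ => by ring
  change form z u v = _
  have h1 : ∀ a b, form z (realL n a) (imagVec b) = a ⬝ᵥ hessian φ (reL n z) *ᵥ b := fun a b => by
    rw [hform, hH, reL_realL]
  conv_lhs => rw [← realL_add_imagVec u, ← realL_add_imagVec v]
  rw [hadd, hadd', hadd', hrr, hii, h1, hswap z (imagVec _) (realL n _), h1]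
  ring

end Potential

/-! ### Existence of adapted Darboux bases -/

section Linear

variable {n : ℕ}

open Matrix
open scoped MatrixOrder

/-- The two-form given by an antisymmetric bilinear form. -/
def twoFormOf (L : (Fin n → ℂ) →L[ℝ] (Fin n → ℂ) →L[ℝ] ℝ) (hL : ∀ u, L u u = 0) :
    (Fin n → ℂ) [⋀^Fin 2]→L[ℝ] ℝ where
  toFun m := L (m 0) (m 1)
  map_update_add' m i x y := by
    fin_cases i <;> simp
  map_update_smul' m i r x := by
    fin_cases i <;> simp
  cont := by fun_prop
  map_eq_zero_of_eq' m i j h hij := by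
    fin_cases i <;> fin_cases j
    · exact absurd rfl hij
    · change L (m 0) (m 1) = 0
      have h' : m 0 = m 1 := h
      rw [← h', hL]
    · change L (m 0) (m 1) = 0
      have h' : m 1 = m 0 := h
      rw [h', hL]
    · exact absurd rfl hij

theorem twoFormOf_apply (L : (Fin n → ℂ) →L[ℝ] (Fin n → ℂ) →L[ℝ] ℝ) (hL : ∀ u, L u u = 0)
    (u v : Fin n → ℂ) : twoFormOf L hL ![u, v] = L u v := rfl

variable (n) in
/-- Multiplication by `i`. -/
def mulI : (Fin n → ℂ) →L[ℝ] (Fin n → ℂ) := Complex.I • ContinuousLinearMap.id ℝ (Fin n → ℂ)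

theorem mulI_apply (v : Fin n → ℂ) : mulI n v = Complex.I • v := rfl

theorem mulI_mulI (v : Fin n → ℂ) : mulI n (mulI n v) = -v := by
  rw [mulI_apply, mulI_apply, smul_smul, Complex.I_mul_I, neg_one_smul]

variable (n) in
/-- The inclusion of `iℝⁿ` as a linear map. -/
def imagL : (Fin n → ℝ) →L[ℝ] (Fin n → ℂ) := (mulI n).comp (realL n)

theorem imagL_apply (v : Fin n → ℝ) : imagL n v = imagVec v := rfl

/-- Totally real positive bivectors of type `(1,1)`. -/
structure IsTotallyRealBivector (Q : Bivector n) : Prop where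
  antisymm : ∀ α β : (Fin n → ℂ) →L[ℝ] ℝ, β (Q α) = -α (Q β)
  type_one_one : ∀ α : (Fin n → ℂ) →L[ℝ] ℝ, mulI n (Q (α.comp (mulI n))) = Q α
  nonneg : ∀ α : (Fin n → ℂ) →L[ℝ] ℝ, 0 ≤ α (Q (α.comp (mulI n)))
  coisotropic : ∀ α β : (Fin n → ℂ) →L[ℝ] ℝ, (∀ v, α (imagVec v) = 0) →
    (∀ v, β (imagVec v) = 0) → β (Q α) = 0
  injective : Function.Injective Q

namespace IsTotallyRealBivector

variable {Q : Bivector n} (hQ : IsTotallyRealBivector Q)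

include hQ

/-- Coisotropy, tested against the real coordinate functions: the bivector maps the annihilator of 𝔱
into 𝔱. -/
theorem reL_eq_zero {α : (Fin n → ℂ) →L[ℝ] ℝ} (hα : ∀ v, α (imagVec v) = 0) : reL n (Q α) = 0 := by
  ext k
  exact hQ.coisotropic α ((ContinuousLinearMap.proj k).comp (reL n)) hα fun v => by
    rw [ContinuousLinearMap.comp_apply, reL_imagVec, map_zero]

/-- Composition with i exchanges the annihilators of 𝔱 and i𝔱, and type (1,1) transfers the previous
fact. -/
theorem imL_eq_zero {α : (Fin n → ℂ) →L[ℝ] ℝ} (hα : ∀ v, α (realL n v) = 0) : imL n (Q α) = 0 := by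
  have h1 := hQ.reL_eq_zero (α := α.comp (mulI n)) fun v => by
    rw [ContinuousLinearMap.comp_apply, mulI_apply, I_smul_imagVec, map_neg, hα, neg_zero]
  have h2 : (α.comp (mulI n)).comp (mulI n) = -α := by
    ext v
    simp [mulI_mulI]
  have h3 := hQ.type_one_one (α.comp (mulI n))
  rw [h2, map_neg, map_neg, mulI_apply] at h3
  rw [← h3, map_neg, reL_I_smul, neg_neg] at h1
  exact h1

/-- The converse of `reL_eq_zero`, from nondegeneracy. Split α into α₁, killing 𝔱, and α₂, killing
i𝔱. Then Q α₂ has both real and imaginary part zero, so α₂ = 0. -/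
theorem apply_imagVec_eq_zero {α : (Fin n → ℂ) →L[ℝ] ℝ} (hα : reL n (Q α) = 0) (v : Fin n → ℝ) :
    α (imagVec v) = 0 := by
  set α₁ := α.comp ((realL n).comp (reL n))
  set α₂ := α.comp ((imagL n).comp (imL n))
  have hα' : α₁ + α₂ = α := by
    ext z
    change α (realL n (reL n z)) + α (imagVec (imL n z)) = α z
    rw [← map_add, realL_add_imagVec]
  have h1 : reL n (Q α₁) = 0 := hQ.reL_eq_zero fun v => by
    change α (realL n (reL n (imagVec v))) = 0
    rw [reL_imagVec, map_zero, map_zero]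
  have h2 : imL n (Q α₂) = 0 := hQ.imL_eq_zero fun v => by
    change α (imagL n (imL n (realL n v))) = 0
    rw [imL_realL, map_zero, map_zero]
  have h3 : reL n (Q α₂) = 0 := by
    rw [← hα', map_add, map_add, h1, zero_add] at hα
    exact hα
  have h4 : α₂ = 0 := hQ.injective <| by
    rw [← realL_add_imagVec (Q α₂), h2, h3, map_zero, ← imagL_apply, map_zero, map_zero, zero_add]
  rw [← hα', h4, add_zero]
  change α (realL n (reL n (imagVec v))) = 0
  rw [reL_imagVec, map_zero, map_zero]

/-- A nondegenerate totally real positive bivector of type `(1,1)` has an inverse. -/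
theorem exists_isInverse : ∃ w, IsInverse Q w := by
  obtain ⟨e, he⟩ := exists_equiv_of_injective (finrank_dual_eq _) hQ.injective
  set L : (Fin n → ℂ) →L[ℝ] (Fin n → ℂ) →L[ℝ] ℝ := -(e.symm : (Fin n → ℂ) →L[ℝ] _)
  have hQL : ∀ u, Q (L u) = -u := fun u => by
    rw [← he]
    simp [L]
  have hL : ∀ u, L u u = 0 := fun u => by
    have := hQ.antisymm (L u) (L u)
    rw [hQL, map_neg] at this
    linarith
  refine ⟨twoFormOf L hL, fun u => ?_⟩
  have : flat (twoFormOf L hL) u = L u := by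
    ext v
    rw [flat_apply, twoFormOf_apply]
  rw [this, hQL]

/-- The covector w(iu, ·) has image −iu in 𝔱, so it annihilates 𝔱. -/
theorem form_imagVec {w : (Fin n → ℂ) [⋀^Fin 2]→L[ℝ] ℝ} (hw : IsInverse Q w) (u v : Fin n → ℝ) :
    w ![imagVec u, imagVec v] = 0 := by
  rw [← flat_apply]
  refine hQ.apply_imagVec_eq_zero ?_ v
  rw [hw, map_neg, reL_imagVec, neg_zero]

theorem form_I_smul {w : (Fin n → ℂ) [⋀^Fin 2]→L[ℝ] ℝ} (hw : IsInverse Q w) (u v : Fin n → ℂ) :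
    w ![Complex.I • u, Complex.I • v] = w ![u, v] := by
  have h1 : (flat w (mulI n u)).comp (mulI n) = flat w u := hQ.injective <| by
    have h2 := hQ.type_one_one (flat w (mulI n u))
    rw [hw] at h2
    have h3 := congrArg (mulI n) h2
    rw [mulI_mulI, map_neg, mulI_mulI, neg_neg] at h3
    rw [hw, eq_comm, neg_eq_iff_eq_neg]
    exact h3.symm
  rw [← flat_apply, ← flat_apply, ← h1]
  rfl

theorem form_realL {w : (Fin n → ℂ) [⋀^Fin 2]→L[ℝ] ℝ} (hw : IsInverse Q w) (u v : Fin n → ℝ) :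
    w ![realL n u, realL n v] = 0 := by
  rw [← hQ.form_I_smul hw]
  exact hQ.form_imagVec hw u v

theorem form_symm {w : (Fin n → ℂ) [⋀^Fin 2]→L[ℝ] ℝ} (hw : IsInverse Q w) (u v : Fin n → ℝ) :
    w ![realL n u, imagVec v] = w ![realL n v, imagVec u] := by
  rw [← hQ.form_I_smul hw, I_smul_imagVec, ← imagVec_eq, ← flat_apply, map_neg, flat_apply,
    ← twoForm_swap]

theorem form_nonneg {w : (Fin n → ℂ) [⋀^Fin 2]→L[ℝ] ℝ} (hw : IsInverse Q w) (u : Fin n → ℂ) :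
    0 ≤ w ![u, Complex.I • u] := by
  have h1 := hQ.nonneg ((flat w u).comp (mulI n))
  have h2 : ((flat w u).comp (mulI n)).comp (mulI n) = -flat w u := by
    ext v
    simp [mulI_mulI]
  rw [h2, map_neg, hw, neg_neg, ContinuousLinearMap.comp_apply, flat_apply, mulI_apply] at h1
  exact h1

theorem exists_darboux : ∃ (w : (Fin n → ℂ) [⋀^Fin 2]→L[ℝ] ℝ)
    (e : Module.Basis (Fin n) ℝ (Fin n → ℝ)), IsInverse Q w ∧
    (∀ j k, w ![realVec (e j), realVec (e k)] = 0) ∧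
    (∀ j k, w ![imagVec (e j), imagVec (e k)] = 0) ∧
    ∀ j k, w ![realVec (e j), imagVec (e k)] = if j = k then 1 else 0 := by
  obtain ⟨w, hw⟩ := hQ.exists_isInverse
  -- `G` is the Gram matrix of (a, b) ↦ w(a, ib), which is symmetric by type (1,1) and nonnegative
  -- by positivity of the bivector.
  set bl : (Fin n → ℝ) →ₗ[ℝ] (Fin n → ℝ) →ₗ[ℝ] ℝ :=
    LinearMap.mk₂ ℝ (fun a b => flat w (realL n a) (imagL n b))
      (by simp) (by simp) (by simp) (by simp)
  set G : Matrix (Fin n) (Fin n) ℝ := LinearMap.toMatrix₂' ℝ bl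
  have hG : ∀ a b, a ⬝ᵥ G *ᵥ b = w ![realL n a, imagVec b] := fun a b => by
    rw [← Matrix.toLinearMap₂'_apply', Matrix.toLinearMap₂'_toMatrix', ← imagL_apply, ← flat_apply]
    rfl
  have hGs : G.IsHermitian := by
    ext i j
    have h1 := hQ.form_symm hw (Pi.single j 1) (Pi.single i 1)
    rw [← hG, ← hG] at h1
    simpa using h1
  have hG0 : G.PosSemidef := Matrix.PosSemidef.of_dotProduct_mulVec_nonneg hGs fun x => by
    rw [star_trivial, hG, imagVec_eq]
    exact hQ.form_nonneg hw _
  -- A null vector of the semidefinite form lies in the kernel of `G`, hence in the kernel of the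
  -- nondegenerate `w`.
  have hGp : G.PosDef := Matrix.PosDef.of_dotProduct_mulVec_pos hGs fun x hx => by
    refine lt_of_le_of_ne (hG0.dotProduct_mulVec_nonneg x) fun h0 => hx ?_
    have h1 := (hG0.dotProduct_mulVec_zero_iff x).1 h0.symm
    have h2 : realL n x = 0 := isNondegenerate_iff.1 hw.isNondegenerate _ fun v => by
      rw [← realL_add_imagVec v, ← flat_apply, map_add, flat_apply, flat_apply,
        hQ.form_realL hw, hQ.form_symm hw, ← hG, h1]
      simp
    rw [← reL_realL x, h2, map_zero]
  -- With G = CᵀC, the columns of C⁻¹ are orthonormal for `G`.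
  obtain ⟨C, hC⟩ := CStarAlgebra.nonneg_iff_eq_star_mul_self.mp hG0.nonneg
  have hCu : IsUnit C.det := by
    have h1 := (Matrix.isUnit_iff_isUnit_det _).1 hGp.isUnit
    rw [hC, det_mul] at h1
    exact isUnit_of_mul_isUnit_right h1
  have hE : IsUnit (C⁻¹) :=
    (Matrix.isUnit_nonsing_inv_iff).2 ((Matrix.isUnit_iff_isUnit_det _).2 hCu)
  set e : Module.Basis (Fin n) ℝ (Fin n → ℝ) := (Pi.basisFun ℝ (Fin n)).map
    (LinearEquiv.ofInjectiveEndo (mulVecLin C⁻¹) (mulVec_injective_of_isUnit hE))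
  have he : ∀ j, e j = C⁻¹ *ᵥ Pi.single j 1 := fun j => by
    simp only [e, Module.Basis.map_apply, Pi.basisFun_apply]
    rfl
  have hCe : ∀ j, C *ᵥ e j = Pi.single j 1 := fun j => by
    rw [he, mulVec_mulVec, mul_nonsing_inv _ hCu, one_mulVec]
  refine ⟨w, e, hw, fun j k => hQ.form_realL hw _ _, fun j k => hQ.form_imagVec hw _ _,
    fun j k => ?_⟩
  rw [← realL_apply, ← hG, hC, ← mulVec_mulVec, hCe, star_eq_conjTranspose,
    conjTranspose_eq_transpose_of_trivial, mulVec_transpose, dotProduct_comm, ← dotProduct_mulVec,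
    hCe]
  simp [Pi.single_apply]

end IsTotallyRealBivector

end Linear

/-! ### The toric Poisson structure at the base point -/

section Darboux

variable {n : ℕ} {X : Type*} [TopologicalSpace X] [ChartedSpace (Fin n → ℂ) X]
  [MulAction (Torus n) X] {x₀ : X} {c : OpenPartialHomeomorph X (Fin n → ℂ)}
  {A : Matrix (Fin n) (Fin n) ℤ} {B : BivectorField n X}

/-- The differential of the exponential map commutes with i and sends imaginary vectors to
fundamental fields, so all conditions transport to ℂⁿ. Injectivity comes from surjectivity between
spaces of equal dimension. -/
theorem IsToricPoisson.isTotallyRealBivector (hB : IsToricPoisson B) (hreal : IsTotallyReal B)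
    (h : IsLogChart x₀ c A) : IsTotallyRealBivector (logBivector B x₀) := by
  obtain ⟨e, he⟩ := h.exists_logDeriv_equiv 0
  have hQ : ∀ α, logBivector B x₀ α = e.symm (bivectorAt B (logMap x₀ (0 : Fin n → ℂ))
      (α.comp (e.symm : (Fin n → ℂ) →L[ℝ] (Fin n → ℂ)))) := fun α => by
    rw [logBivector_apply, ← he, ContinuousLinearMap.inverse_equiv]
    rfl
  have heI : ∀ v, e.symm (mulI n v) = mulI n (e.symm v) := fun v => by
    rw [ContinuousLinearEquiv.symm_apply_eq]
    have h1 : ∀ u, e u = logDeriv x₀ 0 u := fun u => by rw [← he]; rfl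
    rw [h1, mulI_apply, mulI_apply, h.logDeriv_I_smul, ← h1, e.apply_symm_apply]
  have hcomp : ∀ α : (Fin n → ℂ) →L[ℝ] ℝ,
      (α.comp (mulI n)).comp (e.symm : (Fin n → ℂ) →L[ℝ] (Fin n → ℂ)) =
        (α.comp (e.symm : (Fin n → ℂ) →L[ℝ] (Fin n → ℂ))).comp (mulI n) := fun α => by
    ext v
    simp [heI]
  refine ⟨fun α β => ?_, fun α => ?_, fun α => ?_, fun α β hα hβ => ?_, ?_⟩
  · rw [hQ, hQ]
    exact hB.antisymm _ (α.comp (e.symm : (Fin n → ℂ) →L[ℝ] (Fin n → ℂ)))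
      (β.comp (e.symm : (Fin n → ℂ) →L[ℝ] (Fin n → ℂ)))
  · rw [hQ, hQ, hcomp, ← heI]
    congr 1
    refine SeparatingDual.eq_iff_forall_dual_eq (R := ℝ) |>.2 fun β => ?_
    exact hB.type_one_one _ (α.comp (e.symm : (Fin n → ℂ) →L[ℝ] (Fin n → ℂ))) β
  · rw [hQ, hcomp]
    exact hB.nonneg _ (α.comp (e.symm : (Fin n → ℂ) →L[ℝ] (Fin n → ℂ)))
  · rw [hQ]
    have key : ∀ α : (Fin n → ℂ) →L[ℝ] ℝ, (∀ v, α (imagVec v) = 0) → ∀ v : Fin n → ℝ,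
        α.comp (e.symm : (Fin n → ℂ) →L[ℝ] (Fin n → ℂ))
          (show Fin n → ℂ from fundamentalField (imagVec v) (logMap x₀ (0 : Fin n → ℂ))) = 0 := by
      intro α hα v
      rw [h.fundamentalField_logMap, ← he]
      simpa using hα v
    exact hreal _ (α.comp (e.symm : (Fin n → ℂ) →L[ℝ] (Fin n → ℂ)))
      (β.comp (e.symm : (Fin n → ℂ) →L[ℝ] (Fin n → ℂ))) (key α hα) (key β hβ)
  · exact (LinearMap.injective_iff_surjective_of_finrank_eq_finrank (finrank_dual_eq (Fin n → ℂ))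
      (f := (logBivector B x₀ : ((Fin n → ℂ) →L[ℝ] ℝ) →ₗ[ℝ] (Fin n → ℂ)))).2
      (hB.logBivector_surjective h)

theorem IsToricPoisson.exists_isAdaptedDarbouxBasis (hB : IsToricPoisson B)
    (hreal : IsTotallyReal B) (h : IsLogChart x₀ c A) : ∃ e, IsAdaptedDarbouxBasis B x₀ e := by
  obtain ⟨w, e, hw⟩ := (hB.isTotallyRealBivector hreal h).exists_darboux
  exact ⟨e, w, hw⟩

end Darboux

/-! ### Poisson commutation in logarithmic coordinates -/

section Standard

variable {n : ℕ}

open Matrix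

/-- The covector `z ↦ ⟨a, Re z⟩ + ⟨b, Im z⟩`. -/
def covec (a b : Fin n → ℝ) : (Fin n → ℂ) →L[ℝ] ℝ :=
  (LinearMap.toContinuousLinearMap (dotProductBilin ℝ ℝ a)).comp (reL n) +
    (LinearMap.toContinuousLinearMap (dotProductBilin ℝ ℝ b)).comp (imL n)

theorem covec_apply (a b : Fin n → ℝ) (z : Fin n → ℂ) :
    covec a b z = a ⬝ᵥ reL n z + b ⬝ᵥ imL n z := rfl

/-- The components of a covector on the real vectors. -/
def coRe (α : (Fin n → ℂ) →L[ℝ] ℝ) : Fin n → ℝ := fun j => α (realL n (Pi.single j 1))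

/-- The components of a covector on the imaginary vectors. -/
def coIm (α : (Fin n → ℂ) →L[ℝ] ℝ) : Fin n → ℝ := fun j => α (imagL n (Pi.single j 1))

theorem apply_realL (α : (Fin n → ℂ) →L[ℝ] ℝ) (v : Fin n → ℝ) : α (realL n v) = coRe α ⬝ᵥ v := by
  conv_lhs => rw [pi_eq_sum_univ' v]
  simp [coRe, dotProduct, mul_comm]

theorem apply_imagVec (α : (Fin n → ℂ) →L[ℝ] ℝ) (v : Fin n → ℝ) : α (imagVec v) = coIm α ⬝ᵥ v := by
  rw [← imagL_apply]
  conv_lhs => rw [pi_eq_sum_univ' v]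
  simp [coIm, dotProduct, mul_comm]

theorem imL_imagVec (v : Fin n → ℝ) : imL n (imagVec v) = v := by
  rw [imagVec_eq, imL_I_smul, reL_realL]

theorem coRe_covec (a b : Fin n → ℝ) : coRe (covec a b) = a := by
  ext j
  simp [coRe, covec_apply, reL_realL, imL_realL]

theorem coIm_covec (a b : Fin n → ℝ) : coIm (covec a b) = b := by
  ext j
  simp [coIm, covec_apply, imagL_apply, reL_imagVec, imL_imagVec]

/-- The bivector `∑ Nⱼₖ ∂/∂xⱼ ∧ ∂/∂yₖ` given by a matrix `N`. -/
def stdBivector (N : Matrix (Fin n) (Fin n) ℝ) : Bivector n :=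
  LinearMap.toContinuousLinearMap
    { toFun := fun α => imagL n (N *ᵥ coRe α) - realL n (N *ᵥ coIm α)
      map_add' := fun α β => by
        have h1 : coRe (α + β) = coRe α + coRe β := rfl
        have h2 : coIm (α + β) = coIm α + coIm β := rfl
        rw [h1, h2, mulVec_add, mulVec_add, map_add, map_add]
        abel
      map_smul' := fun r α => by
        have h1 : coRe (r • α) = r • coRe α := rfl
        have h2 : coIm (r • α) = r • coIm α := rfl
        rw [h1, h2, mulVec_smul, mulVec_smul, map_smul, map_smul, ← smul_sub]
        rfl }

theorem stdBivector_apply (N : Matrix (Fin n) (Fin n) ℝ) (α : (Fin n → ℂ) →L[ℝ] ℝ) :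
    stdBivector N α = imagVec (N *ᵥ coRe α) - realL n (N *ᵥ coIm α) := rfl

theorem covector_stdBivector (N : Matrix (Fin n) (Fin n) ℝ) (α β : (Fin n → ℂ) →L[ℝ] ℝ) :
    β (stdBivector N α) = coIm β ⬝ᵥ N *ᵥ coRe α - coRe β ⬝ᵥ N *ᵥ coIm α := by
  rw [stdBivector_apply, map_sub, apply_imagVec, apply_realL]

theorem isSymm_dotProduct_comm {N : Matrix (Fin n) (Fin n) ℝ} (hN : N.IsSymm) (a b : Fin n → ℝ) :
    a ⬝ᵥ N *ᵥ b = b ⬝ᵥ N *ᵥ a := by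
  rw [dotProduct_comm b, dotProduct_mulVec, ← mulVec_transpose, hN.eq]

theorem stdBivector_antisymm {N : Matrix (Fin n) (Fin n) ℝ} (hN : N.IsSymm)
    (α β : (Fin n → ℂ) →L[ℝ] ℝ) : β (stdBivector N α) = -α (stdBivector N β) := by
  rw [covector_stdBivector, covector_stdBivector, isSymm_dotProduct_comm hN (coIm β),
    isSymm_dotProduct_comm hN (coRe β)]
  ring

/-- The form `∑ Hⱼₖ dxⱼ ∧ dyₖ` is inverse to the bivector given by `H⁻¹`. -/
theorem stdBivector_isInverse {H : Matrix (Fin n) (Fin n) ℝ} (hs : H.IsSymm) (hH : IsUnit H.det)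
    {w : (Fin n → ℂ) [⋀^Fin 2]→L[ℝ] ℝ}
    (hw : ∀ u v, w ![u, v] = reL n u ⬝ᵥ H *ᵥ imL n v - reL n v ⬝ᵥ H *ᵥ imL n u) :
    IsInverse (stdBivector H⁻¹) w := fun u => by
  have h1 : coRe (flat w u) = -(H *ᵥ imL n u) := by
    ext j
    simp [coRe, flat_apply, hw, reL_realL, imL_realL]
  have h2 : coIm (flat w u) = H *ᵥ reL n u := by
    ext j
    rw [coIm, flat_apply, hw, imagL_apply, imL_imagVec, reL_imagVec, isSymm_dotProduct_comm hs]
    simp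
  rw [stdBivector_apply, h1, h2, mulVec_neg, mulVec_mulVec, mulVec_mulVec, nonsing_inv_mul _ hH,
    one_mulVec, one_mulVec]
  conv_rhs => rw [← realL_add_imagVec u]
  rw [← imagL_apply, ← imagL_apply, map_neg]
  abel

/-- A two-form with prescribed values. -/
theorem exists_twoForm {H : Matrix (Fin n) (Fin n) ℝ} : ∃ w : (Fin n → ℂ) [⋀^Fin 2]→L[ℝ] ℝ,
    ∀ u v, w ![u, v] = reL n u ⬝ᵥ H *ᵥ imL n v - reL n v ⬝ᵥ H *ᵥ imL n u := by
  set L : (Fin n → ℂ) →ₗ[ℝ] (Fin n → ℂ) →ₗ[ℝ] ℝ := LinearMap.mk₂ ℝ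
    (fun u v => reL n u ⬝ᵥ H *ᵥ imL n v - reL n v ⬝ᵥ H *ᵥ imL n u)
    (fun u u' v => by simp only [map_add, add_dotProduct, mulVec_add, dotProduct_add]; ring)
    (fun r u v => by simp only [map_smul, smul_dotProduct, mulVec_smul, dotProduct_smul, smul_sub])
    (fun u v v' => by simp only [map_add, add_dotProduct, mulVec_add, dotProduct_add]; ring)
    (fun r u v => by simp only [map_smul, smul_dotProduct, mulVec_smul, dotProduct_smul, smul_sub])
  refine ⟨twoFormOf (LinearMap.toContinuousLinearMap
    ((LinearMap.toContinuousLinearMap : ((Fin n → ℂ) →ₗ[ℝ] ℝ) ≃ₗ[ℝ] _).toLinearMap ∘ₗ L))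
    fun u => ?_, fun u v => rfl⟩
  exact sub_self (reL n u ⬝ᵥ H *ᵥ imL n u)

/-- The bilinear forms of the matrices `∂N/∂u`. -/
def matDeriv (N : (Fin n → ℝ) → Matrix (Fin n) (Fin n) ℝ) (x u a b : Fin n → ℝ) : ℝ :=
  fderiv ℝ (fun y => a ⬝ᵥ N y *ᵥ b) x u

section

variable {N : (Fin n → ℝ) → Matrix (Fin n) (Fin n) ℝ} {x : Fin n → ℝ}

theorem matDeriv_comm (hN : ∀ y, (N y).IsSymm) (u a b : Fin n → ℝ) :
    matDeriv N x u a b = matDeriv N x u b a := by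
  simp only [matDeriv, isSymm_dotProduct_comm (hN _) a b]

theorem contDiffAt_dotProduct_mulVec {k : ℕ∞ω} (hN : ∀ i j, ContDiffAt ℝ k (fun y => N y i j) x)
    (a b : Fin n → ℝ) : ContDiffAt ℝ k (fun y => a ⬝ᵥ N y *ᵥ b) x := by
  simp only [dotProduct, mulVec]
  exact ContDiffAt.sum fun i _ => contDiffAt_const.mul
    (ContDiffAt.sum fun j _ => (hN i j).mul contDiffAt_const)

theorem matDeriv_eq_sum (hN : ∀ i j, DifferentiableAt ℝ (fun y => N y i j) x) (u a b : Fin n → ℝ) :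
    matDeriv N x u a b = ∑ k, ∑ i, ∑ j, u k * a i * b j *
      fderiv ℝ (fun y => N y i j) x (Pi.single k 1) := by
  have h1 : HasFDerivAt (fun y => a ⬝ᵥ N y *ᵥ b)
      (∑ i, a i • ∑ j, b j • fderiv ℝ (fun y => N y i j) x) x := by
    simp only [dotProduct, mulVec]
    exact HasFDerivAt.fun_sum fun i _ => HasFDerivAt.const_mul
      (HasFDerivAt.fun_sum fun j _ => (hN i j).hasFDerivAt.mul_const (b j)) (a i)
  rw [matDeriv, h1.fderiv]
  simp only [_root_.sum_apply, _root_.smul_apply, smul_eq_mul, Finset.mul_sum]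
  have h2 : ∀ i j, fderiv ℝ (fun y => N y i j) x u =
      ∑ k, u k * fderiv ℝ (fun y => N y i j) x (Pi.single k 1) := fun i j => by
    conv_lhs => rw [pi_eq_sum_univ' u]
    simp
  simp only [h2, Finset.mul_sum]
  conv_rhs => rw [Finset.sum_comm]
  refine Finset.sum_congr rfl fun i _ => ?_
  conv_rhs => rw [Finset.sum_comm]
  exact Finset.sum_congr rfl fun j _ => Finset.sum_congr rfl fun k _ => by ring

/-- The derivative of `N` is trilinear, so the symmetry may be checked on basis vectors. -/
theorem matDeriv_symm_iff (hN : ∀ i j, DifferentiableAt ℝ (fun y => N y i j) x) :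
    (∀ u a b, matDeriv N x u a b = matDeriv N x b a u) ↔
    ∀ i j k : Fin n, fderiv ℝ (fun y => N y i j) x (Pi.single k 1) =
      fderiv ℝ (fun y => N y i k) x (Pi.single j 1) := by
  constructor
  · intro h i j k
    have := h (Pi.single k 1) (Pi.single i 1) (Pi.single j 1)
    simpa [matDeriv] using this
  · intro h u a b
    rw [matDeriv_eq_sum hN, matDeriv_eq_sum hN]
    calc _ = ∑ k, ∑ j, ∑ i, u k * a i * b j * fderiv ℝ (fun y => N y i j) x (Pi.single k 1) :=
          Finset.sum_congr rfl fun k _ => Finset.sum_comm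
      _ = ∑ j, ∑ k, ∑ i, u k * a i * b j * fderiv ℝ (fun y => N y i j) x (Pi.single k 1) :=
          Finset.sum_comm
      _ = ∑ j, ∑ k, ∑ i, b j * a i * u k * fderiv ℝ (fun y => N y i k) x (Pi.single j 1) :=
          Finset.sum_congr rfl fun j _ => Finset.sum_congr rfl fun k _ =>
            Finset.sum_congr rfl fun i _ => by rw [h]; ring
      _ = _ := Finset.sum_congr rfl fun j _ => Finset.sum_comm

theorem contDiffAt_stdBivector {k : ℕ∞ω} {z : Fin n → ℂ}
    (hN : ∀ i j, ContDiffAt ℝ k (fun y => N y i j) (reL n z)) :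
    ContDiffAt ℝ k (fun z => stdBivector (N (reL n z))) z := by
  refine contDiffAt_bivector fun α β => ?_
  simp only [covector_stdBivector]
  exact ((contDiffAt_dotProduct_mulVec hN _ _).comp z (reL n).contDiff.contDiffAt).sub
    ((contDiffAt_dotProduct_mulVec hN _ _).comp z (reL n).contDiff.contDiffAt)

theorem covector_fderiv_stdBivector {z : Fin n → ℂ}
    (hN : ∀ i j, ContDiffAt ℝ 1 (fun y => N y i j) (reL n z)) (v : Fin n → ℂ)
    (α β : (Fin n → ℂ) →L[ℝ] ℝ) :
    β (fderiv ℝ (fun z => stdBivector (N (reL n z))) z v α) =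
      matDeriv N (reL n z) (reL n v) (coIm β) (coRe α) -
        matDeriv N (reL n z) (reL n v) (coRe β) (coIm α) := by
  have hd := ((contDiffAt_stdBivector hN).differentiableAt one_ne_zero).hasFDerivAt
  have h1 : HasFDerivAt (fun z => β (stdBivector (N (reL n z)) α)) (β.comp
      ((ContinuousLinearMap.apply ℝ (Fin n → ℂ) α).comp
        (fderiv ℝ (fun z => stdBivector (N (reL n z))) z))) z :=
    β.hasFDerivAt.comp z (HasFDerivAt.comp (g := fun Q : Bivector n => Q α) z
      (ContinuousLinearMap.apply ℝ (Fin n → ℂ) α).hasFDerivAt hd)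
  have hm : ∀ a b, HasFDerivAt (fun z => a ⬝ᵥ N (reL n z) *ᵥ b)
      ((fderiv ℝ (fun y => a ⬝ᵥ N y *ᵥ b) (reL n z)).comp (reL n)) z := fun a b =>
    (((contDiffAt_dotProduct_mulVec hN a b).differentiableAt one_ne_zero).hasFDerivAt).comp z
      (reL n).hasFDerivAt
  have h2 := (hm (coIm β) (coRe α)).sub (hm (coRe β) (coIm α))
  simp only [covector_stdBivector] at h1
  exact congrArg (fun L : (Fin n → ℂ) →L[ℝ] ℝ => L v) (h1.unique h2)

/-- The Schouten bracket of the constant bivector `∑ ∂/∂xⱼ ∧ ∂/∂yⱼ` with the bivector given by a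
matrix valued function on `ℝⁿ`. -/
theorem schoutenTensor_stdBivector {z : Fin n → ℂ} (hs : ∀ y, (N y).IsSymm)
    (hN : ∀ i j, ContDiffAt ℝ 1 (fun y => N y i j) (reL n z)) :
    (∀ α β γ,
      schoutenTensor (fun _ => stdBivector 1) (fun z => stdBivector (N (reL n z))) z α β γ = 0)
      ↔ ∀ u a b, matDeriv N (reL n z) u a b = matDeriv N (reL n z) b a u := by
  have hv : ∀ α, reL n (stdBivector 1 α) = -coIm α := fun α => by
    rw [stdBivector_apply, map_sub, reL_imagVec, reL_realL, one_mulVec, zero_sub]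
  have hneg : ∀ u a b, matDeriv N (reL n z) (-u) a b = -matDeriv N (reL n z) u a b := fun u a b =>
    map_neg _ _
  have h0 : ∀ u a, matDeriv N (reL n z) u a 0 = 0 := fun u a => by
    simp [matDeriv]
  have h0' : ∀ a b, matDeriv N (reL n z) 0 a b = 0 := fun a b => by
    simp [matDeriv]
  -- The constant bivector contributes no derivative, and it sends α to a vector with real part
  -- −`coIm` α, the only part along which `N` varies.
  simp only [schoutenTensor, covector_fderiv_stdBivector hN, hv, hneg, fderiv_const_apply]
  constructor
  · intro h u a b
    -- Two covectors of dy type and one of dx type isolate a single pair of terms.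
    have := h (covec 0 u) (covec 0 b) (covec a 0)
    simp only [coRe_covec, coIm_covec, h0, h0'] at this
    simp at this
    rw [matDeriv_comm hs b a u]
    linarith
  · intro h α β γ
    -- The six terms cancel in pairs.
    rw [matDeriv_comm hs (coIm α) (coIm γ) (coRe β), matDeriv_comm hs (coIm β) (coIm α) (coRe γ),
      matDeriv_comm hs (coIm γ) (coIm β) (coRe α), h (coIm α) (coRe β), h (coIm β) (coRe γ),
      h (coIm γ) (coRe α)]
    simp

end

end Standard

/-! ### Adapted coordinates -/

section Coords

variable {n : ℕ} (e : Module.Basis (Fin n) ℝ (Fin n → ℝ))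

open Matrix

/-- The linear coordinates of a basis. -/
def coordsL : (Fin n → ℝ) ≃L[ℝ] (Fin n → ℝ) := e.equivFun.symm.toContinuousLinearEquiv

theorem coordsL_apply (x : Fin n → ℝ) : coordsL e x = ofCoords e x := e.equivFun_symm_apply x

/-- The complex linear coordinates of a basis of `ℝⁿ`. -/
def complexCoords : (Fin n → ℂ) →L[ℝ] (Fin n → ℂ) :=
  ((realL n).comp ((coordsL e : (Fin n → ℝ) →L[ℝ] (Fin n → ℝ)).comp (reL n))) +
    ((imagL n).comp ((coordsL e : (Fin n → ℝ) →L[ℝ] (Fin n → ℝ)).comp (imL n)))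

theorem complexCoords_apply (z : Fin n → ℂ) :
    complexCoords e z = realL n (coordsL e (reL n z)) + imagVec (coordsL e (imL n z)) := rfl

theorem reL_complexCoords (z : Fin n → ℂ) : reL n (complexCoords e z) = coordsL e (reL n z) := by
  rw [complexCoords_apply, map_add, reL_realL, reL_imagVec, add_zero]

theorem imL_complexCoords (z : Fin n → ℂ) : imL n (complexCoords e z) = coordsL e (imL n z) := by
  rw [complexCoords_apply, map_add, imL_realL, imL_imagVec, zero_add]

theorem complexCoords_surjective : Function.Surjective (complexCoords e) := fun z =>
  ⟨realL n ((coordsL e).symm (reL n z)) + imagVec ((coordsL e).symm (imL n z)), by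
    rw [complexCoords_apply, map_add (reL n), map_add (imL n), reL_realL, imL_realL,
      reL_imagVec, imL_imagVec, add_zero, zero_add, ContinuousLinearEquiv.apply_symm_apply,
      ContinuousLinearEquiv.apply_symm_apply, realL_add_imagVec]⟩

theorem dotProduct_hessian_mulVec {f : (Fin n → ℝ) → ℝ} (hf : ContDiff ℝ ∞ f) (x a b : Fin n → ℝ) :
    a ⬝ᵥ hessian f x *ᵥ b = fderiv ℝ (fun y => fderiv ℝ f y b) x a := by
  have h1 : HasFDerivAt (fun y => fderiv ℝ f y b)
      (∑ j, b j • fderiv ℝ (fun y => grad f y j) x) x := by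
    simp only [fderiv_eq_grad_dotProduct, dotProduct]
    exact HasFDerivAt.fun_sum fun j _ =>
      (hasFDerivAt_of_contDiff (contDiff_pi.1 (contDiff_grad hf) j) x).mul_const (b j)
  rw [h1.fderiv]
  simp only [_root_.sum_apply, _root_.smul_apply, smul_eq_mul, fderiv_eq_grad_dotProduct]
  simp only [dotProduct, mulVec, Finset.mul_sum]
  rw [Finset.sum_comm]
  refine Finset.sum_congr rfl fun j _ => Finset.sum_congr rfl fun i _ => ?_
  change a i * (grad (fun y => grad f y j) x i * b j) = _
  ring

theorem fderiv_comp_coordsL {φ : (Fin n → ℝ) → ℝ} (hφ : ContDiff ℝ ∞ φ) (x v : Fin n → ℝ) :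
    fderiv ℝ (fun x => φ (coordsL e x)) x v = fderiv ℝ φ (coordsL e x) (coordsL e v) := by
  have h := (hasFDerivAt_of_contDiff hφ (coordsL e x)).comp x (coordsL e).hasFDerivAt
  exact congrArg (fun L : (Fin n → ℝ) →L[ℝ] ℝ => L v) h.fderiv

theorem contDiff_comp_coordsL {φ : (Fin n → ℝ) → ℝ} (hφ : ContDiff ℝ ∞ φ) :
    ContDiff ℝ ∞ fun x => φ (coordsL e x) := hφ.comp (coordsL e).contDiff

/-- Hessians transform by congruence under linear changes of coordinates. -/
theorem dotProduct_hessian_comp_coordsL {φ : (Fin n → ℝ) → ℝ} (hφ : ContDiff ℝ ∞ φ)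
    (x a b : Fin n → ℝ) : a ⬝ᵥ hessian (fun x => φ (coordsL e x)) x *ᵥ b =
      coordsL e a ⬝ᵥ hessian φ (coordsL e x) *ᵥ coordsL e b := by
  rw [dotProduct_hessian_mulVec (contDiff_comp_coordsL e hφ), dotProduct_hessian_mulVec hφ]
  simp only [fderiv_comp_coordsL e hφ]
  have h1 : ContDiff ℝ ∞ fun y => fderiv ℝ φ y (coordsL e b) :=
    (hφ.fderiv_right (m := ∞) le_rfl).clm_apply contDiff_const
  exact fderiv_comp_coordsL e h1 x a

theorem posDef_hessian_comp_coordsL {φ : (Fin n → ℝ) → ℝ} (hφ : ContDiff ℝ ∞ φ)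
    (hpos : ∀ x, (hessian φ x).PosDef) (x : Fin n → ℝ) :
    (hessian (fun x => φ (coordsL e x)) x).PosDef := by
  refine Matrix.PosDef.of_dotProduct_mulVec_pos ?_ fun v hv => ?_
  · rw [Matrix.IsHermitian, conjTranspose_eq_transpose_of_trivial]
    exact hessian_isSymm (contDiff_comp_coordsL e hφ) x
  · rw [star_trivial, dotProduct_hessian_comp_coordsL e hφ]
    have h := (hpos (coordsL e x)).dotProduct_mulVec_pos ((coordsL e).map_ne_zero_iff.2 hv)
    rwa [star_trivial] at h

theorem ofDualCoords_coordsL (y x : Fin n → ℝ) : ofDualCoords e y (coordsL e x) = y ⬝ᵥ x := by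
  rw [ofDualCoords, _root_.sum_apply, dotProduct]
  refine Finset.sum_congr rfl fun i _ => ?_
  change y i * e.equivFun (e.equivFun.symm x) i = _
  rw [LinearEquiv.apply_symm_apply]

theorem ofDualCoords_injective : Function.Injective (ofDualCoords e) := fun y y' h => by
  ext j
  have := congrArg (fun L : (Fin n → ℝ) →L[ℝ] ℝ => L (coordsL e (Pi.single j 1))) h
  simpa [ofDualCoords_coordsL] using this

/-- In dual coordinates the differential of φ is the gradient of φ read in the basis. This
identifies the domain of the symplectic potential with the range of that gradient. -/
theorem fderiv_eq_ofDualCoords {φ : (Fin n → ℝ) → ℝ} (hφ : ContDiff ℝ ∞ φ) (x : Fin n → ℝ) :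
    fderiv ℝ φ (coordsL e x) = ofDualCoords e (grad (fun x => φ (coordsL e x)) x) := by
  ext1 v
  obtain ⟨v, rfl⟩ := (coordsL e).surjective v
  rw [ofDualCoords_coordsL, ← fderiv_eq_grad_dotProduct, fderiv_comp_coordsL e hφ]

theorem setOf_ofDualCoords_mem_range {φ : (Fin n → ℝ) → ℝ} (hφ : ContDiff ℝ ∞ φ) :
    {y | ofDualCoords e y ∈ range (fderiv ℝ φ)} = range (grad fun x => φ (coordsL e x)) := by
  ext y
  constructor
  · rintro ⟨x, hx⟩
    obtain ⟨x, rfl⟩ := (coordsL e).surjective x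
    rw [fderiv_eq_ofDualCoords e hφ] at hx
    exact ⟨x, ofDualCoords_injective e hx⟩
  · rintro ⟨x, rfl⟩
    exact ⟨coordsL e x, fderiv_eq_ofDualCoords e hφ x⟩

theorem legendre_ofDualCoords (φ : (Fin n → ℝ) → ℝ) (y : Fin n → ℝ) :
    legendre φ (ofDualCoords e y) = ⨆ x, (y ⬝ᵥ x - φ (coordsL e x)) := by
  rw [legendre, ← (coordsL e).surjective.iSup_comp]
  simp only [ofDualCoords_coordsL]

end Coords

/-! ### Poisson commutation and property I in adapted coordinates -/

section Main

variable {n : ℕ} {X : Type*} [TopologicalSpace X] [ChartedSpace (Fin n → ℂ) X]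
  [MulAction (Torus n) X] {x₀ : X} {c : OpenPartialHomeomorph X (Fin n → ℂ)}
  {A : Matrix (Fin n) (Fin n) ℤ} {B : BivectorField n X} {σ : TwoForm n X}
  {e : Module.Basis (Fin n) ℝ (Fin n → ℝ)}

open Matrix

/-- The Darboux relations say that Ξ pulls back to ∑ dxⱼ ∧ dyⱼ, whose inverse is `stdBivector 1`. -/
theorem related_complexCoords (he : IsAdaptedDarbouxBasis B x₀ e) :
    Related (complexCoords e) (stdBivector 1) (logBivector B x₀) := by
  obtain ⟨w, hw, hrr, hii, hri⟩ := he
  have hc : ∀ a, coordsL e a = ∑ i, a i • e i := fun a => coordsL_apply e a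
  have h1 : ∀ a b, flat w (realL n (coordsL e a)) (realL n (coordsL e b)) = 0 := fun a b => by
    simp [hc, _root_.sum_apply, flat_apply, realL_apply, hrr]
  have h2 : ∀ a b, flat w (imagL n (coordsL e a)) (imagL n (coordsL e b)) = 0 := fun a b => by
    simp [hc, _root_.sum_apply, flat_apply, imagL_apply, hii]
  have h3 : ∀ a b, flat w (realL n (coordsL e a)) (imagL n (coordsL e b)) = a ⬝ᵥ b := fun a b => by
    simp [hc, _root_.sum_apply, flat_apply, imagL_apply, realL_apply, hri, dotProduct, mul_comm]
  have h4 : ∀ a b, flat w (imagL n (coordsL e a)) (realL n (coordsL e b)) = -(b ⬝ᵥ a) := by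
    intro a b
    rw [flat_apply, twoForm_swap, ← flat_apply, h3]
  obtain ⟨w', hw'⟩ := exists_twoForm (H := (1 : Matrix (Fin n) (Fin n) ℝ))
  have hinv := stdBivector_isInverse isSymm_one (by simp) hw'
  rw [inv_one] at hinv
  rw [hw.isNondegenerate.eq_inverseOf hw]
  refine related_inverse (complexCoords_surjective e) hw.isNondegenerate (fun u v => ?_) hinv
  rw [hw', ← flat_apply, complexCoords_apply, complexCoords_apply, ← imagL_apply, ← imagL_apply,
    map_add (flat w), _root_.add_apply, map_add, map_add, h1, h2, h3, h4, one_mulVec, one_mulVec]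
  ring

/-- Adapted logarithmic coordinates. -/
def adaptedLog (x₀ : X) (e : Module.Basis (Fin n) ℝ (Fin n → ℝ)) (z : Fin n → ℂ) : X :=
  logMap x₀ (complexCoords e z)

/-- The differential of the adapted logarithmic coordinates. -/
def adaptedLogDeriv (x₀ : X) (e : Module.Basis (Fin n) ℝ (Fin n → ℝ)) (z : Fin n → ℂ) :
    (Fin n → ℂ) →L[ℝ] (Fin n → ℂ) := (logDeriv x₀ (complexCoords e z)).comp (complexCoords e)

theorem IsLogChart.contMDiffAt_adaptedLog (h : IsLogChart x₀ c A) (z : Fin n → ℂ) :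
    ContMDiffAt 𝓘(ℝ, Fin n → ℂ) 𝓘(ℝ, Fin n → ℂ) ∞ (adaptedLog x₀ e) z :=
  ContMDiffAt.comp z ((h.contMDiffAt_logMap _).of_le le_top)
    (complexCoords e).contDiff.contMDiff.contMDiffAt

theorem IsLogChart.hasMFDerivAt_adaptedLog (h : IsLogChart x₀ c A) (z : Fin n → ℂ) :
    HasMFDerivAt 𝓘(ℝ, Fin n → ℂ) 𝓘(ℝ, Fin n → ℂ) (adaptedLog x₀ e) z (adaptedLogDeriv x₀ e z) :=
  (h.hasMFDerivAt_logMap _).comp z (complexCoords e).hasFDerivAt.hasMFDerivAt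

theorem IsLogChart.adaptedLogDeriv_surjective (h : IsLogChart x₀ c A) (z : Fin n → ℂ) :
    Function.Surjective (adaptedLogDeriv x₀ e z) :=
  (h.logDeriv_surjective _).comp (complexCoords_surjective e)

theorem IsToricPoisson.related_adaptedLog (hB : IsToricPoisson B) (h : IsLogChart x₀ c A)
    (he : IsAdaptedDarbouxBasis B x₀ e) (z : Fin n → ℂ) :
    Related (adaptedLogDeriv x₀ e z) (stdBivector 1) (B (adaptedLog x₀ e z)) :=
  (related_complexCoords he).comp (hB.related_logBivector h _)

/-- A real change of basis respects real and imaginary parts, so σ keeps its shape, with the Hessian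
of φ replaced by that of φ in the new coordinates. -/
theorem IsKahlerPotential.related_adaptedLog (hσ : IsKahlerForm σ) (h : IsLogChart x₀ c A)
    {φ : (Fin n → ℝ) → ℝ} (hφ : IsKahlerPotential σ x₀ φ) (z : Fin n → ℂ) :
    Related (adaptedLogDeriv x₀ e z)
      (stdBivector (hessian (fun x => φ (coordsL e x)) (reL n z))⁻¹)
      (inverseBivector σ (adaptedLog x₀ e z)) := by
  obtain ⟨w', hw'⟩ := exists_twoForm (H := hessian (fun x => φ (coordsL e x)) (reL n z))
  refine related_inverse (h.adaptedLogDeriv_surjective z) (hσ.isNondegenerate _) (fun u v => ?_)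
    (stdBivector_isInverse (hessian_isSymm (contDiff_comp_coordsL e hφ.1) _)
      (isUnit_iff_ne_zero.2 (posDef_hessian_comp_coordsL e hφ.1 (hφ.posDef hσ h) _).det_pos.ne')
      hw')
  refine (hw' u v).trans (((isKahlerPotential_iff.1 hφ).2 (complexCoords e z) (complexCoords e u)
    (complexCoords e v)).trans ?_).symm
  simp only [reL_complexCoords, imL_complexCoords, dotProduct_hessian_comp_coordsL e hφ.1]

variable [IsManifold 𝓘(ℝ, Fin n → ℂ) ω X]

/-- Every covector is the differential of a smooth germ. -/
theorem IsLogChart.exists_smoothAt (h : IsLogChart x₀ c A) (z : Fin n → ℂ)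
    (α : (Fin n → ℂ) →L[ℝ] ℝ) :
    ∃ f : X → ℝ, SmoothAt n f (adaptedLog x₀ e z) ∧ fderiv ℝ (f ∘ adaptedLog x₀ e) z = α := by
  set x := adaptedLog x₀ e z
  set ch := chartAt (Fin n → ℂ) x
  have hc : ch ∈ atlas (Fin n → ℂ) X := chart_mem_atlas _ x
  have hx : x ∈ ch.source := mem_chart_source _ x
  have h1 : HasFDerivAt (ch ∘ adaptedLog x₀ e) ((chartDeriv ch x).comp (adaptedLogDeriv x₀ e z))
      z :=
    ((hasMFDerivAt_chart hc hx).comp z (h.hasMFDerivAt_adaptedLog z)).hasFDerivAt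
  have h2 : Function.Surjective (chartDeriv ch x) := fun v => by
    have h3 := chartDeriv_comp_symm hc (ch.map_source hx)
    rw [ch.left_inv hx] at h3
    exact ⟨chartSymmDeriv ch (ch x) v, congrArg (fun L : (Fin n → ℂ) →L[ℝ] (Fin n → ℂ) => L v) h3⟩
  obtain ⟨M, hM⟩ := exists_equiv_of_injective rfl (LinearMap.injective_iff_surjective
    (f := (((chartDeriv ch x).comp (adaptedLogDeriv x₀ e z) : (Fin n → ℂ) →L[ℝ] (Fin n → ℂ)) :
      (Fin n → ℂ) →ₗ[ℝ] (Fin n → ℂ))).2 (h2.comp (h.adaptedLogDeriv_surjective z)))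
  set β : (Fin n → ℂ) →L[ℝ] ℝ := α.comp (M.symm : (Fin n → ℂ) →L[ℝ] (Fin n → ℂ))
  refine ⟨β ∘ ch, smoothAt_covector_comp_chart hc hx β, ?_⟩
  have h4 := (β.hasFDerivAt.comp z h1).fderiv
  refine h4.trans ?_
  rw [← hM]
  ext v
  simp [β]

/-- On the open orbit the bracket is the Schouten tensor of two explicit bivectors. Every covector
is the differential of a smooth germ, so vanishing on functions is vanishing of the tensor; density
of the orbit covers the rest of X. -/
theorem poissonCommute_iff (hB : IsToricPoisson B) (hσ : IsKahlerForm σ)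
    (h : IsLogChart x₀ c A) (hx₀ : Dense (MulAction.orbit (Torus n) x₀))
    {φ : (Fin n → ℝ) → ℝ} (hφ : IsKahlerPotential σ x₀ φ) (he : IsAdaptedDarbouxBasis B x₀ e) :
    PoissonCommute B (inverseBivector σ) ↔ HasPropertyI univ fun x => φ (coordsL e x) := by
  set ψ : (Fin n → ℝ) → ℝ := fun x => φ (coordsL e x)
  have hψ : ContDiff ℝ ∞ ψ := contDiff_comp_coordsL e hφ.1
  have hpos : ∀ x, (hessian ψ x).PosDef := posDef_hessian_comp_coordsL e hφ.1 (hφ.posDef hσ h)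
  have hNs : ∀ x, ((hessian ψ x)⁻¹).IsSymm := fun x => by
    have := (hpos x).inv.isHermitian
    rwa [Matrix.IsHermitian, conjTranspose_eq_transpose_of_trivial] at this
  have hN : ∀ x i j, ContDiffAt ℝ 1 (fun y => (hessian ψ y)⁻¹ i j) x := fun x =>
    contDiffAt_matrix_inv (fun i j => (contDiff_hessian hψ i j).contDiffAt.of_le
      (WithTop.coe_le_coe.2 le_top)) (hpos x).det_pos.ne'
  have hd : ∀ x i j, DifferentiableAt ℝ (fun y => (hessian ψ y)⁻¹ i j) x := fun x i j =>
    (hN x i j).differentiableAt one_ne_zero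
  have hsch : ∀ z (f g k : X → ℝ), SmoothAt n f (adaptedLog x₀ e z) →
      SmoothAt n g (adaptedLog x₀ e z) → SmoothAt n k (adaptedLog x₀ e z) →
      schouten B (inverseBivector σ) f g k (adaptedLog x₀ e z) =
        schoutenTensor (fun _ => stdBivector 1) (fun z => stdBivector (hessian ψ (reL n z))⁻¹) z
          (fderiv ℝ (f ∘ adaptedLog x₀ e) z) (fderiv ℝ (g ∘ adaptedLog x₀ e) z)
          (fderiv ℝ (k ∘ adaptedLog x₀ e) z) := fun z f g k hf hg hk =>
    schouten_eq_schoutenTensor hB.toIsPoisson.toIsBivectorField hσ.isBivectorField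
      (h.contMDiffAt_adaptedLog z) (.of_forall h.hasMFDerivAt_adaptedLog)
      (.of_forall (hB.related_adaptedLog h he)) (.of_forall (hφ.related_adaptedLog hσ h))
      (differentiableAt_const _)
      ((contDiffAt_stdBivector (hN (reL n z))).differentiableAt one_ne_zero)
      (stdBivector_antisymm isSymm_one) (stdBivector_antisymm (hNs _)) hf hg hk
  constructor
  · intro hcomm
    refine ⟨isOpen_univ, isConnected_univ, hψ.contDiffOn, fun x _ => hpos x, fun x _ => ?_⟩
    refine (matDeriv_symm_iff (hd x)).1 ?_
    -- The coefficients depend on Re z only, so the real points of ℂⁿ suffice.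
    rw [← reL_realL x]
    refine (schoutenTensor_stdBivector (z := realL n x) hNs (hN _)).1 fun α β γ => ?_
    obtain ⟨f, hf, hfα⟩ := h.exists_smoothAt (e := e) (realL n x) α
    obtain ⟨g, hg, hgβ⟩ := h.exists_smoothAt (e := e) (realL n x) β
    obtain ⟨k, hk, hkγ⟩ := h.exists_smoothAt (e := e) (realL n x) γ
    rw [← hfα, ← hgβ, ← hkγ, ← hsch _ f g k hf hg hk]
    exact hcomm _ f g k hf hg hk
  · intro hI
    refine poissonCommute_of_dense hB.toIsPoisson.toIsBivectorField hσ.isBivectorField hx₀ ?_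
    intro x hx f g k hf hg hk
    rw [← range_logMap] at hx
    obtain ⟨z, rfl⟩ := hx
    obtain ⟨z, rfl⟩ := complexCoords_surjective e z
    exact (hsch z f g k hf hg hk).trans ((schoutenTensor_stdBivector hNs (hN _)).2
      ((matDeriv_symm_iff (hd _)).2 (hI.symm_deriv _ (mem_univ _))) _ _ _)

end Main

end ToricPoisson

end
theorem mainTheorem3 (n : ℕ) (X : Type*) [TopologicalSpace X] [ChartedSpace (Fin n → ℂ) X]
    [MulAction (ToricPoisson.Torus n) X] (hX : ToricPoisson.IsSmoothToricVariety n X)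
    (B : ToricPoisson.BivectorField n X) (hB : ToricPoisson.IsToricPoisson B)
    (hreal : ToricPoisson.IsTotallyReal B)
    (σ : ToricPoisson.TwoForm n X) (hσ : ToricPoisson.IsKahlerForm σ)
    (hham : ToricPoisson.IsHamiltonianAction σ)
    (x₀ : X) (hx₀ : Dense (MulAction.orbit (ToricPoisson.Torus n) x₀)) :
    (∃ φ, ToricPoisson.IsKahlerPotential σ x₀ φ) ∧
    (∃ e, ToricPoisson.IsAdaptedDarbouxBasis B x₀ e) ∧
    ∀ φ, ToricPoisson.IsKahlerPotential σ x₀ φ →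
      ∀ e, ToricPoisson.IsAdaptedDarbouxBasis B x₀ e →
        List.TFAE [
          ToricPoisson.PoissonCommute B (ToricPoisson.inverseBivector σ),
          ToricPoisson.HasPropertyI univ (fun x => φ (ToricPoisson.ofCoords e x)),
          ToricPoisson.HasPropertyI {y | ToricPoisson.ofDualCoords e y ∈ range (fderiv ℝ φ)}
            (fun y => ToricPoisson.legendre φ (ToricPoisson.ofDualCoords e y))] := by
  have := hX.isManifold
  have : IsManifold 𝓘(ℝ, Fin n → ℂ) ω X := ToricPoisson.isManifold_restrictScalars
  obtain ⟨c, A, h⟩ := hX.exists_isLogChart hx₀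
  refine ⟨ToricPoisson.exists_isKahlerPotential hσ hham h,
    hB.exists_isAdaptedDarbouxBasis hreal h, fun φ hφ e he => ?_⟩
  -- In coordinates the third condition concerns the ordinary Legendre transform of ψ on the range
  -- of ∇ψ.
  simp only [← ToricPoisson.coordsL_apply, ToricPoisson.legendre_ofDualCoords,
    ToricPoisson.setOf_ofDualCoords_mem_range e hφ.1]
  tfae_have 1 ↔ 2 := ToricPoisson.poissonCommute_iff hB hσ h hx₀ hφ he
  tfae_have 2 ↔ 3 := ToricPoisson.hasPropertyI_iff_legendre
    (ToricPoisson.contDiff_comp_coordsL e hφ.1)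
    (ToricPoisson.posDef_hessian_comp_coordsL e hφ.1 (hφ.posDef hσ h))
  tfae_finish
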